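/- Let $\mathbb D=\mathbb R^2\times[0,1]$, with either periodic boundary conditions in $x_3$ or stress-free ones ($\partial_3u_1=\partial_3u_2=u_3=\theta=0$ at $x_3=0,1$), for fields $v=(u,\theta)=(u_1,u_2,u_3,\theta)$ on $\mathbb D$. Let $\hat v(k)$, $k=(k_h,k_3)$, be the Fourier transform in $x_h=(x_1,x_2)$ combined with the Fourier series in $x_3$: in the modes $e^{ik_3x_3}$, $k_3=2\pi n$, in the periodic case; in the modes $\cos(k_3x_3)$ for $u_1,u_2$ and $\sin(k_3x_3)$ for $u_3,\theta$, $k_3=\pi n$, in the stress-free case. Let $Q$ be the barotropic projection: $Qv=\int_0^1 v\,dx_3$ in the periodic case, $Qv=(\int_0^1u_1\,dx_3,\int_0^1u_2\,dx_3,0,0)$ in the stress-free case. For $\Gamma,\Omega\in\mathbb R\setminus\{0\}$ put $\eta=\Omega/\Gamma$ and $$J_\eta=\begin{pmatrix}\eta J&0\\0&J\end{pmatrix},\qquad J=\begin{pmatrix}0&-1\\1&0\end{pmatrix},$$ let $\mathbb P$ be the Helmholtz projection onto divergence-free fields (acting on $u$, and as the identity on $\theta$), and let $S$ be the projection onto the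 geostrophic mode, $\widehat{Sv}(k)=\langle a_g(k),\hat v(k)\rangle_{\mathbb C^4}\,a_g(k)$, where $$a_g(k)=\frac{1}{|k_\eta|}\,(ik_2,\,-ik_1,\,0,\,-ik_3\eta)^T\ \text{(periodic)},\qquad a_g(k)=\frac1{|k_\eta|}\,(ik_2,\,-ik_1,\,0,\,k_3\eta)^T\ \text{(stress-free)},\qquad k_\eta=(k_1,k_2,\eta k_3).$$ For every $R>0$ and $\Gamma_0>0$ there is a constant $C>0$, depending only on $R$ and $\Gamma_0$, such that for all real $\Gamma,\Omega$ with $|\Gamma|\ge\Gamma_0$ and $\Omega\ne0$, and for all $\tilde v_0\in(I-Q)L^2(\mathbb D)^4$ with $\operatorname{div}\tilde u_0=0$ and $\operatorname{supp}\widehat{\tilde v}_0\subset B_R=\{|k|\le R\}$, the projection $S\tilde v_0\in L^2(\mathbb D)^4$ is defined, and the linear equation $$\partial_t\tilde v+\Gamma\,\mathbb PJ_\eta\mathbb P\,\tilde v=\Delta\tilde v,\qquad \operatorname{div}\tilde u=0,\qquad \tilde v(0)=\tilde v_0,$$ has a baroclinic solution in $C([0,\infty);L^2)$ that satisfies the equation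 in $L^2(\mathbb D)^4$ for every $t>0$, and every such solution satisfies $$\|\tilde v\|_{L^1(\mathbb R_+,L^\infty(\mathbb D))}\le C\left(|\eta|^{-1/4}\,\|(1-S)\tilde v_0\|_{L^2(\mathbb D)}+\|S\tilde v_0\|_{L^2(\mathbb D)}\right).$$ In particular, for fixed $\Gamma\neq0$ the constant depends only on $R$ (and $\Gamma$), not on $\Omega$. -/

import Mathlib

open MeasureTheory Set
open scoped ENNReal FourierTransform

noncomputable section

namespace RotatingStratified

/-- Boundary conditions in the vertical variable `x₃` on the layer `ℝ² × [0,1]`: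
`periodic`: all components are `1`-periodic in `x₃`;
`stressFree`: `∂₃ u₁ = ∂₃ u₂ = u₃ = θ = 0` at `x₃ = 0, 1`. -/
inductive VerticalBC
  | periodic
  | stressFree

/-- The horizontal plane `ℝ²`. -/
abbrev Plane := EuclideanSpace ℝ (Fin 2)

/-- Values of the fields `v = (u₁, u₂, u₃, θ)`. Complex values are allowed; real fields are a
special case. -/
abbrev Vec4 := EuclideanSpace ℂ (Fin 4)

/-- Lebesgue measure on the unit interval. -/
abbrev unitMeasure : Measure ℝ := volume.restrict (Icc (0 : ℝ) 1)

/-- Lebesgue measure on the layer `𝔻 = ℝ² × [0,1]`. -/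
abbrev layerMeasure : Measure (Plane × ℝ) := (volume : Measure Plane).prod unitMeasure

/-- The space `L²(𝔻)⁴`. -/
abbrev L2Layer := Lp Vec4 2 layerMeasure

/-! ### Fourier transform on the layer -/

/-- Vertical wave number of the `n`-th vertical mode: `k₃ = 2πn` for periodic and `k₃ = πn` for
stress-free boundary conditions. -/
def vertFreq (bc : VerticalBC) (n : ℤ) : ℝ :=
  match bc with
  | .periodic => 2 * Real.pi * n
  | .stressFree => Real.pi * n

/-- Vertical analysing functions. Periodic: `exp (-2πi n x₃)` for every component. Stress-free:
`cos (πn x₃)` for `u₁, u₂` and `sin (πn x₃)` for `u₃, θ`; here the modes `n` and `-n` carry the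
same information (even and odd extension), and for `n = 0` only the vertical means of `u₁, u₂`
are seen. -/
def vertProfile (bc : VerticalBC) (n : ℤ) (x₃ : ℝ) (j : Fin 4) : ℂ :=
  match bc with
  | .periodic => Complex.exp (-((vertFreq .periodic n * x₃ : ℝ) : ℂ) * Complex.I)
  | .stressFree =>
      if j.val < 2 then ((Real.cos (vertFreq .stressFree n * x₃) : ℝ) : ℂ)
      else ((Real.sin (vertFreq .stressFree n * x₃) : ℝ) : ℂ)

/-- The integrand `x ↦ (profileⱼ(x₃) fⱼ(x))ⱼ` of the vertical Fourier coefficient. -/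
def vertIntegrand (bc : VerticalBC) (n : ℤ) (f : Plane × ℝ → Vec4) (x : Plane × ℝ) : Vec4 :=
  WithLp.toLp 2 fun j => vertProfile bc n x.2 j * f x j

/-- The `n`-th vertical Fourier coefficient
`x_h ↦ ∫₀¹ (profileⱼ(x₃) fⱼ(x_h, x₃))ⱼ dx₃` of a field on the layer. -/
def vertCoeffFun (bc : VerticalBC) (n : ℤ) (f : Plane × ℝ → Vec4) (xh : Plane) : Vec4 :=
  ∫ x₃, vertIntegrand bc n f (xh, x₃) ∂unitMeasure

theorem norm_vertProfile_le (bc : VerticalBC) (n : ℤ) (x₃ : ℝ) (j : Fin 4) :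
    ‖vertProfile bc n x₃ j‖ ≤ 1 := by
  cases bc with
  | periodic =>
      simp only [vertProfile]
      rw [← Complex.ofReal_neg, Complex.norm_exp_ofReal_mul_I]
  | stressFree =>
      simp only [vertProfile]
      split_ifs
      · rw [Complex.norm_real]; exact Real.abs_cos_le_one _
      · rw [Complex.norm_real]; exact Real.abs_sin_le_one _

theorem continuous_vertProfile (bc : VerticalBC) (n : ℤ) (j : Fin 4) :
    Continuous fun x₃ : ℝ => vertProfile bc n x₃ j := by
  cases bc with
  | periodic => simp only [vertProfile]; fun_prop
  | stressFree =>
      simp only [vertProfile]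
      split_ifs <;> fun_prop

theorem norm_vertIntegrand_le (bc : VerticalBC) (n : ℤ) (f : Plane × ℝ → Vec4) (x : Plane × ℝ) :
    ‖vertIntegrand bc n f x‖ ≤ ‖f x‖ := by
  rw [EuclideanSpace.norm_eq, EuclideanSpace.norm_eq]
  refine Real.sqrt_le_sqrt (Finset.sum_le_sum fun j _ => ?_)
  have h : ‖vertIntegrand bc n f x j‖ ≤ ‖f x j‖ := by
    simp only [vertIntegrand, norm_mul]
    exact mul_le_of_le_one_left (norm_nonneg _) (norm_vertProfile_le bc n x.2 j)
  gcongr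

theorem aestronglyMeasurable_vertIntegrand (bc : VerticalBC) (n : ℤ) {f : Plane × ℝ → Vec4}
    (hf : AEStronglyMeasurable f layerMeasure) :
    AEStronglyMeasurable (vertIntegrand bc n f) layerMeasure := by
  have h1 : AEStronglyMeasurable (fun x => fun j => vertProfile bc n x.2 j * f x j)
      layerMeasure := by
    refine (aemeasurable_pi_iff.2 fun j => AEStronglyMeasurable.aemeasurable ?_).aestronglyMeasurable
    refine AEStronglyMeasurable.mul ?_ ?_
    · exact ((continuous_vertProfile bc n j).comp continuous_snd).aestronglyMeasurable
    · exact (EuclideanSpace.proj (𝕜 := ℂ) j).continuous.comp_aestronglyMeasurable hf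
  exact (PiLp.continuous_toLp 2 _).comp_aestronglyMeasurable h1

theorem memLp_vertCoeffFun (bc : VerticalBC) (n : ℤ) (f : L2Layer) :
    MemLp (vertCoeffFun bc n f) 2 (volume : Measure Plane) := by
  have hf := Lp.memLp f
  have hm := aestronglyMeasurable_vertIntegrand bc n hf.1
  refine ⟨hm.integral_prod_right', ?_⟩
  rw [eLpNorm_lt_top_iff_lintegral_rpow_enorm_lt_top two_ne_zero ENNReal.ofNat_ne_top]
  have hfin : ∫⁻ x, ‖f x‖ₑ ^ (2 : ℝ) ∂layerMeasure < ∞ := by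
    have := (eLpNorm_lt_top_iff_lintegral_rpow_enorm_lt_top two_ne_zero
      ENNReal.ofNat_ne_top).1 hf.2
    simpa using this
  have hfm : AEMeasurable (fun x => ‖f x‖ₑ ^ (2 : ℝ)) layerMeasure :=
    hf.1.enorm.pow_const _
  rw [lintegral_prod _ hfm] at hfin
  refine lt_of_le_of_lt (lintegral_mono_ae ?_) hfin
  filter_upwards [hm.prodMk_left] with xh hxh
  have hprob : unitMeasure univ = 1 := by simp
  have h1 : ‖vertCoeffFun bc n f xh‖ₑ
      ≤ eLpNorm (fun x₃ => vertIntegrand bc n f (xh, x₃)) 1 unitMeasure := by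
    rw [eLpNorm_one_eq_lintegral_enorm]
    exact enorm_integral_le_lintegral_enorm _
  have h2 : eLpNorm (fun x₃ => vertIntegrand bc n f (xh, x₃)) 1 unitMeasure
      ≤ eLpNorm (fun x₃ => vertIntegrand bc n f (xh, x₃)) 2 unitMeasure := by
    have : IsProbabilityMeasure unitMeasure := ⟨hprob⟩
    exact eLpNorm_le_eLpNorm_of_exponent_le (by norm_num) hxh
  have h3 : eLpNorm (fun x₃ => vertIntegrand bc n f (xh, x₃)) 2 unitMeasure
      ≤ eLpNorm (fun x₃ => f (xh, x₃)) 2 unitMeasure :=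
    eLpNorm_mono fun x₃ => norm_vertIntegrand_le bc n f (xh, x₃)
  have h4 := (h1.trans h2).trans h3
  rw [eLpNorm_eq_lintegral_rpow_enorm_toReal two_ne_zero ENNReal.ofNat_ne_top] at h4
  have h5 := ENNReal.rpow_le_rpow h4 (z := (2 : ℝ)) (by norm_num)
  rw [← ENNReal.rpow_mul] at h5
  simpa using h5

/-- The `n`-th vertical Fourier coefficient as an element of `L²(ℝ²)⁴`. -/
def vertCoeff (bc : VerticalBC) (n : ℤ) (f : L2Layer) : Lp Vec4 2 (volume : Measure Plane) :=
  (memLp_vertCoeffFun bc n f).toLp _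

/-- The Fourier transform of `f ∈ L²(𝔻)⁴`: the family, indexed by the vertical mode `n`, of the
(Plancherel) Fourier transforms of the vertical Fourier coefficients. Mathlib's Fourier transform
is `∫ exp (-2πi x·ξ) g(x) dx`, so the horizontal wave vector is `k_h = 2πξ`. -/
def layerFourier (bc : VerticalBC) (f : L2Layer) (n : ℤ) :
    Lp Vec4 2 (volume : Measure Plane) :=
  𝓕 (vertCoeff bc n f)

/-- The wave vector `k = (2πξ₁, 2πξ₂, k₃)`, where `k₃` is the `n`-th vertical wave number. -/
def waveVector (bc : VerticalBC) (n : ℤ) (ξ : Plane) : Fin 3 → ℝ :=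
  ![2 * Real.pi * ξ 0, 2 * Real.pi * ξ 1, vertFreq bc n]

/-- `|k|²`. -/
def normSq (k : Fin 3 → ℝ) : ℝ := k 0 ^ 2 + k 1 ^ 2 + k 2 ^ 2

/-! ### The linear operator -/

/-- Symbol of the divergence: `div u` has Fourier coefficients `divSymbol ⬝ᵥ v̂`. -/
def divSymbol (bc : VerticalBC) (k : Fin 3 → ℝ) : Fin 4 → ℂ :=
  match bc with
  | .periodic => ![Complex.I * k 0, Complex.I * k 1, Complex.I * k 2, 0]
  | .stressFree => ![Complex.I * k 0, Complex.I * k 1, k 2, 0]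

/-- Symbol of `∇̃ = (∂₁, ∂₂, ∂₃, 0)` acting on scalars (with the vertical profiles
`exp (2πi n x₃)`, respectively `cos (πn x₃)`). -/
def gradSymbol (bc : VerticalBC) (k : Fin 3 → ℝ) : Fin 4 → ℂ :=
  match bc with
  | .periodic => ![Complex.I * k 0, Complex.I * k 1, Complex.I * k 2, 0]
  | .stressFree => ![Complex.I * k 0, Complex.I * k 1, -(k 2 : ℂ), 0]

/-- Symbol `P(k) = I - ∇̃ Δ⁻¹ div` of the Helmholtz projection: it acts on the velocity block and
is the identity on `θ`. In the periodic case the velocity block is `δᵢⱼ - kᵢ kⱼ / |k|²`. -/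
def helmholtz (bc : VerticalBC) (k : Fin 3 → ℝ) : Matrix (Fin 4) (Fin 4) ℂ :=
  1 + ((normSq k : ℂ)⁻¹) • Matrix.vecMulVec (gradSymbol bc k) (divSymbol bc k)

/-- `J_η = Γ⁻¹ J_{Ω,Γ}`, with `η = Ω / Γ`: rotation (`e₃ × u`) and buoyancy terms. -/
def coriolisBuoyancy (η : ℝ) : Matrix (Fin 4) (Fin 4) ℂ :=
  !![0, -(η : ℂ), 0, 0;
     (η : ℂ), 0, 0, 0;
     0, 0, 0, -1;
     0, 0, 1, 0]

/-- Symbol of `ℙ J_η ℙ`. -/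
def pjpSymbol (bc : VerticalBC) (η : ℝ) (k : Fin 3 → ℝ) : Matrix (Fin 4) (Fin 4) ℂ :=
  helmholtz bc k * coriolisBuoyancy η * helmholtz bc k

/-- `div u = 0` for `f = (u, θ)`. -/
def IsDivFree (bc : VerticalBC) (f : L2Layer) : Prop :=
  ∀ n : ℤ, ∀ᵐ ξ : Plane, divSymbol bc (waveVector bc n ξ) ⬝ᵥ (layerFourier bc f n ξ).ofLp = 0

/-- `f ∈ (I - Q) L²(𝔻)⁴`, where `Q` is the barotropic projection: the vertical mean of all four
components for periodic boundary conditions, and `Q v = (∫₀¹ u₁ dx₃, ∫₀¹ u₂ dx₃, 0, 0)` for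
stress-free boundary conditions. -/
def IsBaroclinic (bc : VerticalBC) (f : L2Layer) : Prop :=
  ∀ j : Fin 4, (bc = .periodic ∨ j.val < 2) →
    ∀ᵐ xh : Plane, ∫ x₃, f (xh, x₃) j ∂unitMeasure = 0

/-- `supp f̂ ⊆ B_R = {k : |k| ≤ R}`. -/
def HasFourierSupportIn (bc : VerticalBC) (R : ℝ) (f : L2Layer) : Prop :=
  ∀ n : ℤ, ∀ᵐ ξ : Plane,
    R < Real.sqrt (normSq (waveVector bc n ξ)) → layerFourier bc f n ξ = 0

/-- The normalised geostrophic eigenvector `a_g(k)`, spanning, for `η ≠ 0` and `k₃ ≠ 0`, the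
kernel of the symbol of `ℙ J_η ℙ` among the divergence-free vectors:
`|k_η|⁻¹ (i k₂, -i k₁, 0, -i k₃ η)` for periodic and `|k_η|⁻¹ (i k₂, -i k₁, 0, k₃ η)` for
stress-free boundary conditions, where `k_η = (k₁, k₂, η k₃)`. -/
def geoVector (bc : VerticalBC) (η : ℝ) (k : Fin 3 → ℝ) : Fin 4 → ℂ :=
  ((Real.sqrt (normSq ![k 0, k 1, η * k 2]) : ℝ) : ℂ)⁻¹ •
    match bc with
    | .periodic => ![Complex.I * k 1, -(Complex.I * k 0), 0, -(Complex.I * k 2 * η)]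
    | .stressFree => ![Complex.I * k 1, -(Complex.I * k 0), 0, (k 2 : ℂ) * η]

/-- `g = S f`, where `S` is the projection onto the geostrophic mode:
`ĝ(k) = ⟨a_g(k), f̂(k)⟩ a_g(k)`. -/
def IsGeostrophicPart (bc : VerticalBC) (η : ℝ) (f g : L2Layer) : Prop :=
  ∀ n : ℤ, ∀ᵐ ξ : Plane,
    (layerFourier bc g n ξ).ofLp =
      (star (geoVector bc η (waveVector bc n ξ)) ⬝ᵥ (layerFourier bc f n ξ).ofLp) •
        geoVector bc η (waveVector bc n ξ)

/-- `g = Δ f - Γ ℙ J_η ℙ f` in `L²(𝔻)⁴` (in particular `f` is in the domain of this operator),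
with `η = Ω / Γ`. -/
def IsGeneratorImage (bc : VerticalBC) (Γ Ω : ℝ) (f g : L2Layer) : Prop :=
  ∀ n : ℤ, ∀ᵐ ξ : Plane,
    (layerFourier bc g n ξ).ofLp =
      -((normSq (waveVector bc n ξ) : ℂ) • (layerFourier bc f n ξ).ofLp)
        - (Γ : ℂ) • (pjpSymbol bc (Ω / Γ) (waveVector bc n ξ)).mulVec
            (layerFourier bc f n ξ).ofLp

/-- `v` is the (classical, `L²`-valued) solution on `[0, ∞)` of
`∂ₜ v + Γ ℙ J_η ℙ v = Δ v`, `div u = 0`, `v(0) = v₀`, in the space of baroclinic fields: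
`v ∈ C([0,∞); L²)`, and for every `t > 0` the time derivative of `v` exists in `L²`,
`v(t)` lies in the domain of the operator, and the equation holds. -/
structure IsSolution (bc : VerticalBC) (Γ Ω : ℝ) (v₀ : L2Layer) (v : ℝ → L2Layer) : Prop where
  initial : v 0 = v₀
  continuousOn : ContinuousOn v (Ici 0)
  equation : ∀ t : ℝ, 0 < t → ∃ w : L2Layer, HasDerivAt v w t ∧ IsGeneratorImage bc Γ Ω (v t) w
  divFree : ∀ t : ℝ, 0 ≤ t → IsDivFree bc (v t)
  baroclinic : ∀ t : ℝ, 0 ≤ t → IsBaroclinic bc (v t)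

/-- The norm of `L¹(ℝ₊, L^∞(𝔻))`. -/
def normL1Linfty (v : ℝ → L2Layer) : ℝ≥0∞ :=
  ∫⁻ t in Ioi (0 : ℝ), eLpNorm (v t) ∞ layerMeasure

end RotatingStratified

end

noncomputable section

namespace RotatingStratified

/-! ### The symbol of the linear operator -/

/-! On the Fourier side the equation is an ODE in `ℂ⁴` at every wave vector `k`. Let `N` be the
symbol of `ℙ J_η ℙ`. It is skew-Hermitian, kills the geostrophic vector, and on divergence-free
vectors satisfies `N² = -ω² (1 - S)` with `ω = |k_η| / |k|` (`pjpSymbol_pjpSymbol`). Hence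
divergence-free vectors split into the range of `S`, which does not oscillate, and the two parts `½
((1 - S) ± i ω⁻¹ N (1 - S))`, and the solution is the sum of three pieces with rates `-|k|²` and
`-|k|² ± iΓω`. Baroclinicity removes the mode `n = 0` and the support condition bounds `|n|`, so
only finitely many vertical modes occur, each with `|k₃| ≥ π`. Every piece therefore decays at least
like `exp (-t)`, all sums are finite, and existence is explicit. Uniqueness follows from the energy
inequality, since `N` is skew and `Δ` is dissipative.

For the estimate, one mode evaluated at a point `x` is the inner product of the initial profile with
a vector `evalFlow … x t` in `L²`. The geostrophic piece needs only Cauchy-Schwarz (a Bernstein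
inequality) and `∫ exp (-t) dt = 1`. For the oscillating pieces with `η² ≥ 2` a `TT*` argument is
used (`lintegral_iSup_inner_le`): the supremum over points is linearised by a measurable choice of
the point, and the bound reduces to the inner products of `evalFlow … x s` and `evalFlow … y t`,
uniformly in `x` and `y`. These are oscillatory integrals over horizontal frequencies with phase `±Γ
(s - t) ω` plus a linear term.

Such an integral is estimated by the second derivative test in one variable only
(`norm_oscillatory_le`). Along lines in a direction `u`, the second derivative of `ω` is at most a
negative multiple of `|η|`, as long as the frequency stays in the sector where `|u · ξ| ≤ |ξ| / 2`
(`le_neg_layerDisp''`). Three such sectors cover the plane, so the data are cut into three pieces.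
The kernel is then `O(exp (-(s + t)) |η|^(-1/2) |s - t|^(-1/2))`. The singularity is integrable, so
one-dimensional decay suffices, and the square root taken in `TT*` produces `|η|^(-1/4)`. If `η² <
2`, the weight `|η|^(-1/4)` is at least `1/2` and the bound by heat decay is enough. -/

theorem vertFreq_neg (bc : VerticalBC) (n : ℤ) : vertFreq bc (-n) = -vertFreq bc n := by
  cases bc <;> simp [vertFreq]

theorem pi_le_abs_vertFreq (bc : VerticalBC) {n : ℤ} (hn : n ≠ 0) :
    Real.pi ≤ |vertFreq bc n| := by
  have h1 : (1 : ℝ) ≤ |(n : ℝ)| := by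
    have := Int.one_le_abs hn
    exact_mod_cast this
  have hpi := Real.pi_pos
  cases bc
  · simp only [vertFreq, abs_mul, abs_of_pos hpi, abs_two]
    nlinarith
  · simp only [vertFreq, abs_mul, abs_of_pos hpi]
    nlinarith

theorem helmholtz_mulVec (bc : VerticalBC) (k : Fin 3 → ℝ) (w : Fin 4 → ℂ) :
    (helmholtz bc k).mulVec w =
      w + ((normSq k : ℂ)⁻¹ * (divSymbol bc k ⬝ᵥ w)) • gradSymbol bc k := by
  rw [helmholtz, Matrix.add_mulVec, Matrix.one_mulVec, Matrix.smul_mulVec,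
    Matrix.vecMulVec_mulVec]
  ext j
  simp
  ring

theorem divSymbol_dotProduct_gradSymbol (bc : VerticalBC) (k : Fin 3 → ℝ) :
    divSymbol bc k ⬝ᵥ gradSymbol bc k = -(normSq k : ℂ) := by
  have hI := Complex.I_mul_I
  cases bc <;>
    simp [divSymbol, gradSymbol, normSq, dotProduct, Fin.sum_univ_four]
  · linear_combination ((k 0 : ℂ) ^ 2 + (k 1 : ℂ) ^ 2 + (k 2 : ℂ) ^ 2) * hI
  · linear_combination ((k 0 : ℂ) ^ 2 + (k 1 : ℂ) ^ 2) * hI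

theorem divSymbol_helmholtz (bc : VerticalBC) {k : Fin 3 → ℝ} (hk : normSq k ≠ 0)
    (w : Fin 4 → ℂ) : divSymbol bc k ⬝ᵥ (helmholtz bc k).mulVec w = 0 := by
  have hk' : (normSq k : ℂ) ≠ 0 := by exact_mod_cast hk
  rw [helmholtz_mulVec, dotProduct_add, dotProduct_smul, divSymbol_dotProduct_gradSymbol,
    smul_eq_mul]
  field_simp
  ring

theorem helmholtz_mulVec_of_div_eq_zero (bc : VerticalBC) (k : Fin 3 → ℝ) {w : Fin 4 → ℂ}
    (hw : divSymbol bc k ⬝ᵥ w = 0) : (helmholtz bc k).mulVec w = w := by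
  rw [helmholtz_mulVec, hw]; simp

theorem divSymbol_pjpSymbol (bc : VerticalBC) (η : ℝ) {k : Fin 3 → ℝ} (hk : normSq k ≠ 0)
    (w : Fin 4 → ℂ) : divSymbol bc k ⬝ᵥ (pjpSymbol bc η k).mulVec w = 0 := by
  rw [pjpSymbol, Matrix.mul_assoc, ← Matrix.mulVec_mulVec, divSymbol_helmholtz bc hk]

theorem coriolisBuoyancy_mulVec (η : ℝ) (w : Fin 4 → ℂ) :
    (coriolisBuoyancy η).mulVec w = ![-(η * w 1), η * w 0, -w 3, w 2] := by
  ext j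
  fin_cases j <;> simp [coriolisBuoyancy, Matrix.mulVec, dotProduct, Fin.sum_univ_four]

theorem pjpSymbol_mulVec_of_div_eq_zero (bc : VerticalBC) (η : ℝ) (k : Fin 3 → ℝ)
    {w : Fin 4 → ℂ} (hw : divSymbol bc k ⬝ᵥ w = 0) :
    (pjpSymbol bc η k).mulVec w = ![-(η * w 1), η * w 0, -w 3, w 2] +
      ((normSq k : ℂ)⁻¹ * (divSymbol bc k ⬝ᵥ ![-(η * w 1), η * w 0, -w 3, w 2])) •
        gradSymbol bc k := by
  rw [pjpSymbol, ← Matrix.mulVec_mulVec, helmholtz_mulVec_of_div_eq_zero bc k hw,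
    ← Matrix.mulVec_mulVec, coriolisBuoyancy_mulVec, helmholtz_mulVec]

/-- The squared dispersion relation `|k_η|² / |k|²`. -/
def dispersionSq (η : ℝ) (k : Fin 3 → ℝ) : ℝ := normSq ![k 0, k 1, η * k 2] / normSq k

/-- The dispersion relation `|k_η| / |k|`. -/
def dispersion (η : ℝ) (k : Fin 3 → ℝ) : ℝ := Real.sqrt (dispersionSq η k)

theorem normSq_pos {k : Fin 3 → ℝ} (hk : k 2 ≠ 0) : 0 < normSq k := by
  have := sq_nonneg (k 0); have := sq_nonneg (k 1); have := sq_pos_of_ne_zero hk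
  rw [normSq]; linarith

theorem normSq_scaled_pos {η : ℝ} {k : Fin 3 → ℝ} (hη : η ≠ 0) (hk : k 2 ≠ 0) :
    0 < normSq ![k 0, k 1, η * k 2] := normSq_pos (by simp [hη, hk])

theorem dispersionSq_pos {η : ℝ} {k : Fin 3 → ℝ} (hη : η ≠ 0) (hk : k 2 ≠ 0) :
    0 < dispersionSq η k := div_pos (normSq_scaled_pos hη hk) (normSq_pos hk)

theorem dispersion_pos {η : ℝ} {k : Fin 3 → ℝ} (hη : η ≠ 0) (hk : k 2 ≠ 0) :
    0 < dispersion η k := Real.sqrt_pos.2 (dispersionSq_pos hη hk)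

/-- The unnormalised geostrophic vector. -/
def geoVectorAux (bc : VerticalBC) (η : ℝ) (k : Fin 3 → ℝ) : Fin 4 → ℂ :=
  match bc with
    | .periodic => ![Complex.I * k 1, -(Complex.I * k 0), 0, -(Complex.I * k 2 * η)]
    | .stressFree => ![Complex.I * k 1, -(Complex.I * k 0), 0, (k 2 : ℂ) * η]

theorem geoVector_eq (bc : VerticalBC) (η : ℝ) (k : Fin 3 → ℝ) :
    geoVector bc η k =
      ((Real.sqrt (normSq ![k 0, k 1, η * k 2]) : ℝ) : ℂ)⁻¹ • geoVectorAux bc η k := by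
  cases bc <;> rfl

theorem divSymbol_geoVector (bc : VerticalBC) (η : ℝ) (k : Fin 3 → ℝ) :
    divSymbol bc k ⬝ᵥ geoVector bc η k = 0 := by
  rw [geoVector_eq, dotProduct_smul]
  have : divSymbol bc k ⬝ᵥ geoVectorAux bc η k = 0 := by
    cases bc <;> simp [divSymbol, geoVectorAux, dotProduct, Fin.sum_univ_four] <;> ring
  rw [this, smul_zero]

/-- Geostrophic balance: the rotation and buoyancy terms of this vector form the gradient of a
pressure, which the Helmholtz projection annihilates. -/
theorem pjpSymbol_geoVector (bc : VerticalBC) (η : ℝ) {k : Fin 3 → ℝ} (hk : k 2 ≠ 0) :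
    (pjpSymbol bc η k).mulVec (geoVector bc η k) = 0 := by
  have hk' : (normSq k : ℂ) ≠ 0 := by exact_mod_cast (normSq_pos hk).ne'
  rw [geoVector_eq, Matrix.mulVec_smul]
  have h0 : divSymbol bc k ⬝ᵥ geoVectorAux bc η k = 0 := by
    cases bc <;> simp [divSymbol, geoVectorAux, dotProduct, Fin.sum_univ_four] <;> ring
  have h1 : (![-(η * geoVectorAux bc η k 1), η * geoVectorAux bc η k 0,
      -geoVectorAux bc η k 3, geoVectorAux bc η k 2] : Fin 4 → ℂ) =
        (η : ℂ) • gradSymbol bc k := by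
    ext j
    cases bc <;> fin_cases j <;> simp [geoVectorAux, gradSymbol] <;> ring
  rw [pjpSymbol_mulVec_of_div_eq_zero bc η k h0, h1, dotProduct_smul,
    divSymbol_dotProduct_gradSymbol, ← add_smul, smul_eq_mul]
  have : (η : ℂ) + (normSq k : ℂ)⁻¹ * (η * -(normSq k : ℂ)) = 0 := by field_simp; ring
  rw [this, zero_smul, smul_zero]

/-- The normalisation enters the projection only through its square, so the square root disappears
and identities involving `S` become rational in `k`. -/
theorem star_geoVector_dotProduct_smul (bc : VerticalBC) (η : ℝ) (k : Fin 3 → ℝ)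
    (w : Fin 4 → ℂ) :
    (star (geoVector bc η k) ⬝ᵥ w) • geoVector bc η k =
      ((normSq ![k 0, k 1, η * k 2] : ℂ)⁻¹ * (star (geoVectorAux bc η k) ⬝ᵥ w)) •
        geoVectorAux bc η k := by
  have h : ((Real.sqrt (normSq ![k 0, k 1, η * k 2]) : ℝ) : ℂ) *
      ((Real.sqrt (normSq ![k 0, k 1, η * k 2]) : ℝ) : ℂ) = normSq ![k 0, k 1, η * k 2] := by
    rw [← Complex.ofReal_mul, Real.mul_self_sqrt]
    simp only [normSq]; positivity
  rw [geoVector_eq, star_smul, smul_dotProduct, smul_smul, ← h, mul_inv]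
  simp
  congr 1
  ring

/-- On divergence-free vectors the symbol satisfies `N² = -ω² (1 - S)`. -/
theorem pjpSymbol_pjpSymbol (bc : VerticalBC) {η : ℝ} {k : Fin 3 → ℝ} (hη : η ≠ 0)
    (hk : k 2 ≠ 0) {w : Fin 4 → ℂ} (hw : divSymbol bc k ⬝ᵥ w = 0) :
    (pjpSymbol bc η k).mulVec ((pjpSymbol bc η k).mulVec w) =
      -(dispersionSq η k : ℂ) • (w - (star (geoVector bc η k) ⬝ᵥ w) • geoVector bc η k) := by
  have hk1 : (normSq k : ℂ) ≠ 0 := by exact_mod_cast (normSq_pos hk).ne'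
  have hk2 : (normSq ![k 0, k 1, η * k 2] : ℂ) ≠ 0 := by
    exact_mod_cast (normSq_scaled_pos hη hk).ne'
  have hI := Complex.I_mul_I
  rw [pjpSymbol_mulVec_of_div_eq_zero bc η k (divSymbol_pjpSymbol bc η (normSq_pos hk).ne' w),
    pjpSymbol_mulVec_of_div_eq_zero bc η k hw, star_geoVector_dotProduct_smul, dispersionSq]
  push_cast
  have e1 : (normSq k : ℂ) = k 0 ^ 2 + k 1 ^ 2 + k 2 ^ 2 := by simp [normSq]
  have e2 : (normSq ![k 0, k 1, η * k 2] : ℂ) = k 0 ^ 2 + k 1 ^ 2 + η ^ 2 * k 2 ^ 2 := by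
    simp [normSq, mul_pow]
  have hk0 : (k 2 : ℂ) ≠ 0 := by exact_mod_cast hk
  have hI2 := Complex.I_sq
  rw [e1] at hk1 ⊢
  -- The quantity `|k_η|²` stays an atom while denominators are cleared; `e2` expands it only
  -- afterwards.
  generalize (normSq ![k 0, k 1, η * k 2] : ℂ) = E at *
  obtain ⟨a, b, c, d, rfl⟩ : ∃ a b c d, w = ![a, b, c, d] :=
    ⟨w 0, w 1, w 2, w 3, by ext j; fin_cases j <;> rfl⟩
  cases bc
  -- Since `k₃ ≠ 0`, the divergence constraint determines the third component; what remains is a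
  -- rational identity in each of the four components.
  · have h2 : c = -(k 0 * a + k 1 * b) / k 2 := by
      simp [divSymbol, dotProduct, Fin.sum_univ_four] at hw
      field_simp
      linear_combination (-Complex.I) * hw + (k 0 * a + k 1 * b + k 2 * c) * hI
    subst h2
    ext j
    fin_cases j <;>
      simp [divSymbol, gradSymbol, geoVectorAux, dotProduct, Fin.sum_univ_four] <;>
      field_simp <;> (try rw [e2]) <;> ring_nf <;> (try simp only [hI2]) <;> ring
  · have h2 : c = -(Complex.I * (k 0 * a + k 1 * b)) / k 2 := by
      simp [divSymbol, dotProduct, Fin.sum_univ_four] at hw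
      field_simp
      linear_combination hw
    subst h2
    ext j
    fin_cases j <;>
      simp [divSymbol, gradSymbol, geoVectorAux, dotProduct, Fin.sum_univ_four] <;>
      field_simp <;> (try rw [e2]) <;> ring_nf <;> (try simp only [hI2]) <;> ring


/-! ### Skew-adjointness and the spectral decomposition of the symbol -/

theorem helmholtz_conjTranspose (bc : VerticalBC) (k : Fin 3 → ℝ) :
    (helmholtz bc k).conjTranspose = helmholtz bc k := by
  ext i j
  cases bc <;> fin_cases i <;> fin_cases j <;>
    simp [helmholtz, Matrix.conjTranspose_apply, gradSymbol, divSymbol] <;> ring_nf <;> simp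

theorem coriolisBuoyancy_conjTranspose (η : ℝ) :
    (coriolisBuoyancy η).conjTranspose = -coriolisBuoyancy η := by
  ext i j
  fin_cases i <;> fin_cases j <;> simp [coriolisBuoyancy, Matrix.conjTranspose_apply]

theorem pjpSymbol_conjTranspose (bc : VerticalBC) (η : ℝ) (k : Fin 3 → ℝ) :
    (pjpSymbol bc η k).conjTranspose = -pjpSymbol bc η k := by
  rw [pjpSymbol, Matrix.conjTranspose_mul, Matrix.conjTranspose_mul, helmholtz_conjTranspose,
    coriolisBuoyancy_conjTranspose, Matrix.neg_mul, Matrix.mul_neg, Matrix.mul_assoc]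

theorem star_pjpSymbol_mulVec_dotProduct (bc : VerticalBC) (η : ℝ) (k : Fin 3 → ℝ)
    (x y : Fin 4 → ℂ) :
    star ((pjpSymbol bc η k).mulVec x) ⬝ᵥ y = -(star x ⬝ᵥ (pjpSymbol bc η k).mulVec y) := by
  rw [Matrix.star_mulVec, ← Matrix.dotProduct_mulVec, pjpSymbol_conjTranspose,
    Matrix.neg_mulVec, dotProduct_neg]

/-- Rotation and buoyancy do no work. This is the source of uniqueness. -/
theorem re_star_dotProduct_pjpSymbol (bc : VerticalBC) (η : ℝ) (k : Fin 3 → ℝ)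
    (x : Fin 4 → ℂ) : (star x ⬝ᵥ (pjpSymbol bc η k).mulVec x).re = 0 := by
  have h := star_pjpSymbol_mulVec_dotProduct bc η k x x
  have h2 : star ((pjpSymbol bc η k).mulVec x) ⬝ᵥ x
      = star (star x ⬝ᵥ (pjpSymbol bc η k).mulVec x) := by
    rw [Matrix.star_dotProduct]
  rw [h2] at h
  have := congrArg Complex.re h
  simp at this
  linarith

/-- The projection onto the geostrophic mode. -/
def geoProj (bc : VerticalBC) (η : ℝ) (k : Fin 3 → ℝ) : Matrix (Fin 4) (Fin 4) ℂ :=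
  Matrix.vecMulVec (geoVector bc η k) (star (geoVector bc η k))

theorem geoProj_mulVec (bc : VerticalBC) (η : ℝ) (k : Fin 3 → ℝ) (w : Fin 4 → ℂ) :
    (geoProj bc η k).mulVec w = (star (geoVector bc η k) ⬝ᵥ w) • geoVector bc η k := by
  rw [geoProj, Matrix.vecMulVec_mulVec]; ext j; simp [mul_comm]

/-- The signs of the three frequencies `0, ω, -ω`. -/
def modeSign : Fin 3 → ℝ := ![0, 1, -1]

/-- The projections onto the three eigenspaces of the symbol on divergence-free vectors:
the geostrophic one and the two ageostrophic ones. -/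
def modeProj (bc : VerticalBC) (η : ℝ) (k : Fin 3 → ℝ) (e : Fin 3) : Matrix (Fin 4) (Fin 4) ℂ :=
  if e = 0 then geoProj bc η k
  else (1 / 2 : ℂ) • ((1 - geoProj bc η k) +
    (Complex.I * modeSign e * (dispersion η k : ℂ)⁻¹) •
      (pjpSymbol bc η k * (1 - geoProj bc η k)))

theorem modeProj_zero (bc : VerticalBC) (η : ℝ) (k : Fin 3 → ℝ) :
    modeProj bc η k 0 = geoProj bc η k := rfl

theorem modeProj_mulVec_of_ne_zero (bc : VerticalBC) (η : ℝ) (k : Fin 3 → ℝ) {e : Fin 3}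
    (he : e ≠ 0) (w : Fin 4 → ℂ) :
    (modeProj bc η k e).mulVec w = (1 / 2 : ℂ) • ((w - (geoProj bc η k).mulVec w) +
      (Complex.I * modeSign e * (dispersion η k : ℂ)⁻¹) •
        (pjpSymbol bc η k).mulVec (w - (geoProj bc η k).mulVec w)) := by
  rw [modeProj, if_neg he, Matrix.smul_mulVec, Matrix.add_mulVec, Matrix.smul_mulVec,
    ← Matrix.mulVec_mulVec, Matrix.sub_mulVec, Matrix.one_mulVec]

theorem sum_modeProj_mulVec (bc : VerticalBC) (η : ℝ) (k : Fin 3 → ℝ) (w : Fin 4 → ℂ) :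
    ∑ e, (modeProj bc η k e).mulVec w = w := by
  rw [Fin.sum_univ_three, modeProj_mulVec_of_ne_zero _ _ _ (e := 1) (by decide),
    modeProj_mulVec_of_ne_zero _ _ _ (e := 2) (by decide), modeProj_zero]
  ext j
  simp [modeSign]
  ring

theorem divSymbol_geoProj (bc : VerticalBC) (η : ℝ) (k : Fin 3 → ℝ) (w : Fin 4 → ℂ) :
    divSymbol bc k ⬝ᵥ (geoProj bc η k).mulVec w = 0 := by
  rw [geoProj_mulVec, dotProduct_smul, divSymbol_geoVector, smul_zero]

theorem divSymbol_modeProj (bc : VerticalBC) (η : ℝ) {k : Fin 3 → ℝ} (hk : k 2 ≠ 0)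
    {w : Fin 4 → ℂ} (hw : divSymbol bc k ⬝ᵥ w = 0) (e : Fin 3) :
    divSymbol bc k ⬝ᵥ (modeProj bc η k e).mulVec w = 0 := by
  by_cases he : e = 0
  · rw [he, modeProj_zero, divSymbol_geoProj]
  · rw [modeProj_mulVec_of_ne_zero _ _ _ he, dotProduct_smul, dotProduct_add, dotProduct_sub,
      hw, divSymbol_geoProj, dotProduct_smul, divSymbol_pjpSymbol bc η (normSq_pos hk).ne']
    simp

theorem pjpSymbol_pjpSymbol_sub_geoProj (bc : VerticalBC) {η : ℝ} {k : Fin 3 → ℝ} (hη : η ≠ 0)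
    (hk : k 2 ≠ 0) {w : Fin 4 → ℂ} (hw : divSymbol bc k ⬝ᵥ w = 0) :
    (pjpSymbol bc η k).mulVec ((pjpSymbol bc η k).mulVec (w - (geoProj bc η k).mulVec w)) =
      -((dispersion η k : ℂ) ^ 2) • (w - (geoProj bc η k).mulVec w) := by
  have h : (dispersion η k : ℂ) ^ 2 = dispersionSq η k := by
    rw [dispersion, ← Complex.ofReal_pow, Real.sq_sqrt (dispersionSq_pos hη hk).le]
  rw [Matrix.mulVec_sub, geoProj_mulVec, Matrix.mulVec_smul, pjpSymbol_geoVector bc η hk,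
    smul_zero, sub_zero, pjpSymbol_pjpSymbol bc hη hk hw, h]

/-- On the range of `1 - S` the symbol squares to `-ω²`, so `z ± i ω⁻¹ N z` are eigenvectors. The
equation contains `-Γ N`, which is why the mode `e` oscillates with frequency `+ modeSign e * Γ *
ω`. -/
theorem pjpSymbol_modeProj (bc : VerticalBC) {η : ℝ} {k : Fin 3 → ℝ} (hη : η ≠ 0)
    (hk : k 2 ≠ 0) {w : Fin 4 → ℂ} (hw : divSymbol bc k ⬝ᵥ w = 0) (e : Fin 3) :
    (pjpSymbol bc η k).mulVec ((modeProj bc η k e).mulVec w) =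
      -(Complex.I * modeSign e * dispersion η k) • (modeProj bc η k e).mulVec w := by
  have hω : (dispersion η k : ℂ) ≠ 0 := by exact_mod_cast (dispersion_pos hη hk).ne'
  by_cases he : e = 0
  · rw [he, modeProj_zero, geoProj_mulVec, Matrix.mulVec_smul, pjpSymbol_geoVector bc η hk]
    simp [modeSign]
  · have hs : (modeSign e : ℂ) ^ 2 = 1 := by
      fin_cases e <;> simp [modeSign] at he ⊢
    rw [modeProj_mulVec_of_ne_zero _ _ _ he, Matrix.mulVec_smul, Matrix.mulVec_add,
      Matrix.mulVec_smul, pjpSymbol_pjpSymbol_sub_geoProj bc hη hk hw]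
    ext j
    simp only [Pi.smul_apply, Pi.add_apply, smul_eq_mul]
    generalize (pjpSymbol bc η k).mulVec (w - (geoProj bc η k).mulVec w) j = A
    generalize (w - (geoProj bc η k).mulVec w) j = B
    have hI := Complex.I_sq
    field_simp
    linear_combination (A * modeSign e ^ 2) * hI - A * hs

theorem star_geoVector_dotProduct_self (bc : VerticalBC) {η : ℝ} {k : Fin 3 → ℝ} (hη : η ≠ 0)
    (hk : k 2 ≠ 0) : star (geoVector bc η k) ⬝ᵥ geoVector bc η k = 1 := by
  have hk2 : (normSq ![k 0, k 1, η * k 2] : ℂ) ≠ 0 := by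
    exact_mod_cast (normSq_scaled_pos hη hk).ne'
  have h : ((Real.sqrt (normSq ![k 0, k 1, η * k 2]) : ℝ) : ℂ) *
      ((Real.sqrt (normSq ![k 0, k 1, η * k 2]) : ℝ) : ℂ) = normSq ![k 0, k 1, η * k 2] := by
    rw [← Complex.ofReal_mul, Real.mul_self_sqrt (normSq_scaled_pos hη hk).le]
  have h2 : star (geoVectorAux bc η k) ⬝ᵥ geoVectorAux bc η k =
      normSq ![k 0, k 1, η * k 2] := by
    have hI := Complex.I_sq
    cases bc <;> simp [geoVectorAux, dotProduct, Fin.sum_univ_four, normSq] <;> ring_nf <;>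
      simp only [hI] <;> ring
  rw [geoVector_eq, star_smul, smul_dotProduct, dotProduct_smul, h2, smul_smul, ← h]
  have : (√(normSq ![k 0, k 1, η * k 2]) : ℂ) ≠ 0 := by
    exact_mod_cast (Real.sqrt_pos.2 (normSq_scaled_pos hη hk)).ne'
  simp
  field_simp

theorem norm_toLp_sq (x : Fin 4 → ℂ) :
    ((‖(WithLp.toLp 2 x : Vec4)‖ ^ 2 : ℝ) : ℂ) = star x ⬝ᵥ x := by
  rw [EuclideanSpace.norm_sq_eq]
  simp [dotProduct, ← Complex.mul_conj', mul_comm]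

theorem norm_geoProj_le (bc : VerticalBC) {η : ℝ} {k : Fin 3 → ℝ} (hη : η ≠ 0)
    (hk : k 2 ≠ 0) (w : Fin 4 → ℂ) :
    ‖(WithLp.toLp 2 ((geoProj bc η k).mulVec w) : Vec4)‖ ≤ ‖(WithLp.toLp 2 w : Vec4)‖ := by
  have h1 : ‖(WithLp.toLp 2 (geoVector bc η k) : Vec4)‖ = 1 := by
    have := norm_toLp_sq (geoVector bc η k)
    rw [star_geoVector_dotProduct_self bc hη hk] at this
    have h : ‖(WithLp.toLp 2 (geoVector bc η k) : Vec4)‖ ^ 2 = 1 := by exact_mod_cast this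
    nlinarith [norm_nonneg (WithLp.toLp 2 (geoVector bc η k) : Vec4)]
  have h2 : star (geoVector bc η k) ⬝ᵥ w =
      inner ℂ (WithLp.toLp 2 (geoVector bc η k) : Vec4) (WithLp.toLp 2 w) := by
    rw [EuclideanSpace.inner_eq_star_dotProduct, dotProduct_comm]
  rw [geoProj_mulVec, WithLp.toLp_smul, norm_smul, h1, mul_one, h2]
  exact (norm_inner_le_norm _ _).trans (by rw [h1, one_mul])

/-- By skewness and `N² = -ω²`, the symbol acts on the range of `1 - S` as `ω` times an isometry.
The two summands of the projection therefore have equal norm, and the bound is free of `η`. -/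
theorem norm_modeProj_le (bc : VerticalBC) {η : ℝ} {k : Fin 3 → ℝ} (hη : η ≠ 0)
    (hk : k 2 ≠ 0) {w : Fin 4 → ℂ} (hw : divSymbol bc k ⬝ᵥ w = 0) {e : Fin 3} (he : e ≠ 0) :
    ‖(WithLp.toLp 2 ((modeProj bc η k e).mulVec w) : Vec4)‖ ≤
      ‖(WithLp.toLp 2 (w - (geoProj bc η k).mulVec w) : Vec4)‖ := by
  have hω := dispersion_pos hη hk
  rw [modeProj_mulVec_of_ne_zero _ _ _ he]
  have hN := pjpSymbol_pjpSymbol_sub_geoProj bc hη hk hw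
  set z := w - (geoProj bc η k).mulVec w
  have h1 : ‖(WithLp.toLp 2 ((pjpSymbol bc η k).mulVec z) : Vec4)‖ =
      dispersion η k * ‖(WithLp.toLp 2 z : Vec4)‖ := by
    rw [← sq_eq_sq₀ (norm_nonneg _) (by positivity)]
    apply Complex.ofReal_injective
    rw [norm_toLp_sq, star_pjpSymbol_mulVec_dotProduct, hN, mul_pow, Complex.ofReal_mul,
      norm_toLp_sq, dotProduct_smul]
    simp
  have hs : ‖(modeSign e : ℂ)‖ = 1 := by
    fin_cases e <;> simp [modeSign] at he ⊢
  rw [WithLp.toLp_smul, WithLp.toLp_add, WithLp.toLp_smul, norm_smul]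
  have h2 := norm_add_le (WithLp.toLp 2 z : Vec4)
    ((Complex.I * modeSign e * (dispersion η k : ℂ)⁻¹) •
      WithLp.toLp 2 ((pjpSymbol bc η k).mulVec z))
  rw [norm_smul, h1, norm_mul, norm_mul, hs, Complex.norm_I, norm_inv, Complex.norm_real,
    Real.norm_of_nonneg hω.le, ← mul_assoc, one_mul, one_mul, inv_mul_cancel₀ hω.ne'] at h2
  have : ‖(1 / 2 : ℂ)‖ = 1 / 2 := by simp
  rw [this]
  linarith

/-! ### Reflection of the vertical wave number -/

/-- The action of `x₃ ↦ -x₃` on values of fields, for stress-free boundary conditions. -/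
def reflectVec (w : Fin 4 → ℂ) : Fin 4 → ℂ := ![w 0, w 1, -w 2, -w 3]

/-- The reflection `(k_h, k₃) ↦ (k_h, -k₃)`. -/
def reflectFreq (k : Fin 3 → ℝ) : Fin 3 → ℝ := ![k 0, k 1, -k 2]

theorem reflectVec_reflectVec (w : Fin 4 → ℂ) : reflectVec (reflectVec w) = w := by
  ext j; fin_cases j <;> simp [reflectVec]

theorem reflectVec_add (v w : Fin 4 → ℂ) :
    reflectVec (v + w) = reflectVec v + reflectVec w := by
  ext j; fin_cases j <;> simp [reflectVec] <;> ring

theorem reflectVec_smul (c : ℂ) (w : Fin 4 → ℂ) : reflectVec (c • w) = c • reflectVec w := by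
  ext j; fin_cases j <;> simp [reflectVec]

theorem reflectVec_sub (v w : Fin 4 → ℂ) :
    reflectVec (v - w) = reflectVec v - reflectVec w := by
  ext j; fin_cases j <;> simp [reflectVec] <;> ring

theorem normSq_reflectFreq (k : Fin 3 → ℝ) : normSq (reflectFreq k) = normSq k := by
  simp [normSq, reflectFreq]

theorem dispersion_reflectFreq (η : ℝ) (k : Fin 3 → ℝ) :
    dispersion η (reflectFreq k) = dispersion η k := by
  simp [dispersion, dispersionSq, normSq, reflectFreq]

theorem helmholtz_reflect (k : Fin 3 → ℝ) (w : Fin 4 → ℂ) :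
    (helmholtz .stressFree (reflectFreq k)).mulVec (reflectVec w) =
      reflectVec ((helmholtz .stressFree k).mulVec w) := by
  rw [helmholtz_mulVec, helmholtz_mulVec, reflectVec_add, reflectVec_smul, normSq_reflectFreq]
  congr 2
  · congr 1
    simp [divSymbol, reflectFreq, reflectVec, dotProduct, Fin.sum_univ_four]
  · ext j
    fin_cases j <;> simp [gradSymbol, reflectFreq, reflectVec]

theorem coriolisBuoyancy_reflect (η : ℝ) (w : Fin 4 → ℂ) :
    (coriolisBuoyancy η).mulVec (reflectVec w) = reflectVec ((coriolisBuoyancy η).mulVec w) := by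
  rw [coriolisBuoyancy_mulVec, coriolisBuoyancy_mulVec]
  ext j
  fin_cases j <;> simp [reflectVec]

theorem pjpSymbol_reflect (η : ℝ) (k : Fin 3 → ℝ) (w : Fin 4 → ℂ) :
    (pjpSymbol .stressFree η (reflectFreq k)).mulVec (reflectVec w) =
      reflectVec ((pjpSymbol .stressFree η k).mulVec w) := by
  simp only [pjpSymbol, ← Matrix.mulVec_mulVec, helmholtz_reflect, coriolisBuoyancy_reflect]

theorem geoProj_reflect (η : ℝ) (k : Fin 3 → ℝ) (w : Fin 4 → ℂ) :
    (geoProj .stressFree η (reflectFreq k)).mulVec (reflectVec w) =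
      reflectVec ((geoProj .stressFree η k).mulVec w) := by
  have h : geoVector .stressFree η (reflectFreq k) =
      reflectVec (geoVector .stressFree η k) := by
    simp only [geoVector_eq, reflectVec_smul]
    congr 1
    · simp [normSq, reflectFreq]
    · ext j
      fin_cases j <;> simp [geoVectorAux, reflectFreq, reflectVec]
  rw [geoProj_mulVec, geoProj_mulVec, reflectVec_smul, h]
  congr 1
  simp [reflectVec, dotProduct, Fin.sum_univ_four]

/-- In the stress-free case the vertical modes `n` and `-n` are mirror images. Equivariance of the
projections guarantees that each piece of a field is again the transform of a field. -/
theorem modeProj_reflect (η : ℝ) (k : Fin 3 → ℝ) (e : Fin 3) (w : Fin 4 → ℂ) :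
    (modeProj .stressFree η (reflectFreq k) e).mulVec (reflectVec w) =
      reflectVec ((modeProj .stressFree η k e).mulVec w) := by
  by_cases he : e = 0
  · rw [he, modeProj_zero, modeProj_zero, geoProj_reflect]
  · rw [modeProj_mulVec_of_ne_zero _ _ _ he, modeProj_mulVec_of_ne_zero _ _ _ he,
      geoProj_reflect, dispersion_reflectFreq, ← reflectVec_sub, pjpSymbol_reflect,
      reflectVec_smul, reflectVec_add, reflectVec_smul]

/-! ### Measurability -/

theorem measurable_waveVector (bc : VerticalBC) (n : ℤ) : Measurable (waveVector bc n) := by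
  refine measurable_pi_iff.2 fun i => ?_
  fin_cases i <;> simp [waveVector] <;> fun_prop

theorem measurable_normSq : Measurable normSq := by
  unfold normSq; fun_prop

theorem measurable_dispersion (η : ℝ) : Measurable (dispersion η) := by
  unfold dispersion dispersionSq normSq
  simp
  fun_prop

theorem measurable_geoVector (bc : VerticalBC) (η : ℝ) (i : Fin 4) :
    Measurable fun k => geoVector bc η k i := by
  cases bc <;> fin_cases i <;> simp [geoVector, normSq] <;> fun_prop

theorem measurable_helmholtz (bc : VerticalBC) (i j : Fin 4) :
    Measurable fun k => helmholtz bc k i j := by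
  cases bc <;> fin_cases i <;> fin_cases j <;>
    simp [helmholtz, gradSymbol, divSymbol, normSq] <;> fun_prop

theorem measurable_matrix_mul {α : Type*} [MeasurableSpace α]
    {A B : α → Matrix (Fin 4) (Fin 4) ℂ} (hA : ∀ i j, Measurable fun x => A x i j)
    (hB : ∀ i j, Measurable fun x => B x i j) (i j : Fin 4) :
    Measurable fun x => (A x * B x) i j := by
  simp only [Matrix.mul_apply]
  exact Finset.measurable_fun_sum _ fun l _ => (hA i l).mul (hB l j)

theorem measurable_pjpSymbol (bc : VerticalBC) (η : ℝ) (i j : Fin 4) :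
    Measurable fun k => pjpSymbol bc η k i j := by
  unfold pjpSymbol
  have h := measurable_matrix_mul (A := fun k => helmholtz bc k)
    (B := fun _ => coriolisBuoyancy η) (measurable_helmholtz bc) (fun _ _ => measurable_const)
  exact measurable_matrix_mul (A := fun k => helmholtz bc k * coriolisBuoyancy η)
    (B := fun k => helmholtz bc k) h (measurable_helmholtz bc) i j

theorem measurable_geoProj (bc : VerticalBC) (η : ℝ) (i j : Fin 4) :
    Measurable fun k => geoProj bc η k i j := by
  simp only [geoProj, Matrix.vecMulVec_apply, Pi.star_apply]
  exact (measurable_geoVector bc η i).mul (continuous_star.measurable.comp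
    (measurable_geoVector bc η j))

theorem measurable_modeProj (bc : VerticalBC) (η : ℝ) (e : Fin 3) (i j : Fin 4) :
    Measurable fun k => modeProj bc η k e i j := by
  unfold modeProj
  split_ifs
  · exact measurable_geoProj bc η i j
  · have h1 : ∀ i j, Measurable fun k => (1 - geoProj bc η k) i j := fun i j => by
      simp only [Matrix.sub_apply]
      exact measurable_const.sub (measurable_geoProj bc η i j)
    have h2 := measurable_matrix_mul (A := fun k => pjpSymbol bc η k)
      (B := fun k => 1 - geoProj bc η k) (measurable_pjpSymbol bc η) h1 i j
    have h3 := measurable_dispersion η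
    simp only [Matrix.smul_apply, Matrix.add_apply, smul_eq_mul]
    exact measurable_const.mul ((h1 i j).add (((measurable_const.mul
      (Complex.measurable_ofReal.comp h3).inv)).mul h2))

theorem measurable_mulVec {α : Type*} [MeasurableSpace α] {μ : Measure α}
    {A : α → Matrix (Fin 4) (Fin 4) ℂ} (hA : ∀ i j, Measurable fun x => A x i j)
    {f : α → Vec4} (hf : AEStronglyMeasurable f μ) :
    AEStronglyMeasurable (fun x => (WithLp.toLp 2 ((A x).mulVec (f x).ofLp) : Vec4)) μ := by
  refine (PiLp.continuous_toLp 2 _).comp_aestronglyMeasurable ?_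
  refine (aemeasurable_pi_iff.2 fun i => ?_).aestronglyMeasurable
  simp only [Matrix.mulVec, dotProduct]
  refine Finset.aemeasurable_fun_sum _ fun j _ => (hA i j).aemeasurable.mul ?_
  exact ((EuclideanSpace.proj (𝕜 := ℂ) j).continuous.comp_aestronglyMeasurable hf).aemeasurable


/-! ### Oscillatory integrals -/

/-- The second derivative test of van der Corput, with a nonnegative decreasing amplitude. -/
theorem norm_oscillatory_le {a b lam M : ℝ} (hab : a ≤ b) (hlam : 0 < lam)
    {φ ψ ψ' A A' : ℝ → ℝ} (hφ : ∀ x, HasDerivAt φ (ψ x) x) (hψ : ∀ x, HasDerivAt ψ (ψ' x) x)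
    (hψ' : Continuous ψ') (hA : ∀ x, HasDerivAt A (A' x) x) (hA' : Continuous A')
    (hl : ∀ x ∈ Icc a b, lam ≤ ψ' x) (hA0 : ∀ x ∈ Icc a b, 0 ≤ A x)
    (hAM : ∀ x ∈ Icc a b, A x ≤ M) (hA'0 : ∀ x ∈ Icc a b, A' x ≤ 0) :
    ‖∫ x in a..b, (A x : ℂ) * Complex.exp (Complex.I * φ x)‖ ≤ 8 * M / √lam := by
  have cφ : Continuous φ := continuous_iff_continuousAt.2 fun x => (hφ x).continuousAt
  have cψ : Continuous ψ := continuous_iff_continuousAt.2 fun x => (hψ x).continuousAt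
  have cA : Continuous A := continuous_iff_continuousAt.2 fun x => (hA x).continuousAt
  have hQ : ∀ x, 0 < lam + ψ x ^ 2 := fun x => by positivity
  have hQne : ∀ x, lam + ψ x ^ 2 ≠ 0 := fun x => (hQ x).ne'
  have hsl : 0 < √lam := Real.sqrt_pos.2 hlam
  have hM : 0 ≤ M := (hA0 a ⟨le_rfl, hab⟩).trans (hAM a ⟨le_rfl, hab⟩)
  -- the weight `w = ψ / (λ + ψ²)`
  set w : ℝ → ℝ := fun x => ψ x / (lam + ψ x ^ 2) with hw
  set w' : ℝ → ℝ := fun x => ψ' x * (lam - ψ x ^ 2) / (lam + ψ x ^ 2) ^ 2 with hw'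
  have cw : Continuous w := cψ.div (by fun_prop) hQne
  have cw' : Continuous w' :=
    (hψ'.mul (by fun_prop)).div (by fun_prop) fun x => pow_ne_zero 2 (hQne x)
  have hwd : ∀ x, HasDerivAt w (w' x) x := fun x => by
    refine ((hψ x).div (((hψ x).pow 2).const_add lam) (hQne x)).congr_deriv ?_
    simp only [hw']
    congr 1
    push_cast
    simp only [Pi.pow_apply]
    ring
  have hwb : ∀ x, |w x| ≤ 1 / (2 * √lam) := fun x => by
    rw [hw, abs_div, abs_of_pos (hQ x), div_le_div_iff₀ (hQ x) (by positivity)]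
    have h1 : √lam ^ 2 = lam := Real.sq_sqrt hlam.le
    nlinarith [sq_nonneg (√lam - |ψ x|), sq_abs (ψ x)]
  set E : ℝ → ℂ := fun x => Complex.exp (Complex.I * φ x) with hE
  have cE : Continuous E := by fun_prop
  have hEn : ∀ x, ‖E x‖ = 1 := fun x => by
    simp only [hE]
    rw [mul_comm, Complex.norm_exp_ofReal_mul_I]
  have hEd : ∀ x, HasDerivAt E (E x * (Complex.I * ψ x)) x := fun x =>
    (((hφ x).ofReal_comp).const_mul Complex.I).cexp
  -- The weight `w` is a regularisation of `1 / ψ`, and `w ψ = 1 - λ / (λ + ψ²)`. Thus `F'`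
  -- reproduces the integrand up to terms that can be integrated absolutely, and a stationary point
  -- needs no separate treatment.
  set F : ℝ → ℂ := fun x => -Complex.I * (A x * w x : ℝ) * E x with hF
  set F' : ℝ → ℂ := fun x => -Complex.I * (A' x * w x + A x * w' x : ℝ) * E x
    + (A x * (1 - lam / (lam + ψ x ^ 2)) : ℝ) * E x with hF'
  have hFd : ∀ x, HasDerivAt F (F' x) x := fun x => by
    refine (((((hA x).mul (hwd x)).ofReal_comp).const_mul (-Complex.I)).mul (hEd x)).congr_deriv ?_
    have h1 : A x * (1 - lam / (lam + ψ x ^ 2)) = A x * w x * ψ x := by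
      simp only [hw]; have := hQne x; field_simp; ring
    simp only [hF', h1, Pi.mul_apply]
    push_cast
    linear_combination (-(A x * w x * ψ x : ℂ) * E x) * Complex.I_mul_I
  have cF' : Continuous F' := by
    have : Continuous fun x => lam / (lam + ψ x ^ 2) :=
      continuous_const.div (by fun_prop) hQne
    fun_prop
  have hFint : ∫ x in a..b, F' x = F b - F a :=
    intervalIntegral.integral_eq_sub_of_hasDerivAt (fun x _ => hFd x) (cF'.intervalIntegrable _ _)
  set G : ℝ → ℂ := fun x => (A x : ℂ) * E x - F' x with hG
  have cG : Continuous G := by fun_prop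
  have hsplit : ∫ x in a..b, (A x : ℂ) * E x = (F b - F a) + ∫ x in a..b, G x := by
    rw [← hFint, ← intervalIntegral.integral_add (cF'.intervalIntegrable _ _)
      (cG.intervalIntegrable _ _)]
    congr 1
    ext x
    simp [hG]
  -- pointwise bound of the remainder by an exact derivative
  set H : ℝ → ℝ := fun x => -(1 / (2 * √lam)) * A' x
    + 2 * M * ψ' x / (lam + ψ x ^ 2) with hH
  have cH : Continuous H := by
    have : Continuous fun x => 2 * M * ψ' x / (lam + ψ x ^ 2) :=
      (by fun_prop : Continuous fun x => 2 * M * ψ' x).div (by fun_prop) hQne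
    fun_prop
  -- The total variation of the arctangent is at most `π`, so no bound on `ψ` itself is needed.
  have hHd : ∀ x, HasDerivAt (fun x => -(1 / (2 * √lam)) * A x
      + 2 * M / √lam * Real.arctan (ψ x / √lam)) (H x) x := fun x => by
    refine (((hA x).const_mul _).add ((((hψ x).div_const (√lam)).arctan).const_mul
      (2 * M / √lam))).congr_deriv ?_
    simp only [hH]
    congr 1
    have h1 : √lam ^ 2 = lam := Real.sq_sqrt hlam.le
    have h2 := hQne x
    have h3 : 1 + (ψ x / √lam) ^ 2 = (lam + ψ x ^ 2) / lam := by
      rw [div_pow, h1]; field_simp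
    rw [h3]
    field_simp
    rw [h1]
  have hGH : ∀ x ∈ Icc a b, ‖G x‖ ≤ H x := fun x hx => by
    have e : G x = Complex.I * (A' x * w x + A x * w' x : ℝ) * E x
        + (A x * (lam / (lam + ψ x ^ 2)) : ℝ) * E x := by
      simp only [hG, hF']; push_cast; ring
    have hψ'x : 0 < ψ' x := hlam.trans_le (hl x hx)
    have b1 : |A' x * w x| ≤ -(1 / (2 * √lam)) * A' x := by
      rw [abs_mul, abs_of_nonpos (hA'0 x hx)]
      nlinarith [hwb x, hA'0 x hx]
    have b2 : |A x * w' x| ≤ M * (ψ' x / (lam + ψ x ^ 2)) := by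
      rw [abs_mul, abs_of_nonneg (hA0 x hx)]
      refine mul_le_mul (hAM x hx) ?_ (abs_nonneg _) hM
      simp only [hw']
      rw [abs_div, abs_mul, abs_of_pos hψ'x, abs_of_pos (pow_pos (hQ x) 2),
        div_le_div_iff₀ (pow_pos (hQ x) 2) (hQ x)]
      have : |lam - ψ x ^ 2| ≤ lam + ψ x ^ 2 := by
        rw [abs_le]; constructor <;> nlinarith [sq_nonneg (ψ x)]
      calc ψ' x * |lam - ψ x ^ 2| * (lam + ψ x ^ 2)
          ≤ ψ' x * (lam + ψ x ^ 2) * (lam + ψ x ^ 2) := by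
            gcongr
        _ = _ := by ring
    -- The lower bound `λ ≤ ψ'` trades `λ` for `ψ'` and makes this term part of the derivative of
    -- the arctangent.
    have b3 : |A x * (lam / (lam + ψ x ^ 2))| ≤ M * (ψ' x / (lam + ψ x ^ 2)) := by
      rw [abs_mul, abs_of_nonneg (hA0 x hx), abs_of_pos (div_pos hlam (hQ x))]
      refine mul_le_mul (hAM x hx) ?_ (div_pos hlam (hQ x)).le hM
      have := hl x hx
      have := hQ x
      gcongr
    rw [e]
    refine (norm_add_le _ _).trans ?_
    rw [norm_mul, norm_mul, norm_mul, hEn, Complex.norm_I, Complex.norm_real, Complex.norm_real,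
      Real.norm_eq_abs, Real.norm_eq_abs]
    have := abs_add_le (A' x * w x) (A x * w' x)
    have e2 : 2 * M * ψ' x / (lam + ψ x ^ 2) =
      M * (ψ' x / (lam + ψ x ^ 2)) + M * (ψ' x / (lam + ψ x ^ 2)) := by ring
    simp only [hH, e2]
    linarith
  have hHint : ∫ x in a..b, H x ≤ M / (2 * √lam) + 2 * M * Real.pi / √lam := by
    rw [intervalIntegral.integral_eq_sub_of_hasDerivAt (fun x _ => hHd x)
      (cH.intervalIntegrable _ _)]
    have h1 := Real.arctan_lt_pi_div_two (ψ b / √lam)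
    have h2 := Real.neg_pi_div_two_lt_arctan (ψ a / √lam)
    have h3 : A a - A b ≤ M := by
      linarith [hAM a ⟨le_rfl, hab⟩, hA0 b ⟨hab, le_rfl⟩]
    have h4 : 2 * M / √lam * (Real.arctan (ψ b / √lam) - Real.arctan (ψ a / √lam))
        ≤ 2 * M / √lam * Real.pi := by
      refine mul_le_mul_of_nonneg_left ?_ (by positivity)
      linarith
    have h5 : 1 / (2 * √lam) * (A a - A b) ≤ 1 / (2 * √lam) * M :=
      mul_le_mul_of_nonneg_left h3 (by positivity)
    calc _ = 1 / (2 * √lam) * (A a - A b)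
        + 2 * M / √lam * (Real.arctan (ψ b / √lam) - Real.arctan (ψ a / √lam)) := by ring
      _ ≤ 1 / (2 * √lam) * M + 2 * M / √lam * Real.pi := add_le_add h5 h4
      _ = _ := by ring
  have hGint : ‖∫ x in a..b, G x‖ ≤ ∫ x in a..b, H x :=
    intervalIntegral.norm_integral_le_of_norm_le hab
      (Filter.Eventually.of_forall fun x hx => hGH x (Ioc_subset_Icc_self hx))
      (cH.intervalIntegrable _ _)
  have hFb : ∀ x ∈ Icc a b, ‖F x‖ ≤ M / (2 * √lam) := fun x hx => by
    simp only [hF]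
    rw [norm_mul, norm_mul, hEn, norm_neg, Complex.norm_I, Complex.norm_real, Real.norm_eq_abs,
      abs_mul, abs_of_nonneg (hA0 x hx), one_mul, mul_one]
    calc A x * |w x| ≤ M * (1 / (2 * √lam)) :=
          mul_le_mul (hAM x hx) (hwb x) (abs_nonneg _) hM
      _ = _ := by ring
  rw [hsplit]
  refine (norm_add_le _ _).trans ?_
  have h1 := norm_sub_le (F b) (F a)
  have h2 := hFb a ⟨le_rfl, hab⟩
  have h3 := hFb b ⟨hab, le_rfl⟩
  -- The two boundary terms and the variation of the amplitude give `3/2`, the arctangent gives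
  -- `2π`, and the total is below `8`.
  have h4 : M / (2 * √lam) + 2 * M * Real.pi / √lam + 2 * (M / (2 * √lam)) ≤ 8 * M / √lam := by
    rw [show M / (2 * √lam) + 2 * M * Real.pi / √lam + 2 * (M / (2 * √lam)) =
      (M * (3 / 2 + 2 * Real.pi)) / √lam by field_simp; ring]
    rw [mul_comm 8 M]
    have : 3 / 2 + 2 * Real.pi ≤ 8 := by linarith [Real.pi_lt_d2]
    gcongr
  linarith


/-- Complex conjugation of the integral reverses the sign of the phase. -/
theorem norm_oscillatory_le_of_neg {a b lam M : ℝ} (hab : a ≤ b) (hlam : 0 < lam)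
    {φ ψ ψ' A A' : ℝ → ℝ} (hφ : ∀ x, HasDerivAt φ (ψ x) x) (hψ : ∀ x, HasDerivAt ψ (ψ' x) x)
    (hψ' : Continuous ψ') (hA : ∀ x, HasDerivAt A (A' x) x) (hA' : Continuous A')
    (hl : ∀ x ∈ Icc a b, lam ≤ -ψ' x) (hA0 : ∀ x ∈ Icc a b, 0 ≤ A x)
    (hAM : ∀ x ∈ Icc a b, A x ≤ M) (hA'0 : ∀ x ∈ Icc a b, A' x ≤ 0) :
    ‖∫ x in a..b, (A x : ℂ) * Complex.exp (Complex.I * φ x)‖ ≤ 8 * M / √lam := by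
  have h := norm_oscillatory_le (φ := fun x => -φ x) (ψ := fun x => -ψ x)
    (ψ' := fun x => -ψ' x) hab hlam (fun x => (hφ x).neg) (fun x => (hψ x).neg) hψ'.neg
    hA hA' hl hA0 hAM hA'0
  have e : ∀ x, (A x : ℂ) * Complex.exp (Complex.I * ((-φ x : ℝ) : ℂ)) =
      (starRingEnd ℂ) ((A x : ℂ) * Complex.exp (Complex.I * φ x)) := fun x => by
    rw [map_mul, Complex.conj_ofReal, ← Complex.exp_conj, map_mul, Complex.conj_I,
      Complex.conj_ofReal]
    push_cast
    ring_nf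
  simp only [e, intervalIntegral.intervalIntegral_conj, RCLike.norm_conj] at h
  exact h

/-- The dispersion relation as a function of the squared horizontal wave number. -/
def layerDisp (κ η s : ℝ) : ℝ := √((s + κ * η ^ 2) / (s + κ))

/-! ### Concavity of the dispersion relation along lines in a sector -/

section slice

variable {κ η y : ℝ}

theorem layerDisp_pos (hκ : 0 < κ) (hη : 2 ≤ η ^ 2) {s : ℝ} (hs : 0 ≤ s) :
    0 < layerDisp κ η s := Real.sqrt_pos.2 (by positivity)

theorem layerDisp_sq (hκ : 0 < κ) {s : ℝ} (hs : 0 ≤ s) :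
    layerDisp κ η s ^ 2 = (s + κ * η ^ 2) / (s + κ) := Real.sq_sqrt (by positivity)

/-- In the second derivative the factor `η² - 1` is divided by the dispersion relation; this bound
leaves one full power of `|η|`. -/
theorem layerDisp_le (hκ : 0 < κ) (hη : 2 ≤ η ^ 2) {s : ℝ} (hs : 0 ≤ s) :
    layerDisp κ η s ≤ |η| := by
  rw [← abs_of_pos (layerDisp_pos hκ hη hs), ← sq_le_sq, layerDisp_sq hκ hs,
    div_le_iff₀ (by positivity)]
  nlinarith

/-- First derivative of the dispersion relation along horizontal lines. -/
def layerDisp' (κ η y x : ℝ) : ℝ :=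
  -(κ * (η ^ 2 - 1) * x) / ((x ^ 2 + y ^ 2 + κ) ^ 2 * layerDisp κ η (x ^ 2 + y ^ 2))

/-- Second derivative of the dispersion relation along horizontal lines. -/
def layerDisp'' (κ η y x : ℝ) : ℝ :=
  κ * (η ^ 2 - 1) / ((x ^ 2 + y ^ 2 + κ) ^ 2 * layerDisp κ η (x ^ 2 + y ^ 2)) *
    (-1 + 4 * x ^ 2 / (x ^ 2 + y ^ 2 + κ) - κ * (η ^ 2 - 1) * x ^ 2 /
      ((x ^ 2 + y ^ 2 + κ) ^ 2 * layerDisp κ η (x ^ 2 + y ^ 2) ^ 2))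

theorem hasDerivAt_layerDisp (hκ : 0 < κ) (hη : 2 ≤ η ^ 2) (x : ℝ) :
    HasDerivAt (fun x => layerDisp κ η (x ^ 2 + y ^ 2)) (layerDisp' κ η y x) x := by
  have hD : x ^ 2 + y ^ 2 + κ ≠ 0 := by positivity
  have h1 : HasDerivAt (fun x : ℝ => x ^ 2 + y ^ 2) (2 * x) x := by
    simpa using (hasDerivAt_pow 2 x).add_const (y ^ 2)
  have h2 := ((h1.add_const (κ * η ^ 2)).div (h1.add_const κ) hD).sqrt
    (by simp only [Pi.div_apply]; positivity)
  refine h2.congr_deriv ?_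
  have hp := (layerDisp_pos hκ hη (s := x ^ 2 + y ^ 2) (by positivity)).ne'
  rw [layerDisp']
  change _ / (2 * layerDisp κ η (x ^ 2 + y ^ 2)) = _
  field_simp
  ring

theorem hasDerivAt_layerDisp' (hκ : 0 < κ) (hη : 2 ≤ η ^ 2) (x : ℝ) :
    HasDerivAt (layerDisp' κ η y) (layerDisp'' κ η y x) x := by
  have hD : x ^ 2 + y ^ 2 + κ ≠ 0 := by positivity
  have hp := (layerDisp_pos hκ hη (s := x ^ 2 + y ^ 2) (by positivity)).ne'
  have h1 : HasDerivAt (fun x : ℝ => x ^ 2 + y ^ 2 + κ) (2 * x) x := by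
    simpa using ((hasDerivAt_pow 2 x).add_const (y ^ 2)).add_const κ
  have h2 := (((hasDerivAt_id x).const_mul (κ * (η ^ 2 - 1))).neg).div
    ((h1.pow 2).mul (hasDerivAt_layerDisp (y := y) hκ hη x))
    (mul_ne_zero (pow_ne_zero 2 hD) hp)
  refine h2.congr_deriv ?_
  rw [layerDisp'', layerDisp']
  simp only [id, Pi.pow_apply, Pi.mul_apply, Pi.neg_apply]
  field_simp
  ring

theorem continuous_layerDisp (hκ : 0 < κ) :
    Continuous fun x => layerDisp κ η (x ^ 2 + y ^ 2) := by
  refine Real.continuous_sqrt.comp (Continuous.div (by fun_prop) (by fun_prop) fun x => ?_)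
  positivity

theorem continuous_layerDisp'' (hκ : 0 < κ) (hη : 2 ≤ η ^ 2) :
    Continuous (layerDisp'' κ η y) := by
  have hD : ∀ x, x ^ 2 + y ^ 2 + κ ≠ 0 := fun x => by positivity
  have hp : ∀ x, layerDisp κ η (x ^ 2 + y ^ 2) ≠ 0 := fun x =>
    (layerDisp_pos hκ hη (s := x ^ 2 + y ^ 2) (by positivity)).ne'
  have hc := continuous_layerDisp (κ := κ) (η := η) (y := y) hκ
  unfold layerDisp''
  refine (Continuous.div (by fun_prop) (by fun_prop) fun x =>
    mul_ne_zero (pow_ne_zero 2 (hD x)) (hp x)).mul ((Continuous.add (by fun_prop)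
      (Continuous.div (by fun_prop) (by fun_prop) hD)).sub
        (Continuous.div (by fun_prop) (by fun_prop) fun x =>
          mul_ne_zero (pow_ne_zero 2 (hD x)) (pow_ne_zero 2 (hp x))))

/-- In the sector `4 x² ≤ x² + y²` the second derivative has size `|η|`. -/
theorem le_neg_layerDisp'' (hκ : 0 < κ) (hη : 2 ≤ η ^ 2) {x D : ℝ}
    (hx : 4 * x ^ 2 ≤ x ^ 2 + y ^ 2) (hD : x ^ 2 + y ^ 2 + κ ≤ D) :
    κ ^ 2 * |η| / (2 * D ^ 3) ≤ -layerDisp'' κ η y x := by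
  have hs : 0 ≤ x ^ 2 + y ^ 2 := by positivity
  have hp := layerDisp_pos hκ hη hs
  have hple := layerDisp_le hκ hη hs
  rw [layerDisp'']
  set p := layerDisp κ η (x ^ 2 + y ^ 2)
  set d := x ^ 2 + y ^ 2 + κ with hd
  have hd0 : 0 < d := by positivity
  have hη0 : 0 < |η| := hp.trans_le hple
  -- The assumption `2 ≤ η²` makes `η² - 1` at least `η² / 2`. At `η² = 1` the dispersion relation
  -- is constant, so some separation from that value is necessary.
  have hb : κ * |η| ^ 2 / 2 ≤ κ * (η ^ 2 - 1) := by rw [sq_abs]; nlinarith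
  have hb0 : 0 ≤ κ * (η ^ 2 - 1) := le_trans (by positivity) hb
  -- The sector condition says `4 x² ≤ d - κ`, hence `1 - 4 x² / d ≥ κ / d`; the remaining term has
  -- the favourable sign.
  have h1 : κ / d ≤ -(-1 + 4 * x ^ 2 / d - κ * (η ^ 2 - 1) * x ^ 2 / (d ^ 2 * p ^ 2)) := by
    have h2 : 0 ≤ κ * (η ^ 2 - 1) * x ^ 2 / (d ^ 2 * p ^ 2) := by positivity
    have h3 : κ / d + 4 * x ^ 2 / d ≤ 1 := by
      rw [← add_div, div_le_one hd0]; linarith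
    linarith
  have h4 : κ * |η| / (2 * d ^ 2) ≤ κ * (η ^ 2 - 1) / (d ^ 2 * p) := by
    calc κ * |η| / (2 * d ^ 2) = (κ * |η| ^ 2 / 2) / (d ^ 2 * |η|) := by field_simp
      _ ≤ κ * (η ^ 2 - 1) / (d ^ 2 * p) := by gcongr
  calc κ ^ 2 * |η| / (2 * D ^ 3) ≤ κ ^ 2 * |η| / (2 * d ^ 3) := by gcongr
    _ = κ * |η| / (2 * d ^ 2) * (κ / d) := by field_simp
    _ ≤ κ * (η ^ 2 - 1) / (d ^ 2 * p) *
        -(-1 + 4 * x ^ 2 / d - κ * (η ^ 2 - 1) * x ^ 2 / (d ^ 2 * p ^ 2)) := by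
        gcongr
    _ = _ := by ring

/-- Only half of the symmetric interval is treated, because the Gaussian amplitude has to be
decreasing. -/
theorem norm_slice_half_le (hκ : 0 < κ) (hη : 2 ≤ η ^ 2) {τ σ m D : ℝ} (hτ : τ ≠ 0)
    (hσ : 0 ≤ σ) (hm : 0 ≤ m) (hmx : 4 * m ^ 2 ≤ m ^ 2 + y ^ 2)
    (hmD : m ^ 2 + y ^ 2 + κ ≤ D) (z : ℝ) :
    ‖∫ x in (0 : ℝ)..m, (Real.exp (-σ * (x ^ 2 + y ^ 2)) : ℂ) *
      Complex.exp (Complex.I * ((z * x + τ * layerDisp κ η (x ^ 2 + y ^ 2) : ℝ) : ℂ))‖ ≤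
      8 * 1 / √(|τ| * (κ ^ 2 * |η| / (2 * D ^ 3))) := by
  have hη0 : 0 < |η| :=
    (layerDisp_pos hκ hη le_rfl).trans_le (layerDisp_le hκ hη le_rfl)
  have hD : 0 < D := lt_of_lt_of_le (by positivity) hmD
  have hlam : 0 < |τ| * (κ ^ 2 * |η| / (2 * D ^ 3)) := by positivity
  have hφ : ∀ x, HasDerivAt (fun x => z * x + τ * layerDisp κ η (x ^ 2 + y ^ 2))
      (z + τ * layerDisp' κ η y x) x := fun x => by
    simpa using ((hasDerivAt_id x).const_mul z).fun_add
      ((hasDerivAt_layerDisp (y := y) hκ hη x).const_mul τ)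
  have hψ : ∀ x, HasDerivAt (fun x => z + τ * layerDisp' κ η y x)
      (τ * layerDisp'' κ η y x) x := fun x =>
    ((hasDerivAt_layerDisp' (y := y) hκ hη x).const_mul τ).const_add z
  have hψ' : Continuous fun x => τ * layerDisp'' κ η y x :=
    continuous_const.mul (continuous_layerDisp'' hκ hη)
  have hA : ∀ x, HasDerivAt (fun x => Real.exp (-σ * (x ^ 2 + y ^ 2)))
      (Real.exp (-σ * (x ^ 2 + y ^ 2)) * (-σ * (2 * x))) x := fun x => by
    have h1 : HasDerivAt (fun x : ℝ => x ^ 2 + y ^ 2) (2 * x) x := by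
      simpa using (hasDerivAt_pow 2 x).add_const (y ^ 2)
    exact (h1.const_mul (-σ)).exp
  have hA' : Continuous fun x => Real.exp (-σ * (x ^ 2 + y ^ 2)) * (-σ * (2 * x)) := by
    fun_prop
  have hA0 : ∀ x ∈ Icc 0 m, 0 ≤ Real.exp (-σ * (x ^ 2 + y ^ 2)) := fun x _ =>
    (Real.exp_pos _).le
  have hAM : ∀ x ∈ Icc 0 m, Real.exp (-σ * (x ^ 2 + y ^ 2)) ≤ 1 := fun x _ => by
    rw [Real.exp_le_one_iff, neg_mul, neg_nonpos]; positivity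
  have hA'0 : ∀ x ∈ Icc 0 m, Real.exp (-σ * (x ^ 2 + y ^ 2)) * (-σ * (2 * x)) ≤ 0 :=
    fun x hx => by
      have : 0 ≤ Real.exp (-σ * (x ^ 2 + y ^ 2)) * (σ * (2 * x)) := by
        have := hx.1; positivity
      linarith
  have hl : ∀ x ∈ Icc 0 m, κ ^ 2 * |η| / (2 * D ^ 3) ≤ -layerDisp'' κ η y x := fun x hx => by
    have hxm : x ^ 2 ≤ m ^ 2 := pow_le_pow_left₀ hx.1 hx.2 2
    exact le_neg_layerDisp'' hκ hη (by linarith) (by linarith)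
  rcases lt_or_gt_of_ne hτ with h | h
  -- The dispersion relation is concave on the interval, so the sign of `τ` decides which form of
  -- the second derivative test applies.
  · refine norm_oscillatory_le hm hlam hφ hψ hψ' hA hA' (fun x hx => ?_) hA0 hAM hA'0
    rw [abs_of_neg h]
    nlinarith [hl x hx]
  · refine norm_oscillatory_le_of_neg hm hlam hφ hψ hψ' hA hA' (fun x hx => ?_) hA0 hAM hA'0
    rw [abs_of_pos h]
    nlinarith [hl x hx]

/-- The reflection `x ↦ -x` exchanges the two halves and replaces `z` by `-z`, while the bound on a
half is uniform in `z`. -/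
theorem norm_slice_le (hκ : 0 < κ) (hη : 2 ≤ η ^ 2) {τ σ m D : ℝ} (hτ : τ ≠ 0)
    (hσ : 0 ≤ σ) (hm : 0 ≤ m) (hmx : 4 * m ^ 2 ≤ m ^ 2 + y ^ 2)
    (hmD : m ^ 2 + y ^ 2 + κ ≤ D) (z : ℝ) :
    ‖∫ x in -m..m, (Real.exp (-σ * (x ^ 2 + y ^ 2)) : ℂ) *
      Complex.exp (Complex.I * ((z * x + τ * layerDisp κ η (x ^ 2 + y ^ 2) : ℝ) : ℂ))‖ ≤
      16 / √(|τ| * (κ ^ 2 * |η| / (2 * D ^ 3))) := by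
  have hc := continuous_layerDisp (κ := κ) (η := η) (y := y) hκ
  have cont : ∀ z : ℝ, Continuous fun x : ℝ => (Real.exp (-σ * (x ^ 2 + y ^ 2)) : ℂ) *
      Complex.exp (Complex.I *
        ((z * x + τ * layerDisp κ η (x ^ 2 + y ^ 2) : ℝ) : ℂ)) := fun z => by fun_prop
  rw [← intervalIntegral.integral_add_adjacent_intervals (b := 0)
    ((cont z).intervalIntegrable _ _) ((cont z).intervalIntegrable _ _)]
  have h1 := norm_slice_half_le hκ hη hτ hσ hm hmx hmD z
  have h2 := norm_slice_half_le hκ hη hτ hσ hm hmx hmD (-z)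
  have h3 := intervalIntegral.integral_comp_neg (a := 0) (b := m)
    (fun x : ℝ => (Real.exp (-σ * (x ^ 2 + y ^ 2)) : ℂ) *
      Complex.exp (Complex.I * ((z * x + τ * layerDisp κ η (x ^ 2 + y ^ 2) : ℝ) : ℂ)))
  simp only [neg_sq, neg_zero, mul_neg] at h3
  simp only [neg_mul z] at h2
  rw [← h3]
  refine (norm_add_le _ _).trans ((add_le_add h2 h1).trans (le_of_eq ?_))
  ring

end slice

/-- The part of a disc in the two opposite sectors of half-angle `π / 6` about the second axis. -/
def discSector (r : ℝ) : Set (ℝ × ℝ) := {q | 4 * q.1 ^ 2 ≤ q.1 ^ 2 + q.2 ^ 2 ∧ q.1 ^ 2 + q.2 ^ 2 ≤ r}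

/-- The oscillation is exploited in the first variable only. The second one contributes the length
`2√r` of its range. -/
theorem norm_discSector_integral_le {κ η τ σ r D : ℝ} (hκ : 0 < κ) (hη : 2 ≤ η ^ 2)
    (hτ : τ ≠ 0) (hσ : 0 ≤ σ) (hD : r + κ ≤ D) (z : ℝ × ℝ) :
    ‖∫ q in discSector r, (Real.exp (-σ * (q.1 ^ 2 + q.2 ^ 2)) : ℂ) *
      Complex.exp (Complex.I * ((z.1 * q.1 + z.2 * q.2 +
        τ * layerDisp κ η (q.1 ^ 2 + q.2 ^ 2) : ℝ) : ℂ))‖ ≤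
      2 * √r * (16 / √(|τ| * (κ ^ 2 * |η| / (2 * D ^ 3)))) := by
  set B := 16 / √(|τ| * (κ ^ 2 * |η| / (2 * D ^ 3))) with hB
  set g : ℝ × ℝ → ℂ := fun q => (Real.exp (-σ * (q.1 ^ 2 + q.2 ^ 2)) : ℂ) *
      Complex.exp (Complex.I * ((z.1 * q.1 + z.2 * q.2 +
        τ * layerDisp κ η (q.1 ^ 2 + q.2 ^ 2) : ℝ) : ℂ)) with hg
  have hdc : Continuous fun q : ℝ × ℝ => layerDisp κ η (q.1 ^ 2 + q.2 ^ 2) :=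
    Real.continuous_sqrt.comp (Continuous.div (by fun_prop) (by fun_prop) fun q => by positivity)
  have gc : Continuous g := by fun_prop
  have hgn : ∀ q, ‖g q‖ ≤ 1 := fun q => by
    simp only [hg]
    rw [norm_mul, mul_comm Complex.I, Complex.norm_exp_ofReal_mul_I, mul_one, Complex.norm_real,
      Real.norm_of_nonneg (Real.exp_pos _).le, Real.exp_le_one_iff, neg_mul, neg_nonpos]
    positivity
  have hSm : MeasurableSet (discSector r) := by
    have h1 : IsClosed {q : ℝ × ℝ | 4 * q.1 ^ 2 ≤ q.1 ^ 2 + q.2 ^ 2} :=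
      isClosed_le (by fun_prop) (by fun_prop)
    have h2 : IsClosed {q : ℝ × ℝ | q.1 ^ 2 + q.2 ^ 2 ≤ r} :=
      isClosed_le (by fun_prop) (by fun_prop)
    exact h1.measurableSet.inter h2.measurableSet
  have hSsub : discSector r ⊆ Icc (-√r) (√r) ×ˢ Icc (-√r) (√r) := by
    rintro ⟨x, y⟩ ⟨-, h⟩
    simp only at h
    have hr : 0 ≤ r := le_trans (by positivity) h
    constructor
    · exact (Real.sq_le hr).1 (by nlinarith [sq_nonneg y])
    · exact (Real.sq_le hr).1 (by nlinarith [sq_nonneg x])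
  have hSfin : volume (discSector r) < ∞ :=
    ((isCompact_Icc.prod isCompact_Icc).isBounded.subset hSsub).measure_lt_top
  have hint : IntegrableOn g (discSector r) :=
    Measure.integrableOn_of_bounded hSfin.ne gc.aestronglyMeasurable
      (Filter.Eventually.of_forall hgn)
  rw [← integral_indicator hSm]
  rw [Measure.volume_eq_prod, integral_prod_symm _ ((integrable_indicator_iff hSm).2 hint)]
  have hslice : ∀ y, ‖∫ x, (discSector r).indicator g (x, y)‖ ≤
      (Icc (-√r) (√r)).indicator (fun _ => B) y := fun y => by
    -- At fixed `y` the two conditions say `x² ≤ y² / 3` and `x² ≤ r - y²`, so the slice is a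
    -- symmetric interval or empty.
    by_cases hy : 0 ≤ min (y ^ 2 / 3) (r - y ^ 2)
    · have hr : 0 ≤ r := by
        have := hy.trans (min_le_right _ _); nlinarith [sq_nonneg y]
      have hyr : y ∈ Icc (-√r) (√r) :=
        (Real.sq_le hr).1 (by linarith [hy.trans (min_le_right (y ^ 2 / 3) (r - y ^ 2))])
      rw [indicator_of_mem hyr]
      set m := √(min (y ^ 2 / 3) (r - y ^ 2)) with hm
      have hm2 : m ^ 2 = min (y ^ 2 / 3) (r - y ^ 2) := Real.sq_sqrt hy
      have hm0 : 0 ≤ m := Real.sqrt_nonneg _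
      have e : (fun x => (discSector r).indicator g (x, y)) =
          (Icc (-m) m).indicator fun x => g (x, y) := by
        ext x
        have : (x, y) ∈ discSector r ↔ x ∈ Icc (-m) m := by
          rw [mem_Icc, hm, ← Real.sq_le hy, le_min_iff]
          simp only [discSector, mem_ofPred_eq]
          constructor
          · rintro ⟨h1, h2⟩; constructor <;> linarith
          · rintro ⟨h1, h2⟩; constructor <;> linarith
        by_cases hx : x ∈ Icc (-m) m
        · rw [indicator_of_mem hx, indicator_of_mem (this.2 hx)]
        · rw [indicator_of_notMem hx, indicator_of_notMem (fun h => hx (this.1 h))]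
      rw [e, integral_indicator measurableSet_Icc, integral_Icc_eq_integral_Ioc,
        ← intervalIntegral.integral_of_le (by linarith)]
      have e2 : ∀ x : ℝ, g (x, y) = Complex.exp (Complex.I * (z.2 * y : ℝ)) *
          ((Real.exp (-σ * (x ^ 2 + y ^ 2)) : ℂ) * Complex.exp (Complex.I *
            ((z.1 * x + τ * layerDisp κ η (x ^ 2 + y ^ 2) : ℝ) : ℂ))) := fun x => by
        simp only [hg]
        rw [mul_left_comm, ← Complex.exp_add]
        push_cast
        ring_nf
      simp only [e2, intervalIntegral.integral_const_mul]
      rw [norm_mul, mul_comm Complex.I, Complex.norm_exp_ofReal_mul_I, one_mul]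
      refine norm_slice_le hκ hη hτ hσ hm0 ?_ ?_ z.1
      · rw [hm2]; linarith [min_le_left (y ^ 2 / 3) (r - y ^ 2)]
      · rw [hm2]; linarith [min_le_right (y ^ 2 / 3) (r - y ^ 2)]
    · have e : ∀ x, (discSector r).indicator g (x, y) = 0 := fun x => by
        refine indicator_of_notMem (fun h => hy ?_) _
        have h2 := h.2
        simp only at h2
        refine le_min (by positivity) (by nlinarith [sq_nonneg x])
      simp only [e, integral_zero, norm_zero]
      exact indicator_nonneg (fun _ _ => by positivity) _
  refine (norm_integral_le_of_norm_le ?_ (Filter.Eventually.of_forall hslice)).trans ?_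
  · exact (integrable_indicator_iff measurableSet_Icc).2 (integrableOn_const (by simp))
  · rw [integral_indicator measurableSet_Icc, setIntegral_const]
    simp only [measureReal_def, Real.volume_Icc, sub_neg_eq_add, smul_eq_mul]
    rw [ENNReal.toReal_ofReal (by positivity)]
    linarith


/-- The part of a disc in the two opposite sectors of half-angle `π / 6` orthogonal to `u`. -/
def planeSector (u : Plane) (r : ℝ) : Set Plane :=
  {ξ | 4 * inner ℝ u ξ ^ 2 ≤ ‖ξ‖ ^ 2 ∧ ‖ξ‖ ^ 2 ≤ r}

theorem measurableSet_planeSector (u : Plane) (r : ℝ) : MeasurableSet (planeSector u r) := by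
  have h1 : IsClosed {ξ : Plane | 4 * inner ℝ u ξ ^ 2 ≤ ‖ξ‖ ^ 2} :=
    isClosed_le (by fun_prop) (by fun_prop)
  have h2 : IsClosed {ξ : Plane | ‖ξ‖ ^ 2 ≤ r} := isClosed_le (by fun_prop) (by fun_prop)
  exact h1.measurableSet.inter h2.measurableSet

theorem norm_sq_plane (ξ : Plane) : ‖ξ‖ ^ 2 = ξ 0 ^ 2 + ξ 1 ^ 2 := by
  rw [EuclideanSpace.norm_sq_eq, Fin.sum_univ_two]; simp

theorem inner_plane (z ξ : Plane) : inner ℝ z ξ = z 0 * ξ 0 + z 1 * ξ 1 := by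
  rw [PiLp.inner_apply, Fin.sum_univ_two]; simp [mul_comm]

/-- The norm and the dispersion relation are invariant under isometries, so the direction `u` may be
taken to be the first coordinate axis. -/
theorem norm_planeSector_integral_le {κ η τ σ r D : ℝ} (hκ : 0 < κ) (hη : 2 ≤ η ^ 2)
    (hτ : τ ≠ 0) (hσ : 0 ≤ σ) (hD : r + κ ≤ D) {u : Plane} (hu : ‖u‖ = 1) (z : Plane) :
    ‖∫ ξ in planeSector u r, (Real.exp (-σ * ‖ξ‖ ^ 2) : ℂ) *
      Complex.exp (Complex.I * ((inner ℝ z ξ + τ * layerDisp κ η (‖ξ‖ ^ 2) : ℝ) : ℂ))‖ ≤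
      2 * √r * (16 / √(|τ| * (κ ^ 2 * |η| / (2 * D ^ 3)))) := by
  set e : Plane := EuclideanSpace.single 0 1 with he
  have hee : ‖u‖ = ‖e‖ := by simp [he, hu]
  -- The reflection in the line orthogonal to `u - e` maps `u` to `e`, because both are unit
  -- vectors.
  set L : Plane ≃ₗᵢ[ℝ] Plane := (ℝ ∙ (u - e))ᗮ.reflection with hL
  have hLu : L u = e := Submodule.reflection_sub hee
  have hLi : ∀ ξ, L ξ 0 = inner ℝ u ξ := fun ξ => by
    rw [← L.inner_map_map, hLu, inner_plane]
    simp [he]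
  set T : Plane ≃ᵐ ℝ × ℝ := (L.toMeasurableEquiv.trans
    (MeasurableEquiv.toLp 2 (Fin 2 → ℝ)).symm).trans MeasurableEquiv.finTwoArrow with hT
  have hTm : MeasurePreserving T volume volume :=
    (volume_preserving_finTwoArrow ℝ).comp ((PiLp.volume_preserving_ofLp (Fin 2)).comp
      L.measurePreserving)
  have hT1 : ∀ ξ, (T ξ).1 = L ξ 0 := fun ξ => rfl
  have hT2 : ∀ ξ, (T ξ).2 = L ξ 1 := fun ξ => rfl
  have hn : ∀ ξ, ‖ξ‖ ^ 2 = (T ξ).1 ^ 2 + (T ξ).2 ^ 2 := fun ξ => by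
    rw [hT1, hT2, ← norm_sq_plane, L.norm_map]
  have hz : ∀ ξ, inner ℝ z ξ = (T z).1 * (T ξ).1 + (T z).2 * (T ξ).2 := fun ξ => by
    rw [hT1, hT2, hT1, hT2, ← inner_plane, L.inner_map_map]
  have hS : planeSector u r = T ⁻¹' discSector r := by
    ext ξ
    rw [mem_preimage, planeSector, discSector, mem_ofPred_eq, mem_ofPred_eq, ← hn, hT1, hLi]
  have h := norm_discSector_integral_le hκ hη hτ hσ hD (T z)
  rw [← hTm.setIntegral_preimage_emb T.measurableEmbedding, ← hS] at h
  simp only [← hn, ← hz] at h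
  exact h

/-- Three unit vectors whose orthogonal sectors cover the plane. -/
def sectorDir : Fin 3 → Plane := ![!₂[1, 0], !₂[1 / 2, √3 / 2], !₂[1 / 2, -(√3 / 2)]]

theorem norm_sectorDir (i : Fin 3) : ‖sectorDir i‖ = 1 := by
  have h3 : √3 ^ 2 = 3 := Real.sq_sqrt (by norm_num)
  have h : ‖sectorDir i‖ ^ 2 = 1 := by
    rw [norm_sq_plane]
    fin_cases i <;> simp [sectorDir] <;> rw [div_pow, h3] <;> norm_num
  nlinarith [norm_nonneg (sectorDir i)]

/-- The lines spanned by the three directions meet at angles `π / 3`, and each double sector has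
opening `π / 3`. Algebraically, a point outside all three would satisfy `y² < 3x²` and `y² ± √3 x y
> 0`, whereas the product of the last two expressions is `y² (y² - 3x²)`. -/
theorem exists_mem_planeSector {ξ : Plane} {r : ℝ} (hξ : ‖ξ‖ ^ 2 ≤ r) :
    ∃ i, ξ ∈ planeSector (sectorDir i) r := by
  have h3 : √3 ^ 2 = 3 := Real.sq_sqrt (by norm_num)
  by_contra! hcon
  have h : ∀ i, ‖ξ‖ ^ 2 < 4 * inner ℝ (sectorDir i) ξ ^ 2 := fun i => by
    by_contra! hi
    exact hcon i ⟨hi, hξ⟩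
  have a := h 0
  have b := h 1
  have c := h 2
  rw [norm_sq_plane, inner_plane] at a b c
  simp [sectorDir] at a b c
  set x := ξ 0
  set y := ξ 1
  set t := √3
  have hb : 0 < y ^ 2 + t * (x * y) := by nlinarith
  have hc : 0 < y ^ 2 - t * (x * y) := by nlinarith
  have hbc := mul_pos hb hc
  have e : (y ^ 2 + t * (x * y)) * (y ^ 2 - t * (x * y)) = y ^ 2 * (y ^ 2 - 3 * x ^ 2) := by
    rw [← h3]; ring
  rw [e] at hbc
  nlinarith [sq_nonneg y, mul_nonneg (sq_nonneg y) (sub_nonneg.2 a.le)]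


/-! ### A `TT*` estimate -/

theorem integrable_abs_rpow_indicator (t : ℝ) :
    Integrable ((Icc (t - 1) (t + 1)).indicator fun s => |s - t| ^ (-(1 / 2) : ℝ)) ∧
    ∫ s, (Icc (t - 1) (t + 1)).indicator (fun s => |s - t| ^ (-(1 / 2) : ℝ)) s = 4 := by
  have h0 : IntervalIntegrable (fun u : ℝ => u ^ (-(1 / 2) : ℝ)) volume 0 1 :=
    intervalIntegral.intervalIntegrable_rpow' (by norm_num)
  have habs : ∀ u ∈ uIoc (0 : ℝ) 1, u ^ (-(1 / 2) : ℝ) = |u| ^ (-(1 / 2) : ℝ) := fun u hu => by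
    rw [uIoc_of_le zero_le_one] at hu
    rw [abs_of_pos hu.1]
  have h1 : IntervalIntegrable (fun u : ℝ => |u| ^ (-(1 / 2) : ℝ)) volume 0 1 :=
    h0.congr habs
  have h2 : IntervalIntegrable (fun u : ℝ => |u| ^ (-(1 / 2) : ℝ)) volume (-1) 0 := by
    have := (IntervalIntegrable.iff_comp_neg (by simp)).1 h1
    simpa using this.symm
  have i1 : ∫ u in (0 : ℝ)..1, |u| ^ (-(1 / 2) : ℝ) = 2 := by
    rw [← intervalIntegral.integral_congr_ae (Filter.Eventually.of_forall habs),
      integral_rpow (Or.inl (by norm_num))]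
    norm_num
  have i2 : ∫ u in (-1 : ℝ)..0, |u| ^ (-(1 / 2) : ℝ) = 2 := by
    have := intervalIntegral.integral_comp_neg (a := 0) (b := 1)
      (fun u : ℝ => |u| ^ (-(1 / 2) : ℝ))
    simp only [abs_neg, neg_zero] at this
    rw [← this, i1]
  have h3 := h2.trans h1
  have i3 : ∫ u in (-1 : ℝ)..1, |u| ^ (-(1 / 2) : ℝ) = 4 := by
    rw [← intervalIntegral.integral_add_adjacent_intervals h2 h1, i1, i2]; norm_num
  have h4 : IntervalIntegrable (fun s : ℝ => |s - t| ^ (-(1 / 2) : ℝ)) volume (t - 1) (t + 1) := by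
    have := h3.comp_sub_right t
    convert! this using 1 <;> ring
  constructor
  · rw [integrable_indicator_iff measurableSet_Icc, integrableOn_Icc_iff_integrableOn_Ioc,
      ← intervalIntegrable_iff_integrableOn_Ioc_of_le (by linarith)]
    exact h4
  · rw [integral_indicator measurableSet_Icc, integral_Icc_eq_integral_Ioc,
      ← intervalIntegral.integral_of_le (by linarith),
      intervalIntegral.integral_comp_sub_right (fun u => |u| ^ (-(1 / 2) : ℝ)), ← i3]
    congr 1 <;> ring

theorem integrableOn_exp_neg : IntegrableOn (fun s : ℝ => Real.exp (-s)) (Ioi 0) ∧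
    ∫ s in Ioi (0 : ℝ), Real.exp (-s) = 1 :=
  ⟨integrableOn_exp_neg_Ioi 0, by rw [integral_exp_neg_Ioi]; simp⟩

/-- A majorant for `s ↦ exp (-s) |s - t| ^ (-1/2)`. -/
def kernelMajorant (t s : ℝ) : ℝ :=
  (Icc (t - 1) (t + 1)).indicator (fun s => |s - t| ^ (-(1 / 2) : ℝ)) s + Real.exp (-s)

theorem exp_mul_rpow_le_kernelMajorant (t : ℝ) {s : ℝ} (hs : 0 < s) :
    Real.exp (-s) * |s - t| ^ (-(1 / 2) : ℝ) ≤ kernelMajorant t s := by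
  have h1 : Real.exp (-s) ≤ 1 := Real.exp_le_one_iff.2 (by linarith)
  have h2 := Real.exp_pos (-s)
  have h3 : 0 ≤ |s - t| ^ (-(1 / 2) : ℝ) := by positivity
  rw [kernelMajorant]
  by_cases h : s ∈ Icc (t - 1) (t + 1)
  · rw [indicator_of_mem h]
    nlinarith
  · rw [indicator_of_notMem h, zero_add]
    have h4 : 1 ≤ |s - t| := by
      by_contra! hlt
      rw [abs_lt] at hlt
      exact h ⟨by linarith, by linarith⟩
    have h5 : |s - t| ^ (-(1 / 2) : ℝ) ≤ 1 := Real.rpow_le_one_of_one_le_of_nonpos h4 (by norm_num)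
    nlinarith

theorem integrableOn_kernelMajorant (t : ℝ) : IntegrableOn (kernelMajorant t) (Ioi 0) :=
  (integrable_abs_rpow_indicator t).1.integrableOn.add integrableOn_exp_neg.1

/-- The singularity contributes `4` and the exponential tail `1`, uniformly in `t`. -/
theorem integral_kernelMajorant_le (t : ℝ) : ∫ s in Ioi (0 : ℝ), kernelMajorant t s ≤ 5 := by
  have h : ∫ s in Ioi (0 : ℝ), (Icc (t - 1) (t + 1)).indicator
      (fun s => |s - t| ^ (-(1 / 2) : ℝ)) s ≤ 4 := by
    rw [← (integrable_abs_rpow_indicator t).2]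
    refine setIntegral_le_integral (integrable_abs_rpow_indicator t).1 ?_
    exact Filter.Eventually.of_forall fun s => indicator_nonneg (fun _ _ => by positivity) _
  unfold kernelMajorant
  rw [integral_add (integrable_abs_rpow_indicator t).1.integrableOn integrableOn_exp_neg.1,
    integrableOn_exp_neg.2]
  linarith

section TTstar

variable {H : Type*} [NormedAddCommGroup H] [InnerProductSpace ℂ H] [CompleteSpace H]

/-- If the kernel `⟪G s, G t⟫` decays like `|s - t| ^ (-1/2)`, then `∫ G` is bounded. -/
theorem norm_integral_sq_le_of_kernel {G : ℝ → H} {B K : ℝ} (hK : 0 ≤ K)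
    (hG : AEStronglyMeasurable G (volume.restrict (Ioi 0)))
    (hB : ∀ t, 0 < t → ‖G t‖ ≤ B * Real.exp (-t))
    (hk : ∀ s t, 0 < s → 0 < t → s ≠ t →
      ‖inner ℂ (G s) (G t)‖ ≤ K * Real.exp (-(s + t)) * |s - t| ^ (-(1 / 2) : ℝ)) :
    IntegrableOn G (Ioi 0) ∧ ‖∫ t in Ioi (0 : ℝ), G t‖ ^ 2 ≤ 5 * K := by
  have hint : IntegrableOn G (Ioi 0) :=
    (integrableOn_exp_neg.1.const_mul B).mono' hG
      ((ae_restrict_iff' measurableSet_Ioi).2 (Filter.Eventually.of_forall fun t ht => hB t ht))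
  refine ⟨hint, ?_⟩
  set v := ∫ t in Ioi (0 : ℝ), G t with hv
  -- A Schur-type argument: integrating the kernel in one time leaves `5 K exp (-t)`, and the second
  -- integration costs a factor `1`.
  have hin : ∀ t, 0 < t → ‖inner ℂ v (G t)‖ ≤ 5 * K * Real.exp (-t) := fun t ht => by
    rw [← inner_conj_symm, RCLike.norm_conj, hv, ← integral_inner hint]
    calc ‖∫ s in Ioi (0 : ℝ), inner ℂ (G t) (G s)‖
        ≤ ∫ s in Ioi (0 : ℝ), K * Real.exp (-t) * kernelMajorant t s := by
          refine norm_integral_le_of_norm_le ((integrableOn_kernelMajorant t).const_mul _) ?_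
          rw [ae_restrict_iff' measurableSet_Ioi]
          have hne : ∀ᵐ s : ℝ, s ≠ t := by
            rw [ae_iff]; simp
          filter_upwards [hne] with s hst hs
          refine (hk t s ht hs hst.symm).trans ?_
          have := exp_mul_rpow_le_kernelMajorant t hs
          rw [neg_add, Real.exp_add, abs_sub_comm]
          calc K * (Real.exp (-t) * Real.exp (-s)) * |s - t| ^ (-(1 / 2) : ℝ)
              = K * Real.exp (-t) * (Real.exp (-s) * |s - t| ^ (-(1 / 2) : ℝ)) := by ring
            _ ≤ _ := by gcongr
      _ = K * Real.exp (-t) * ∫ s in Ioi (0 : ℝ), kernelMajorant t s := integral_const_mul _ _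
      _ ≤ K * Real.exp (-t) * 5 := by gcongr; exact integral_kernelMajorant_le t
      _ = _ := by ring
  have h1 : ‖v‖ ^ 2 = ‖inner ℂ v v‖ := by
    rw [inner_self_eq_norm_sq_to_K]; simp
  rw [h1]
  nth_rewrite 2 [hv]
  rw [← integral_inner hint]
  refine (norm_integral_le_of_norm_le (integrableOn_exp_neg.1.const_mul (5 * K)) ?_).trans ?_
  · rw [ae_restrict_iff' measurableSet_Ioi]
    exact Filter.Eventually.of_forall fun t ht => hin t ht
  · rw [integral_const_mul, integrableOn_exp_neg.2, mul_one]

/-- The `TT*` estimate for a finite family. -/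
theorem lintegral_iSup_le_inner_le {γ : ℕ → ℝ → H} (hc : ∀ i, Continuous (γ i)) {B K : ℝ}
    (hK : 0 ≤ K) (hB : ∀ i t, 0 < t → ‖γ i t‖ ≤ B * Real.exp (-t))
    (hk : ∀ i j s t, 0 < s → 0 < t → s ≠ t → ‖inner ℂ (γ i s) (γ j t)‖ ≤
      K * Real.exp (-(s + t)) * |s - t| ^ (-(1 / 2) : ℝ)) (f : H) (N : ℕ) :
    ∫⁻ t in Ioi (0 : ℝ), ⨆ i ≤ N, ‖inner ℂ (γ i t) f‖ₑ ≤ ENNReal.ofReal (√(5 * K) * ‖f‖) := by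
  classical
  have hac : ∀ i, Continuous fun t => inner ℂ (γ i t) f := fun i => (hc i).inner continuous_const
  have hex : ∀ t, ∃ i, i ≤ N ∧ ∀ j ≤ N, ‖inner ℂ (γ j t) f‖ ≤ ‖inner ℂ (γ i t) f‖ := fun t => by
    obtain ⟨i, hi, h⟩ := Finset.exists_max_image (Finset.range (N + 1))
      (fun i => ‖inner ℂ (γ i t) f‖) ⟨0, by simp⟩
    exact ⟨i, by simpa [Nat.lt_succ_iff] using hi, fun j hj => h j (by simpa [Nat.lt_succ_iff])⟩
  -- Taking the least maximising index makes the choice of the point a measurable function of time.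
  set sel : ℝ → ℕ := fun t => Nat.find (hex t) with hsel
  have hselm : Measurable sel := by
    refine measurable_find hex fun i => ?_
    by_cases hi : i ≤ N
    · have : {t | i ≤ N ∧ ∀ j ≤ N, ‖inner ℂ (γ j t) f‖ ≤ ‖inner ℂ (γ i t) f‖} =
          ⋂ j ∈ Iic N, {t | ‖inner ℂ (γ j t) f‖ ≤ ‖inner ℂ (γ i t) f‖} := by
        ext t; simp [hi]
      rw [this]
      exact (isClosed_biInter fun j _ => isClosed_le (hac j).norm (hac i).norm).measurableSet
    · simp [hi]
  have hselN : ∀ t, sel t ≤ N := fun t => (Nat.find_spec (hex t)).1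
  have hselmax : ∀ t, ∀ j ≤ N, ‖inner ℂ (γ j t) f‖ ≤ ‖inner ℂ (γ (sel t) t) f‖ :=
    fun t => (Nat.find_spec (hex t)).2
  set γs : ℝ → H := fun t => γ (sel t) t with hγs
  have hγsm : StronglyMeasurable γs := by
    have e : γs = fun t => ∑ i ∈ Finset.range (N + 1), (sel ⁻¹' {i}).indicator (γ i) t := by
      ext t
      rw [Finset.sum_eq_single (sel t)]
      · rw [indicator_of_mem (by simp)]
      · intro i _ hi
        exact indicator_of_notMem (by simpa using hi.symm) _
      · intro h
        exact absurd (Finset.mem_range.2 (Nat.lt_succ_of_le (hselN t))) h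
    rw [e]
    exact Finset.stronglyMeasurable_fun_sum _ fun i _ =>
      (hc i).stronglyMeasurable.indicator (hselm (measurableSet_singleton i))
  set a : ℝ → ℂ := fun t => inner ℂ (γs t) f with ha
  have ham : StronglyMeasurable a := hγsm.inner stronglyMeasurable_const
  -- The phase of `a t` is chosen so that pairing with `f` gives `|a t|`. Where `a t = 0`, division
  -- by zero makes `G t = 0`, which is consistent.
  set G : ℝ → H := fun t => (a t / ‖a t‖) • γs t with hG
  have hGm : StronglyMeasurable G := by
    refine StronglyMeasurable.smul (Measurable.stronglyMeasurable ?_) hγsm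
    exact ham.measurable.div (Complex.measurable_ofReal.comp ham.measurable.norm)
  have hph : ∀ t, ‖a t / ‖a t‖‖ ≤ 1 := fun t => by
    rw [norm_div, Complex.norm_real, norm_norm]; exact div_self_le_one _
  have hGB : ∀ t, 0 < t → ‖G t‖ ≤ B * Real.exp (-t) := fun t ht => by
    rw [hG, norm_smul]
    exact (mul_le_of_le_one_left (norm_nonneg _) (hph t)).trans (hB _ t ht)
  have hGk : ∀ s t, 0 < s → 0 < t → s ≠ t → ‖inner ℂ (G s) (G t)‖ ≤
      K * Real.exp (-(s + t)) * |s - t| ^ (-(1 / 2) : ℝ) := fun s t hs ht hst => by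
    simp only [hG]
    rw [inner_smul_left, inner_smul_right, norm_mul, norm_mul, RCLike.norm_conj, ← mul_assoc]
    refine (mul_le_of_le_one_left (norm_nonneg _) ?_).trans (hk _ _ s t hs ht hst)
    exact mul_le_one₀ (hph s) (norm_nonneg _) (hph t)
  obtain ⟨hGi, hGn⟩ := norm_integral_sq_le_of_kernel hK hGm.aestronglyMeasurable hGB hGk
  have hGa : ∀ t, inner ℂ f (G t) = (‖a t‖ : ℂ) := fun t => by
    have h : inner ℂ f (γs t) = (starRingEnd ℂ) (a t) := (inner_conj_symm _ _).symm
    simp only [hG]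
    rw [inner_smul_right, h, div_mul_eq_mul_div, Complex.mul_conj']
    by_cases h0 : (‖a t‖ : ℂ) = 0
    · simp [h0]
    · field_simp
  have hai : IntegrableOn (fun t => ‖a t‖) (Ioi 0) := by
    have h := (hGi.const_inner (𝕜 := ℂ) f).norm
    refine h.congr (Filter.Eventually.of_forall fun t => ?_)
    simp only [hGa]
    simp
  -- Duality: `∫ |a|` is the pairing of `f` with `∫ G`, whose norm is controlled by the kernel.
  have hle : ∫ t in Ioi (0 : ℝ), ‖a t‖ ≤ √(5 * K) * ‖f‖ := by
    have h1 : ((∫ t in Ioi (0 : ℝ), ‖a t‖ : ℝ) : ℂ) = inner ℂ f (∫ t in Ioi (0 : ℝ), G t) := by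
      rw [← integral_inner hGi, ← integral_complex_ofReal]
      simp only [hGa]
    have h2 : ∫ t in Ioi (0 : ℝ), ‖a t‖ ≤ ‖inner ℂ f (∫ t in Ioi (0 : ℝ), G t)‖ := by
      rw [← h1, Complex.norm_real]; exact le_abs_self _
    refine h2.trans ((norm_inner_le_norm _ _).trans ?_)
    rw [mul_comm]
    exact mul_le_mul_of_nonneg_right (Real.le_sqrt_of_sq_le hGn) (norm_nonneg _)
  calc ∫⁻ t in Ioi (0 : ℝ), ⨆ i ≤ N, ‖inner ℂ (γ i t) f‖ₑ
      ≤ ∫⁻ t in Ioi (0 : ℝ), ENNReal.ofReal ‖a t‖ := by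
        refine lintegral_mono fun t => iSup₂_le fun j hj => ?_
        rw [ofReal_norm]
        exact enorm_le_iff_norm_le.2 (hselmax t j hj)
    _ = ENNReal.ofReal (∫ t in Ioi (0 : ℝ), ‖a t‖) :=
        (ofReal_integral_eq_lintegral_ofReal hai
          (Filter.Eventually.of_forall fun t => norm_nonneg _)).symm
    _ ≤ _ := ENNReal.ofReal_le_ofReal hle

/-- The `TT*` estimate for a sequence. -/
theorem lintegral_iSup_inner_le {γ : ℕ → ℝ → H} (hc : ∀ i, Continuous (γ i)) {B K : ℝ}
    (hK : 0 ≤ K) (hB : ∀ i t, 0 < t → ‖γ i t‖ ≤ B * Real.exp (-t))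
    (hk : ∀ i j s t, 0 < s → 0 < t → s ≠ t → ‖inner ℂ (γ i s) (γ j t)‖ ≤
      K * Real.exp (-(s + t)) * |s - t| ^ (-(1 / 2) : ℝ)) (f : H) :
    ∫⁻ t in Ioi (0 : ℝ), ⨆ i, ‖inner ℂ (γ i t) f‖ₑ ≤ ENNReal.ofReal (√(5 * K) * ‖f‖) := by
  have hac : ∀ i, Continuous fun t => inner ℂ (γ i t) f := fun i => (hc i).inner continuous_const
  have e : ∀ t, ⨆ i, ‖inner ℂ (γ i t) f‖ₑ = ⨆ N : ℕ, ⨆ i ≤ N, ‖inner ℂ (γ i t) f‖ₑ := fun t =>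
    le_antisymm (iSup_le fun i => le_iSup_of_le i (le_iSup₂_of_le i le_rfl le_rfl))
      (iSup_le fun N => iSup₂_le fun i _ => le_iSup (fun i => ‖inner ℂ (γ i t) f‖ₑ) i)
  simp only [e]
  -- Monotone convergence applies because the suprema over `i ≤ N` increase with `N`.
  rw [lintegral_iSup]
  · exact iSup_le fun N => lintegral_iSup_le_inner_le hc hK hB hk f N
  · exact fun N => Measurable.iSup fun i => Measurable.iSup fun _ => (hac i).enorm.measurable
  · intro N M hNM t
    exact iSup₂_le fun i hi => le_iSup₂_of_le i (hi.trans hNM) le_rfl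

end TTstar


/-! ### The Fourier transform on `L²` -/

section Fourier

open scoped SchwartzMap

variable {E F : Type*} [NormedAddCommGroup E] [InnerProductSpace ℝ E] [FiniteDimensional ℝ E]
  [MeasurableSpace E] [BorelSpace E]
  [NormedAddCommGroup F] [InnerProductSpace ℂ F] [CompleteSpace F]

/-- On `L¹ ∩ L²` the Plancherel inverse Fourier transform is given by the integral. -/
theorem coeFn_fourierInv_of_integrable {f : Lp F 2 (volume : Measure E)} (hf : Integrable f) :
    ((𝓕⁻ f : Lp F 2 (volume : Measure E)) : E → F) =ᵐ[volume] 𝓕⁻ (f : E → F) := by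
  have hcont : Continuous (𝓕⁻ (f : E → F)) := by
    rw [Real.fourierInv_eq_fourier_comp_neg]
    exact VectorFourier.fourierIntegral_continuous Real.continuous_fourierChar
      (by exact continuous_inner) hf.comp_neg
  refine ae_eq_of_integral_contDiff_smul_eq
    ((Lp.memLp _).locallyIntegrable (by norm_num)) hcont.locallyIntegrable fun g hg hgc => ?_
  have hgc' : HasCompactSupport fun x => (g x : ℂ) := hgc.comp_left (g := Complex.ofReal) rfl
  set G : 𝓢(E, ℂ) := hgc'.toSchwartzMap (Complex.ofRealCLM.contDiff.comp hg) with hG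
  have h1 : ∀ x, G x = (g x : ℂ) := fun x => rfl
  -- Both candidates are tested against smooth compactly supported functions. The transform moves to
  -- the test function by the distributional definition for the `L²` transform, and by Fubini for
  -- the integral.
  have h2 := congrArg (fun T => T G) (Lp.fourierInv_toTemperedDistribution_eq f)
  simp only [TemperedDistribution.fourierInv_apply, Lp.toTemperedDistribution_apply] at h2
  calc ∫ x, g x • (𝓕⁻ f : Lp F 2 (volume : Measure E)) x
      = ∫ x, G x • (𝓕⁻ f : Lp F 2 (volume : Measure E)) x := by simp [h1]
    _ = ∫ x, (𝓕⁻ (G : E → ℂ)) x • f x := by rw [← h2, SchwartzMap.fourierInv_coe]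
    _ = ∫ x, G x • 𝓕⁻ (f : E → F) x :=
        VectorFourier.integral_fourierIntegral_smul_eq_flip (L := -innerₗ E)
          Real.continuous_fourierChar (by simpa using! continuous_inner.neg) G.integrable hf
          |>.trans (by
            have : (-innerₗ E).flip = -innerₗ E := by ext x y; simp [real_inner_comm]
            simp [FourierTransformInv.fourierInv, this])
    _ = _ := by simp [h1]

/-- The inverse Fourier transform on `L²` commutes with operators on the values. -/
theorem fourierInv_compLp (A : F →L[ℂ] F) (f : Lp F 2 (volume : Measure E)) :
    𝓕⁻ (A.compLp f) = A.compLp (𝓕⁻ f) := by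
  have hinj := Lp.ker_toTemperedDistributionCLM_eq_bot (E := E) (F := F) (μ := volume) (p := 2)
  have hint : ∀ (G : 𝓢(E, ℂ)) (h : Lp F 2 (volume : Measure E)), Integrable fun x => G x • h x := by
    intro G h
    exact memLp_one_iff_integrable.1 ((Lp.memLp h).smul (G.memLp 2))
  have hA : ∀ (G : 𝓢(E, ℂ)) (h : Lp F 2 (volume : Measure E)),
      ∫ x, G x • A.compLp h x = A (∫ x, G x • h x) := by
    intro G h
    rw [← A.integral_comp_comm (hint G h)]
    refine integral_congr_ae ?_
    filter_upwards [A.coeFn_compLp h] with x hx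
    rw [hx, map_smul]
  have hinj' := LinearMap.ker_eq_bot.1 hinj
  -- Functions in `L²` embed injectively in tempered distributions, where the transform is defined
  -- by duality and the operator on values can be pulled out of the pairing.
  apply hinj'
  change ((𝓕⁻ (A.compLp f) : Lp F 2 (volume : Measure E)) : 𝓢'(E, F)) =
    ((A.compLp (𝓕⁻ f) : Lp F 2 (volume : Measure E)) : 𝓢'(E, F))
  rw [← Lp.fourierInv_toTemperedDistribution_eq]
  ext G
  have h2 := congrArg (fun T => T G) (Lp.fourierInv_toTemperedDistribution_eq f)
  simp only [TemperedDistribution.fourierInv_apply, Lp.toTemperedDistribution_apply] at h2 ⊢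
  rw [hA, hA, h2]

end Fourier

/-- The reflection `reflectVec` as a linear map. -/
def reflectL : Vec4 →L[ℂ] Vec4 :=
  LinearMap.toContinuousLinearMap
    { toFun := fun w => WithLp.toLp 2 (reflectVec w.ofLp)
      map_add' := fun v w => by rw [WithLp.ofLp_add, reflectVec_add, WithLp.toLp_add]
      map_smul' := fun c w => by
        rw [RingHom.id_apply, WithLp.ofLp_smul, reflectVec_smul, WithLp.toLp_smul] }

theorem reflectL_apply (w : Vec4) : reflectL w = WithLp.toLp 2 (reflectVec w.ofLp) := rfl

theorem reflectL_reflectL (w : Vec4) : reflectL (reflectL w) = w := by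
  rw [reflectL_apply, reflectL_apply, reflectVec_reflectVec]

/-- The reflection `reflectVec` as a continuous linear equivalence. -/
def reflectEquiv : Vec4 ≃L[ℂ] Vec4 :=
  ContinuousLinearEquiv.equivOfInverse reflectL reflectL reflectL_reflectL reflectL_reflectL

theorem vertIntegrand_neg (n : ℤ) (f : Plane × ℝ → Vec4) (x : Plane × ℝ) :
    vertIntegrand .stressFree (-n) f x = reflectL (vertIntegrand .stressFree n f x) := by
  rw [reflectL_apply]
  ext j
  fin_cases j <;> simp [vertIntegrand, vertProfile, reflectVec, vertFreq]

theorem vertCoeff_neg (n : ℤ) (f : L2Layer) :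
    vertCoeff .stressFree (-n) f = reflectL.compLp (vertCoeff .stressFree n f) := by
  refine Lp.ext ?_
  filter_upwards [(memLp_vertCoeffFun .stressFree (-n) f).coeFn_toLp,
    (memLp_vertCoeffFun .stressFree n f).coeFn_toLp,
    reflectL.coeFn_compLp (vertCoeff .stressFree n f)] with xh h1 h2 h3
  rw [h3]
  change (memLp_vertCoeffFun .stressFree (-n) f).toLp _ xh = reflectL
    ((memLp_vertCoeffFun .stressFree n f).toLp _ xh)
  rw [h1, h2, vertCoeffFun, vertCoeffFun]
  have := reflectEquiv.integral_comp_comm (μ := unitMeasure)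
    (fun x₃ => vertIntegrand .stressFree n f (xh, x₃))
  change ∫ x₃, reflectL (vertIntegrand .stressFree n f (xh, x₃)) ∂unitMeasure = reflectL _ at this
  rw [← this]
  simp only [vertIntegrand_neg]

/-- The cosine is even and the sine is odd in `n`, and the horizontal transform commutes with the
resulting sign changes of the components. -/
theorem layerFourier_neg (n : ℤ) (f : L2Layer) :
    layerFourier .stressFree f (-n) = reflectL.compLp (layerFourier .stressFree f n) := by
  have h := fourierInv_compLp reflectL (layerFourier .stressFree f n)
  have h2 : 𝓕⁻ (layerFourier .stressFree f n) = vertCoeff .stressFree n f :=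
    FourierTransform.fourierInv_fourier_eq _
  rw [h2, ← vertCoeff_neg] at h
  have h3 : 𝓕 (𝓕⁻ (reflectL.compLp (layerFourier .stressFree f n)) :
      Lp Vec4 2 (volume : Measure Plane)) = reflectL.compLp (layerFourier .stressFree f n) :=
    FourierTransform.fourier_fourierInv_eq _
  rw [← h3, h]
  rfl

/-! ### Linearity of the vertical Fourier coefficients -/

theorem lintegral_layer_lt_top {f : Plane × ℝ → Vec4} (hf : MemLp f 2 layerMeasure) :
    ∫⁻ x, ‖f x‖ₑ ^ (2 : ℝ) ∂layerMeasure < ∞ := by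
  have := (eLpNorm_lt_top_iff_lintegral_rpow_enorm_lt_top two_ne_zero
    ENNReal.ofNat_ne_top).1 hf.2
  simpa using this

instance : IsProbabilityMeasure unitMeasure := ⟨by simp⟩

theorem memLp_slice {f : Plane × ℝ → Vec4} (hf : MemLp f 2 layerMeasure) :
    ∀ᵐ xh : Plane, MemLp (fun x₃ => f (xh, x₃)) 2 unitMeasure := by
  have hfin := lintegral_layer_lt_top hf
  have hfm : AEMeasurable (fun x => ‖f x‖ₑ ^ (2 : ℝ)) layerMeasure :=
    hf.1.enorm.pow_const _
  rw [lintegral_prod _ hfm] at hfin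
  filter_upwards [hf.1.prodMk_left, ae_lt_top' hfm.lintegral_prod_right' hfin.ne] with xh h1 h2
  refine ⟨h1, ?_⟩
  rw [eLpNorm_lt_top_iff_lintegral_rpow_enorm_lt_top two_ne_zero ENNReal.ofNat_ne_top]
  simpa using h2

theorem memLp_vertIntegrand (bc : VerticalBC) (n : ℤ) {f : Plane × ℝ → Vec4}
    (hf : MemLp f 2 layerMeasure) : MemLp (vertIntegrand bc n f) 2 layerMeasure :=
  hf.of_le (aestronglyMeasurable_vertIntegrand bc n hf.1)
    (Filter.Eventually.of_forall fun x => norm_vertIntegrand_le bc n f x)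

theorem integrable_slice_vertIntegrand (bc : VerticalBC) (n : ℤ) {f : Plane × ℝ → Vec4}
    (hf : MemLp f 2 layerMeasure) :
    ∀ᵐ xh : Plane, Integrable (fun x₃ => vertIntegrand bc n f (xh, x₃)) unitMeasure := by
  filter_upwards [memLp_slice (memLp_vertIntegrand bc n hf)] with xh h
  exact h.integrable (by norm_num)

theorem vertIntegrand_add (bc : VerticalBC) (n : ℤ) (f g : Plane × ℝ → Vec4) (x : Plane × ℝ) :
    vertIntegrand bc n (f + g) x = vertIntegrand bc n f x + vertIntegrand bc n g x := by
  ext j; simp [vertIntegrand, mul_add]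

theorem vertIntegrand_smul (bc : VerticalBC) (n : ℤ) (c : ℂ) (f : Plane × ℝ → Vec4)
    (x : Plane × ℝ) : vertIntegrand bc n (c • f) x = c • vertIntegrand bc n f x := by
  ext j; simp [vertIntegrand]; ring

theorem vertCoeffFun_congr (bc : VerticalBC) (n : ℤ) {f g : Plane × ℝ → Vec4}
    (h : f =ᵐ[layerMeasure] g) : vertCoeffFun bc n f =ᵐ[volume] vertCoeffFun bc n g := by
  filter_upwards [Measure.ae_ae_of_ae_prod h] with xh hxh
  refine integral_congr_ae ?_
  filter_upwards [hxh] with x₃ hx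
  ext j
  simp only [vertIntegrand, hx]

theorem coeFn_vertCoeff (bc : VerticalBC) (n : ℤ) (f : L2Layer) :
    vertCoeff bc n f =ᵐ[volume] vertCoeffFun bc n f :=
  (memLp_vertCoeffFun bc n f).coeFn_toLp

theorem vertCoeff_add (bc : VerticalBC) (n : ℤ) (f g : L2Layer) :
    vertCoeff bc n (f + g) = vertCoeff bc n f + vertCoeff bc n g := by
  refine Lp.ext ?_
  filter_upwards [coeFn_vertCoeff bc n (f + g), coeFn_vertCoeff bc n f, coeFn_vertCoeff bc n g,
    Lp.coeFn_add (vertCoeff bc n f) (vertCoeff bc n g),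
    vertCoeffFun_congr bc n (Lp.coeFn_add f g),
    integrable_slice_vertIntegrand bc n (Lp.memLp f),
    integrable_slice_vertIntegrand bc n (Lp.memLp g)] with xh h1 h2 h3 h4 h5 h6 h7
  rw [h4, Pi.add_apply, h1, h2, h3, h5, vertCoeffFun, vertCoeffFun, vertCoeffFun,
    ← integral_add h6 h7]
  simp only [vertIntegrand_add]

theorem vertCoeff_smul (bc : VerticalBC) (n : ℤ) (c : ℂ) (f : L2Layer) :
    vertCoeff bc n (c • f) = c • vertCoeff bc n f := by
  refine Lp.ext ?_
  filter_upwards [coeFn_vertCoeff bc n (c • f), coeFn_vertCoeff bc n f,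
    Lp.coeFn_smul c (vertCoeff bc n f),
    vertCoeffFun_congr bc n (Lp.coeFn_smul c f)] with xh h1 h2 h4 h5
  rw [h4, Pi.smul_apply, h1, h2, h5, vertCoeffFun, vertCoeffFun, ← integral_smul]
  simp only [vertIntegrand_smul]

theorem norm_vertCoeff_le (bc : VerticalBC) (n : ℤ) (f : L2Layer) :
    ‖vertCoeff bc n f‖ ≤ ‖f‖ := by
  have hf := Lp.memLp f
  have hm := aestronglyMeasurable_vertIntegrand bc n hf.1
  rw [vertCoeff, Lp.norm_toLp, Lp.norm_def]
  refine ENNReal.toReal_mono hf.2.ne ?_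
  rw [eLpNorm_eq_lintegral_rpow_enorm_toReal two_ne_zero ENNReal.ofNat_ne_top,
    eLpNorm_eq_lintegral_rpow_enorm_toReal two_ne_zero ENNReal.ofNat_ne_top]
  refine ENNReal.rpow_le_rpow ?_ (by positivity)
  have hfm : AEMeasurable (fun x => ‖f x‖ₑ ^ (2 : ENNReal).toReal) layerMeasure :=
    hf.1.enorm.pow_const _
  rw [lintegral_prod _ hfm]
  refine lintegral_mono_ae ?_
  filter_upwards [hm.prodMk_left] with xh hxh
  have h1 : ‖vertCoeffFun bc n f xh‖ₑ
      ≤ eLpNorm (fun x₃ => vertIntegrand bc n f (xh, x₃)) 1 unitMeasure := by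
    rw [eLpNorm_one_eq_lintegral_enorm]
    exact enorm_integral_le_lintegral_enorm _
  have h2 : eLpNorm (fun x₃ => vertIntegrand bc n f (xh, x₃)) 1 unitMeasure
      ≤ eLpNorm (fun x₃ => vertIntegrand bc n f (xh, x₃)) 2 unitMeasure :=
    eLpNorm_le_eLpNorm_of_exponent_le (by norm_num) hxh
  have h3 : eLpNorm (fun x₃ => vertIntegrand bc n f (xh, x₃)) 2 unitMeasure
      ≤ eLpNorm (fun x₃ => f (xh, x₃)) 2 unitMeasure :=
    eLpNorm_mono fun x₃ => norm_vertIntegrand_le bc n f (xh, x₃)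
  have h4 := (h1.trans h2).trans h3
  rw [eLpNorm_eq_lintegral_rpow_enorm_toReal two_ne_zero ENNReal.ofNat_ne_top] at h4
  have h5 := ENNReal.rpow_le_rpow h4 (z := (2 : ENNReal).toReal) (by norm_num)
  rw [← ENNReal.rpow_mul] at h5
  simpa using h5

/-- The Fourier transform at the `n`-th vertical mode as a bounded operator. -/
def layerFourierL (bc : VerticalBC) (n : ℤ) :
    L2Layer →L[ℂ] Lp Vec4 2 (volume : Measure Plane) :=
  (Lp.fourierTransformₗᵢ Plane Vec4).toLinearIsometry.toContinuousLinearMap.comp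
    (LinearMap.mkContinuous (σ := RingHom.id ℂ)
      { toFun := vertCoeff bc n
        map_add' := vertCoeff_add bc n
        map_smul' := vertCoeff_smul bc n } 1 fun f => by
          rw [one_mul]; exact norm_vertCoeff_le bc n f)

theorem layerFourierL_apply (bc : VerticalBC) (n : ℤ) (f : L2Layer) :
    layerFourierL bc n f = layerFourier bc f n := rfl

theorem norm_layerFourier_le (bc : VerticalBC) (n : ℤ) (f : L2Layer) :
    ‖layerFourier bc f n‖ ≤ ‖f‖ := by
  rw [layerFourier, Lp.norm_fourier_eq]; exact norm_vertCoeff_le bc n f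


/-! ### Completeness of the vertical modes -/

theorem ae_eq_zero_of_fourierCoeffOn {a b : ℝ} (hab : a < b) {f : ℝ → ℂ}
    (hf : MemLp f 2 (volume.restrict (Ioc a b))) (h : ∀ n, fourierCoeffOn hab f n = 0) :
    f =ᵐ[volume.restrict (Ioc a b)] 0 := by
  have h1 := hasSum_sq_fourierCoeffOn hab hf
  simp only [h, norm_zero, ne_eq, OfNat.ofNat_ne_zero, not_false_eq_true, zero_pow] at h1
  have h2 := h1.unique hasSum_zero
  have h3 : ∫ x in Ioc a b, ‖f x‖ ^ 2 = 0 := by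
    rw [← intervalIntegral.integral_of_le hab.le]
    rcases smul_eq_zero.1 h2 with h | h
    · exact absurd h (inv_ne_zero (sub_pos.2 hab).ne')
    · exact h
  rw [integral_eq_zero_iff_of_nonneg (fun x => by positivity)
    ((memLp_two_iff_integrable_sq_norm hf.1).1 hf)] at h3
  filter_upwards [h3] with x hx
  simpa using hx

theorem unitMeasure_eq : unitMeasure = volume.restrict (Ioc (0 : ℝ) 1) :=
  (restrict_Ioc_eq_restrict_Icc).symm

theorem ae_eq_zero_of_integral_exp {g : ℝ → ℂ} (hg : MemLp g 2 unitMeasure)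
    (h : ∀ n : ℤ, ∫ x, vertProfile .periodic n x 0 * g x ∂unitMeasure = 0) :
    g =ᵐ[unitMeasure] 0 := by
  rw [unitMeasure_eq] at *
  refine ae_eq_zero_of_fourierCoeffOn zero_lt_one hg fun n => ?_
  rw [fourierCoeffOn_eq_integral, intervalIntegral.integral_of_le zero_le_one]
  refine (congrArg _ (Eq.trans ?_ (h n))).trans (smul_zero _)
  congr 1
  ext x
  rw [smul_eq_mul, fourier_coe_apply]
  simp only [vertProfile, vertFreq]
  congr 2
  push_cast
  ring

/-- The function is extended to `[-1, 1]` by `g(x) + s g(-x)`: evenly for `s = 1`, oddly for `s =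
-1`. The hypothesis says that all Fourier coefficients of the extension on this interval of length
`2` vanish, so Parseval applies. The cosine and sine systems are covered at once. -/
theorem ae_eq_zero_of_integral_exp_add {g : ℝ → ℂ} (hg : MemLp g 2 unitMeasure) (s : ℂ)
    (h : ∀ n : ℤ, ∫ x, (Complex.exp (-((Real.pi * n * x : ℝ) : ℂ) * Complex.I) +
      s * Complex.exp (((Real.pi * n * x : ℝ) : ℂ) * Complex.I)) * g x ∂unitMeasure = 0) :
    g =ᵐ[unitMeasure] 0 := by
  set g1 : ℝ → ℂ := (Icc (0 : ℝ) 1).indicator g with hg1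
  have hg1m : MemLp g1 2 volume := (memLp_indicator_iff_restrict measurableSet_Icc).2 hg
  have hg1n : MemLp (fun x => g1 (-x)) 2 volume :=
    hg1m.comp_measurePreserving (Measure.measurePreserving_neg volume)
  set G : ℝ → ℂ := fun x => g1 x + s * g1 (-x) with hG
  have hGm : MemLp G 2 volume := hg1m.add (hg1n.const_mul s)
  have h0 : ∀ x, x ∉ Icc (-1 : ℝ) 1 → G x = 0 := fun x hx => by
    have a : x ∉ Icc (0 : ℝ) 1 := fun h => hx ⟨by linarith [h.1], h.2⟩
    have b : -x ∉ Icc (0 : ℝ) 1 := fun h => hx ⟨by linarith [h.2], by linarith [h.1]⟩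
    simp only [hG, hg1, indicator_of_notMem a, indicator_of_notMem b]
    simp
  have hab : (-1 : ℝ) < 1 := by norm_num
  have key : G =ᵐ[volume.restrict (Ioc (-1 : ℝ) 1)] 0 := by
    refine ae_eq_zero_of_fourierCoeffOn hab (hGm.restrict _) fun n => ?_
    set e : ℝ → ℂ := fun x => Complex.exp (-((Real.pi * n * x : ℝ) : ℂ) * Complex.I) with he
    have hen : ∀ x, ‖e x‖ ≤ 1 := fun x => by
      simp only [he]
      rw [← Complex.ofReal_neg, Complex.norm_exp_ofReal_mul_I]
    have hec : Continuous e := by fun_prop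
    have hint1 : Integrable (fun x => e x * g1 x) := by
      have hi : Integrable g1 := (integrable_indicator_iff measurableSet_Icc).2
        (hg.integrable (by norm_num))
      exact hi.bdd_mul hec.aestronglyMeasurable (Filter.Eventually.of_forall hen)
    have hint2 : Integrable (fun x => e (-x) * g1 x) := by
      have hi : Integrable g1 := (integrable_indicator_iff measurableSet_Icc).2
        (hg.integrable (by norm_num))
      exact hi.bdd_mul (hec.comp continuous_neg).aestronglyMeasurable
        (Filter.Eventually.of_forall fun x => hen _)
    have hint3 : Integrable (fun x => e x * g1 (-x)) := by
      have := hint2.comp_neg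
      simpa using this
    have hI : ∫ x in (-1 : ℝ)..1, e x * G x = 0 := by
      rw [intervalIntegral.integral_of_le hab.le, ← integral_Icc_eq_integral_Ioc,
        setIntegral_eq_integral_of_forall_compl_eq_zero fun x hx => by rw [h0 x hx, mul_zero]]
      have e1 : ∀ x, e x * G x = e x * g1 x + s * (e x * g1 (-x)) := fun x => by
        simp only [hG]; ring
      simp only [e1]
      rw [integral_add hint1 (hint3.const_mul s), integral_const_mul]
      have e2 : ∫ x, e x * g1 (-x) = ∫ x, e (-x) * g1 x := by
        rw [← integral_neg_eq_self]; simp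
      rw [e2, ← integral_const_mul, ← integral_add hint1 (hint2.const_mul s), ← h n,
        ← integral_indicator measurableSet_Icc]
      congr 1
      ext x
      by_cases hx : x ∈ Icc (0 : ℝ) 1
      · simp only [hg1, indicator_of_mem hx, he]
        push_cast
        ring_nf
      · simp only [hg1, indicator_of_notMem hx]; simp
    rw [fourierCoeffOn_eq_integral]
    refine (congrArg _ (Eq.trans ?_ hI)).trans (smul_zero _)
    congr 1
    ext x
    rw [smul_eq_mul, fourier_coe_apply]
    simp only [he]
    congr 2
    push_cast
    ring
  have hsub : Ioc (0 : ℝ) 1 ⊆ Ioc (-1 : ℝ) 1 := Ioc_subset_Ioc_left (by norm_num)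
  have key2 := ae_restrict_of_ae_restrict_of_subset hsub key
  rw [unitMeasure_eq]
  filter_upwards [key2, ae_restrict_mem measurableSet_Ioc] with x hx hx1
  have b : -x ∉ Icc (0 : ℝ) 1 := fun h => by linarith [h.1, hx1.1]
  simpa [hG, hg1, indicator_of_notMem b, indicator_of_mem (Ioc_subset_Icc_self hx1)] using hx

theorem ae_eq_zero_of_integral_vertProfile (bc : VerticalBC) (j : Fin 4) {g : ℝ → ℂ}
    (hg : MemLp g 2 unitMeasure)
    (h : ∀ n : ℤ, ∫ x, vertProfile bc n x j * g x ∂unitMeasure = 0) : g =ᵐ[unitMeasure] 0 := by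
  cases bc
  · exact ae_eq_zero_of_integral_exp hg h
  · by_cases hj : j.val < 2
    · refine ae_eq_zero_of_integral_exp_add hg 1 fun n => ?_
      rw [← mul_zero (2 : ℂ), ← h n, ← integral_const_mul]
      congr 1
      ext x
      simp only [vertProfile, if_pos hj, vertFreq, Complex.ofReal_cos, Complex.cos]
      ring
    · refine ae_eq_zero_of_integral_exp_add hg (-1) fun n => ?_
      rw [← mul_zero (-2 * Complex.I), ← h n, ← integral_const_mul]
      congr 1
      ext x
      simp only [vertProfile, if_neg hj, vertFreq, Complex.ofReal_sin, Complex.sin]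
      linear_combination ((Complex.exp (-((Real.pi * n * x : ℝ) : ℂ) * Complex.I) -
        Complex.exp (((Real.pi * n * x : ℝ) : ℂ) * Complex.I)) * g x) * Complex.I_mul_I

theorem vertCoeffFun_apply (bc : VerticalBC) (n : ℤ) {f : Plane × ℝ → Vec4} {xh : Plane}
    (hf : Integrable (fun x₃ => vertIntegrand bc n f (xh, x₃)) unitMeasure) (j : Fin 4) :
    vertCoeffFun bc n f xh j = ∫ x₃, vertProfile bc n x₃ j * f (xh, x₃) j ∂unitMeasure := by
  have := (EuclideanSpace.proj (𝕜 := ℂ) j : Vec4 →L[ℂ] ℂ).integral_comp_comm hf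
  exact this.symm

/-- There are countably many modes, so almost every vertical slice has all its coefficients equal to
zero and vanishes by completeness. This reduces identities in `L²(𝔻)⁴`, and uniqueness of solutions,
to single modes. -/
theorem eq_zero_of_layerFourier_eq_zero (bc : VerticalBC) {f : L2Layer}
    (h : ∀ n, layerFourier bc f n = 0) : f = 0 := by
  have h1 : ∀ n, vertCoeff bc n f = 0 := fun n => by
    have : ‖vertCoeff bc n f‖ = 0 := by
      rw [← Lp.norm_fourier_eq]; exact norm_eq_zero.2 (h n)
    exact norm_eq_zero.1 this
  have h2 : ∀ᵐ xh : Plane, ∀ n, vertCoeffFun bc n f xh = 0 := by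
    rw [ae_all_iff]
    intro n
    filter_upwards [coeFn_vertCoeff bc n f, Lp.coeFn_zero Vec4 2 (volume : Measure Plane)]
      with xh h3 h4
    rw [← h3, h1 n, h4]; rfl
  have h5 : ∀ᵐ xh : Plane, ∀ n,
      Integrable (fun x₃ => vertIntegrand bc n f (xh, x₃)) unitMeasure :=
    ae_all_iff.2 fun n => integrable_slice_vertIntegrand bc n (Lp.memLp f)
  have h6 : ∀ᵐ xh : Plane, ∀ᵐ x₃ ∂unitMeasure, f (xh, x₃) = 0 := by
    filter_upwards [h2, h5, memLp_slice (Lp.memLp f)] with xh a b c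
    have h7 : ∀ j : Fin 4, (fun x₃ => f (xh, x₃) j) =ᵐ[unitMeasure] 0 := fun j => by
      refine ae_eq_zero_of_integral_vertProfile bc j ?_ fun n => ?_
      · exact (EuclideanSpace.proj (𝕜 := ℂ) j : Vec4 →L[ℂ] ℂ).comp_memLp' c
      · rw [← vertCoeffFun_apply bc n (b n), a n]; rfl
    have h8 := ae_all_iff.2 h7
    filter_upwards [h8] with x₃ hx
    ext j
    exact hx j
  have hm : MeasurableSet {x | f x = 0} :=
    (Lp.stronglyMeasurable f).measurable (measurableSet_singleton 0)
  rw [Lp.eq_zero_iff_ae_eq_zero]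
  exact (Measure.ae_prod_iff_ae_ae hm).2 h6

theorem layerFourier_ext (bc : VerticalBC) {f g : L2Layer}
    (h : ∀ n, layerFourier bc f n = layerFourier bc g n) : f = g := by
  rw [← sub_eq_zero]
  refine eq_zero_of_layerFourier_eq_zero bc fun n => ?_
  rw [← layerFourierL_apply, map_sub, layerFourierL_apply, layerFourierL_apply, h, sub_self]

/-! ### Synthesis from vertical modes -/

/-- The index of the vertical profile dual to the `n`-th analysing profile. -/
def dualIndex (bc : VerticalBC) (n : ℤ) : ℤ :=
  match bc with
  | .periodic => -n
  | .stressFree => n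

/-- The field on the layer with horizontal profile `g` and the `n`-th vertical profile. -/
def vertSynthFun (bc : VerticalBC) (n : ℤ) (g : Plane → Vec4) : Plane × ℝ → Vec4 :=
  vertIntegrand bc (dualIndex bc n) fun x => g x.1

theorem memLp_comp_fst {g : Plane → Vec4} (hg : MemLp g 2 volume) :
    MemLp (fun x : Plane × ℝ => g x.1) 2 layerMeasure :=
  hg.comp_measurePreserving measurePreserving_fst

theorem memLp_vertSynthFun (bc : VerticalBC) (n : ℤ) {g : Plane → Vec4}
    (hg : MemLp g 2 volume) : MemLp (vertSynthFun bc n g) 2 layerMeasure :=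
  memLp_vertIntegrand bc _ (memLp_comp_fst hg)

theorem vertSynthFun_congr (bc : VerticalBC) (n : ℤ) {f g : Plane → Vec4}
    (h : f =ᵐ[volume] g) : vertSynthFun bc n f =ᵐ[layerMeasure] vertSynthFun bc n g := by
  have := (measurePreserving_fst (μ := (volume : Measure Plane))
    (ν := unitMeasure)).quasiMeasurePreserving.ae_eq h
  filter_upwards [this] with x hx
  ext j
  simp only [Function.comp] at hx
  simp only [vertSynthFun, vertIntegrand, hx]

/-- Synthesis of the `n`-th vertical mode as a bounded operator. -/
def vertSynth (bc : VerticalBC) (n : ℤ) : Lp Vec4 2 (volume : Measure Plane) →L[ℂ] L2Layer :=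
  LinearMap.mkContinuous (σ := RingHom.id ℂ)
    { toFun := fun g => (memLp_vertSynthFun bc n (Lp.memLp g)).toLp _
      map_add' := fun f g => by
        rw [← MemLp.toLp_add]
        refine MemLp.toLp_congr _ _ ((vertSynthFun_congr bc n (Lp.coeFn_add f g)).trans ?_)
        exact Filter.Eventually.of_forall fun x => vertIntegrand_add bc _ _ _ x
      map_smul' := fun c f => by
        rw [RingHom.id_apply, ← MemLp.toLp_const_smul]
        refine MemLp.toLp_congr _ _ ((vertSynthFun_congr bc n (Lp.coeFn_smul c f)).trans ?_)
        exact Filter.Eventually.of_forall fun x => vertIntegrand_smul bc _ c _ x } 1 fun g => by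
    rw [one_mul]
    change ‖(memLp_vertSynthFun bc n (Lp.memLp g)).toLp _‖ ≤ _
    rw [Lp.norm_toLp, Lp.norm_def]
    refine ENNReal.toReal_mono (Lp.memLp g).2.ne ?_
    refine (eLpNorm_mono fun x => norm_vertIntegrand_le bc _ _ x).trans (le_of_eq ?_)
    exact eLpNorm_comp_measurePreserving (Lp.memLp g).1 measurePreserving_fst

theorem coeFn_vertSynth (bc : VerticalBC) (n : ℤ) (g : Lp Vec4 2 (volume : Measure Plane)) :
    vertSynth bc n g =ᵐ[layerMeasure] vertSynthFun bc n g :=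
  (memLp_vertSynthFun bc n (Lp.memLp g)).coeFn_toLp

theorem integral_exp_two_pi (l : ℤ) :
    ∫ x, Complex.exp ((2 * Real.pi * l * x : ℝ) * Complex.I) ∂unitMeasure =
      if l = 0 then 1 else 0 := by
  rw [unitMeasure_eq, ← intervalIntegral.integral_of_le zero_le_one]
  split_ifs with h
  · simp [h]
  · have hl : ((2 * Real.pi * l : ℝ) : ℂ) * Complex.I ≠ 0 := by
      refine mul_ne_zero ?_ Complex.I_ne_zero
      have : (l : ℝ) ≠ 0 := by exact_mod_cast h
      have := Real.pi_ne_zero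
      exact_mod_cast (by positivity : 2 * Real.pi * (l : ℝ) ≠ 0)
    have e : ∀ x : ℝ, ((2 * Real.pi * l * x : ℝ) : ℂ) * Complex.I =
        ((2 * Real.pi * l : ℝ) : ℂ) * Complex.I * x := fun x => by push_cast; ring
    simp only [e]
    rw [integral_exp_mul_complex hl]
    have : Complex.exp (((2 * Real.pi * l : ℝ) : ℂ) * Complex.I * (1 : ℝ)) = 1 := by
      rw [← Complex.exp_int_mul_two_pi_mul_I l]; congr 1; push_cast; ring
    rw [this]; simp

theorem integral_cos_pi (l : ℤ) :
    ∫ x, Real.cos (Real.pi * l * x) ∂unitMeasure = if l = 0 then 1 else 0 := by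
  rw [unitMeasure_eq, ← intervalIntegral.integral_of_le zero_le_one]
  split_ifs with h
  · simp [h]
  · have hl : Real.pi * (l : ℝ) ≠ 0 := mul_ne_zero Real.pi_ne_zero (by exact_mod_cast h)
    rw [intervalIntegral.integral_comp_mul_left (fun x => Real.cos x) hl, integral_cos]
    have : Real.sin (Real.pi * l * 1) = 0 := by
      rw [mul_one, mul_comm]; exact Real.sin_int_mul_pi l
    rw [this]; simp

/-- Gram coefficients of the vertical profiles. -/
def vertGram (bc : VerticalBC) (m n : ℤ) (j : Fin 4) : ℂ :=
  ∫ x, vertProfile bc m x j * vertProfile bc (dualIndex bc n) x j ∂unitMeasure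

theorem vertGram_periodic (m n : ℤ) (j : Fin 4) :
    vertGram .periodic m n j = if m = n then 1 else 0 := by
  have h := integral_exp_two_pi (n - m)
  have e : (n - m = 0) ↔ m = n := by omega
  simp only [e] at h
  rw [vertGram, ← h]
  congr 1
  ext x
  simp only [vertProfile, vertFreq, dualIndex]
  rw [← Complex.exp_add]
  congr 1
  push_cast
  ring

/-- The product-to-sum formulas pair each profile with itself and with its mirror image, each with
weight `1/2`. The formula includes the mode `0`, where the two contributions add for cosines and
cancel for sines. -/
theorem vertGram_stressFree (m n : ℤ) (j : Fin 4) :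
    vertGram .stressFree m n j = ((if m = n then 1 else 0) +
      (if j.val < 2 then 1 else -1) * (if m = -n then 1 else 0)) / 2 := by
  have h1 := integral_cos_pi (m - n)
  have h2 := integral_cos_pi (m + n)
  have e1 : (m - n = 0) ↔ m = n := by omega
  have e2 : (m + n = 0) ↔ m = -n := by omega
  simp only [e1] at h1
  simp only [e2] at h2
  have i : ∀ l : ℤ, Integrable (fun x => Real.cos (Real.pi * l * x)) unitMeasure := fun l =>
    (Continuous.integrableOn_Icc (by fun_prop))
  by_cases hj : j.val < 2
  · have : vertGram .stressFree m n j = ((∫ x, (Real.cos (Real.pi * (m - n : ℤ) * x) +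
        Real.cos (Real.pi * (m + n : ℤ) * x)) / 2 ∂unitMeasure : ℝ) : ℂ) := by
      rw [vertGram, ← integral_complex_ofReal]
      congr 1
      ext x
      simp only [vertProfile, vertFreq, dualIndex, if_pos hj]
      push_cast
      have a : Complex.cos (Real.pi * (m - n) * x) =
        Complex.cos (Real.pi * m * x - Real.pi * n * x) := by ring_nf
      have b : Complex.cos (Real.pi * (m + n) * x) =
        Complex.cos (Real.pi * m * x + Real.pi * n * x) := by ring_nf
      rw [a, b, Complex.cos_sub, Complex.cos_add]
      ring
    rw [this, integral_div, integral_add (i _) (i _), h1, h2, if_pos hj]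
    split_ifs <;> push_cast <;> ring
  · have : vertGram .stressFree m n j = ((∫ x, (Real.cos (Real.pi * (m - n : ℤ) * x) -
        Real.cos (Real.pi * (m + n : ℤ) * x)) / 2 ∂unitMeasure : ℝ) : ℂ) := by
      rw [vertGram, ← integral_complex_ofReal]
      congr 1
      ext x
      simp only [vertProfile, vertFreq, dualIndex, if_neg hj]
      push_cast
      have a : Complex.cos (Real.pi * (m - n) * x) =
        Complex.cos (Real.pi * m * x - Real.pi * n * x) := by ring_nf
      have b : Complex.cos (Real.pi * (m + n) * x) =
        Complex.cos (Real.pi * m * x + Real.pi * n * x) := by ring_nf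
      rw [a, b, Complex.cos_sub, Complex.cos_add]
      ring
    rw [this, integral_div, integral_sub (i _) (i _), h1, h2, if_neg hj]
    split_ifs <;> push_cast <;> ring

theorem vertCoeff_vertSynth_apply (bc : VerticalBC) (m n : ℤ)
    (g : Lp Vec4 2 (volume : Measure Plane)) :
    ∀ᵐ xh : Plane, ∀ j, vertCoeff bc m (vertSynth bc n g) xh j = vertGram bc m n j * g xh j := by
  have hI := integrable_slice_vertIntegrand bc m (memLp_vertSynthFun bc n (Lp.memLp g))
  filter_upwards [coeFn_vertCoeff bc m (vertSynth bc n g),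
    vertCoeffFun_congr bc m (coeFn_vertSynth bc n g), hI] with xh h1 h2 h3 j
  rw [h1, h2, vertCoeffFun_apply bc m h3, vertGram, ← integral_mul_const]
  congr 1
  ext x
  simp only [vertSynthFun, vertIntegrand]
  ring

/-- A family of horizontal profiles is compatible with the boundary conditions if, in the
stress-free case, the modes `n` and `-n` are related by reflection. -/
def IsCompatible (bc : VerticalBC) (g : ℤ → Lp Vec4 2 (volume : Measure Plane)) : Prop :=
  bc = .stressFree → ∀ n, g (-n) = reflectL.compLp (g n)

/-- Synthesis from finitely many vertical modes. -/
def layerSynth (bc : VerticalBC) (N : ℕ) (g : ℤ → Lp Vec4 2 (volume : Measure Plane)) : L2Layer :=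
  ∑ n ∈ Finset.Icc (-N : ℤ) N, vertSynth bc n (g n)

/-- The synthesis sums over all integers, so in the stress-free case every nonzero mode is counted
twice. Compatibility makes the two copies agree, which compensates the weight `1/2` in the Gram
coefficients. -/
theorem vertCoeff_layerSynth (bc : VerticalBC) (N : ℕ)
    {g : ℤ → Lp Vec4 2 (volume : Measure Plane)} (hg : IsCompatible bc g)
    (hN : ∀ n : ℤ, n ∉ Finset.Icc (-N : ℤ) N → g n = 0) (m : ℤ) :
    vertCoeff bc m (layerSynth bc N g) = g m := by
  have hsum : vertCoeff bc m (layerSynth bc N g) =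
      ∑ n ∈ Finset.Icc (-N : ℤ) N, vertCoeff bc m (vertSynth bc n (g n)) := by
    let V : L2Layer →+ Lp Vec4 2 (volume : Measure Plane) :=
      AddMonoidHom.mk' (vertCoeff bc m) (vertCoeff_add bc m)
    exact map_sum V _ _
  rw [hsum]
  refine Lp.ext ?_
  have h1 : ∀ᵐ xh : Plane, ∀ n, ∀ j, vertCoeff bc m (vertSynth bc n (g n)) xh j =
      vertGram bc m n j * g n xh j :=
    ae_all_iff.2 fun n => vertCoeff_vertSynth_apply bc m n (g n)
  have h0 : ∀ᵐ xh : Plane, ∀ n : ℤ, n ∉ Finset.Icc (-N : ℤ) N → g n xh = 0 := by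
    refine ae_all_iff.2 fun n => ?_
    by_cases hn : n ∈ Finset.Icc (-N : ℤ) N
    · exact Filter.Eventually.of_forall fun x h => absurd hn h
    · filter_upwards [Lp.coeFn_zero Vec4 2 (volume : Measure Plane)] with x hx _
      rw [hN n hn, hx]; rfl
  have hs : ∀ᵐ xh : Plane, bc = .stressFree → g (-m) xh = reflectL (g m xh) := by
    by_cases hbc : bc = .stressFree
    · filter_upwards [reflectL.coeFn_compLp (g m)] with xh h _
      rw [hg hbc m, h]
    · exact Filter.Eventually.of_forall fun x h => absurd h hbc
  filter_upwards [h1, h0, hs, Lp.coeFn_finsetSum (Finset.Icc (-N : ℤ) N)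
    fun n => vertCoeff bc m (vertSynth bc n (g n))] with xh a b c d
  rw [d]
  ext j
  rw [Finset.sum_apply, WithLp.ofLp_sum, Finset.sum_apply]
  simp only [a]
  have key : ∀ l : ℤ, ∑ n ∈ Finset.Icc (-N : ℤ) N, (if l = n then (1 : ℂ) else 0) * g n xh j =
      g l xh j := fun l => by
    simp only [ite_mul, one_mul, zero_mul]
    rw [Finset.sum_ite_eq]
    split_ifs with hl
    · rfl
    · rw [b l hl]; rfl
  cases bc
  · simp only [vertGram_periodic]
    exact key m
  · simp only [vertGram_stressFree]
    have e : ∀ n : ℤ, (m = -n) ↔ (-m = n) := fun n => by omega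
    simp only [e]
    have : ∀ n : ℤ, ((if m = n then (1 : ℂ) else 0) +
        (if j.val < 2 then (1 : ℂ) else -1) * (if -m = n then 1 else 0)) / 2 * g n xh j =
        (1 / 2) * ((if m = n then (1 : ℂ) else 0) * g n xh j) +
        (if j.val < 2 then (1 : ℂ) else -1) / 2 *
          ((if -m = n then (1 : ℂ) else 0) * g n xh j) := fun n => by ring
    simp only [this]
    -- The sign in the Gram coefficient and the sign in `reflectVec` coincide, so the two halves add
    -- up to `g m`.
    rw [Finset.sum_add_distrib, ← Finset.mul_sum, ← Finset.mul_sum, key, key, c rfl, reflectL_apply]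
    fin_cases j <;> simp [reflectVec] <;> ring


/-! ### Multipliers on `L²` -/

section Multiplier

variable {α : Type*} [MeasurableSpace α] {μ : Measure α} {G : Type*} [NormedAddCommGroup G]
  {E : Type*} [NormedAddCommGroup E] [NormedSpace ℂ E]

open Classical in
/-- The class of `F` in `L²`, or `0` if `F` is not square integrable. -/
def toL2 (μ : Measure α) (F : α → G) : Lp G 2 μ := if h : MemLp F 2 μ then h.toLp F else 0

theorem coeFn_toL2 {F : α → G} (h : MemLp F 2 μ) : toL2 μ F =ᵐ[μ] F := by
  rw [toL2, dif_pos h]; exact h.coeFn_toLp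

theorem memLp_smul_of_bound {a : α → ℂ} (ha : Measurable a) {C : ℝ} (hC : ∀ x, ‖a x‖ ≤ C)
    (f : Lp E 2 μ) : MemLp (fun x => a x • f x) 2 μ := by
  refine (Lp.memLp f).of_le_mul (c := C) (ha.aestronglyMeasurable.smul (Lp.memLp f).1)
    (Filter.Eventually.of_forall fun x => ?_)
  rw [norm_smul]
  exact mul_le_mul_of_nonneg_right (hC x) (norm_nonneg _)

/-- The action of `exp (t λ)` on `L²`. -/
def expLp (lam : α → ℂ) (t : ℝ) (f : Lp E 2 μ) : Lp E 2 μ :=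
  toL2 μ fun x => Complex.exp (t * lam x) • f x

theorem norm_exp_mul_le {β : Type*} {lam : β → ℂ} {L : ℝ} (hL : ∀ x, ‖lam x‖ ≤ L) (t : ℝ)
    (x : β) : ‖Complex.exp (t * lam x)‖ ≤ Real.exp (|t| * L) := by
  rw [Complex.norm_exp]
  refine Real.exp_le_exp.2 ((Complex.re_le_norm _).trans ?_)
  rw [norm_mul, Complex.norm_real, Real.norm_eq_abs]
  exact mul_le_mul_of_nonneg_left (hL x) (abs_nonneg _)

theorem coeFn_expLp {lam : α → ℂ} (hlam : Measurable lam) {L : ℝ} (hL : ∀ x, ‖lam x‖ ≤ L)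
    (t : ℝ) (f : Lp E 2 μ) :
    expLp lam t f =ᵐ[μ] fun x => Complex.exp (t * lam x) • f x :=
  coeFn_toL2 (memLp_smul_of_bound (by fun_prop) (norm_exp_mul_le hL t) f)

/-- For bounded `lam` the remainder is quadratic in `h` in operator norm, by `|exp z - 1 - z| ≤
|z|²` for `|z| ≤ 1`. -/
theorem hasDerivAt_expLp {lam : α → ℂ} (hlam : Measurable lam) {L : ℝ} (hL : ∀ x, ‖lam x‖ ≤ L)
    (f : Lp E 2 μ) (t : ℝ) :
    HasDerivAt (fun t => expLp lam t f) (toL2 μ fun x => lam x • expLp lam t f x) t := by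
  rw [hasDerivAt_iff_isLittleO_nhds_zero]
  have hO : (fun h : ℝ => expLp lam (t + h) f - expLp lam t f -
      h • toL2 μ fun x => lam x • expLp lam t f x) =O[nhds 0] fun h : ℝ => h ^ 2 := by
    refine Asymptotics.IsBigO.of_bound (L ^ 2 * ‖expLp lam t f‖) ?_
    have hev : ∀ᶠ h : ℝ in nhds 0, |h| * L < 1 := by
      have : Filter.Tendsto (fun h : ℝ => |h| * L) (nhds 0) (nhds (|0| * L)) :=
        (Continuous.tendsto (by fun_prop) 0)
      rw [abs_zero, zero_mul] at this
      exact this.eventually (gt_mem_nhds one_pos)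
    filter_upwards [hev] with h hh
    have e : L ^ 2 * ‖expLp lam t f‖ * ‖h ^ 2‖ = (|h| * L) ^ 2 * ‖expLp lam t f‖ := by
      rw [Real.norm_eq_abs, abs_pow]; ring
    rw [e]
    refine Lp.norm_le_mul_norm_of_ae_le_mul ?_
    filter_upwards [Lp.coeFn_sub (expLp lam (t + h) f - expLp lam t f)
      (h • toL2 μ fun x => lam x • expLp lam t f x),
      Lp.coeFn_sub (expLp lam (t + h) f) (expLp lam t f),
      Lp.coeFn_smul h (toL2 μ fun x => lam x • expLp lam t f x),
      coeFn_expLp hlam hL (t + h) f, coeFn_expLp hlam hL t f,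
      coeFn_toL2 (memLp_smul_of_bound hlam hL (expLp lam t f))] with x h1 h2 h3 h4 h5 h6
    rw [h1, Pi.sub_apply, h2, Pi.sub_apply, h3, Pi.smul_apply, h4, h6]
    have e1 : Complex.exp ((t + h : ℝ) * lam x) • f x =
        Complex.exp (h * lam x) • expLp lam t f x := by
      rw [h5, smul_smul, ← Complex.exp_add]; congr 2; push_cast; ring
    rw [e1]
    have e2 : Complex.exp (h * lam x) • expLp lam t f x - expLp lam t f x -
        h • lam x • expLp lam t f x =
        (Complex.exp (h * lam x) - 1 - h * lam x) • expLp lam t f x := by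
      rw [sub_smul, sub_smul, one_smul, mul_smul, Complex.coe_smul]
    rw [e2, norm_smul]
    refine mul_le_mul_of_nonneg_right ?_ (norm_nonneg _)
    have hb : ‖(h : ℂ) * lam x‖ ≤ |h| * L := by
      rw [norm_mul, Complex.norm_real, Real.norm_eq_abs]
      exact mul_le_mul_of_nonneg_left (hL x) (abs_nonneg _)
    exact (Complex.norm_exp_sub_one_sub_id_le (hb.trans hh.le)).trans
      (pow_le_pow_left₀ (norm_nonneg _) hb 2)
  refine hO.trans_isLittleO ?_
  simpa using Asymptotics.isLittleO_pow_pow (𝕜 := ℝ) (m := 1) (n := 2) (by norm_num)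

end Multiplier

/-! ### Fourier characterizations -/

theorem layerFourier_eq_zero_iff (bc : VerticalBC) (n : ℤ) (f : L2Layer) :
    layerFourier bc f n = 0 ↔ vertCoeff bc n f = 0 := by
  rw [← norm_eq_zero, layerFourier, Lp.norm_fourier_eq, norm_eq_zero]

/-- At `n = 0` the profile is `1` on the components that the barotropic projection averages and `0`
on the others, so the mode `0` is exactly the barotropic part. -/
theorem isBaroclinic_iff (bc : VerticalBC) (f : L2Layer) :
    IsBaroclinic bc f ↔ layerFourier bc f 0 = 0 := by
  have hp : ∀ j : Fin 4, ∀ x, (bc = .periodic ∨ j.val < 2) → vertProfile bc 0 x j = 1 := by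
    rintro j x (rfl | hj)
    · simp [vertProfile, vertFreq]
    · cases bc <;> simp [vertProfile, vertFreq, hj]
  have hq : ∀ j : Fin 4, ∀ x, ¬(bc = .periodic ∨ j.val < 2) → vertProfile bc 0 x j = 0 := by
    intro j x hj
    rw [not_or] at hj
    cases bc
    · exact absurd rfl hj.1
    · simp [vertProfile, vertFreq, hj.2]
  have hI := integrable_slice_vertIntegrand bc 0 (Lp.memLp f)
  rw [layerFourier_eq_zero_iff, Lp.eq_zero_iff_ae_eq_zero]
  constructor
  · intro h
    have h2 : ∀ᵐ xh : Plane, ∀ j : Fin 4, (bc = .periodic ∨ j.val < 2) →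
        ∫ x₃, f (xh, x₃) j ∂unitMeasure = 0 := by
      rw [ae_all_iff]
      intro j
      by_cases hj : bc = .periodic ∨ j.val < 2
      · filter_upwards [h j hj] with x hx _; exact hx
      · exact Filter.Eventually.of_forall fun x h => absurd h hj
    filter_upwards [h2, hI, coeFn_vertCoeff bc 0 f] with xh a b c
    rw [c]
    ext j
    rw [vertCoeffFun_apply bc 0 b]
    by_cases hj : bc = .periodic ∨ j.val < 2
    · simp only [hp j _ hj, one_mul, a j hj]; rfl
    · simp [hq j _ hj]
  · intro h j hj
    filter_upwards [h, hI, coeFn_vertCoeff bc 0 f] with xh a b c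
    have := vertCoeffFun_apply bc 0 b j
    rw [← c, a] at this
    simp only [hp j _ hj, one_mul] at this
    rw [← this]; rfl

theorem layerFourier_layerSynth (bc : VerticalBC) (N : ℕ)
    {h : ℤ → Lp Vec4 2 (volume : Measure Plane)} (hh : IsCompatible bc h)
    (hN : ∀ n : ℤ, n ∉ Finset.Icc (-N : ℤ) N → h n = 0) (m : ℤ) :
    layerFourier bc (layerSynth bc N fun n => 𝓕⁻ (h n)) m = h m := by
  rw [layerFourier, vertCoeff_layerSynth bc N]
  · exact FourierTransform.fourier_fourierInv_eq _
  · intro hbc n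
    change 𝓕⁻ (h (-n)) = reflectL.compLp (𝓕⁻ (h n))
    rw [hh hbc n, fourierInv_compLp]
  · intro n hn
    rw [hN n hn]
    exact (Lp.fourierTransformₗᵢ Plane Vec4).symm.map_zero

/-! ### Elementary facts on wave vectors and frequencies -/

theorem waveVector_neg (bc : VerticalBC) (n : ℤ) (ξ : Plane) :
    waveVector bc (-n) ξ = reflectFreq (waveVector bc n ξ) := by
  ext i; fin_cases i <;> simp [waveVector, reflectFreq, vertFreq_neg]

theorem waveVector_two (bc : VerticalBC) (n : ℤ) (ξ : Plane) :
    waveVector bc n ξ 2 = vertFreq bc n := rfl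

theorem waveVector_two_ne_zero (bc : VerticalBC) {n : ℤ} (hn : n ≠ 0) (ξ : Plane) :
    waveVector bc n ξ 2 ≠ 0 := by
  rw [waveVector_two, ← abs_pos]
  exact Real.pi_pos.trans_le (pi_le_abs_vertFreq bc hn)

theorem normSq_waveVector (bc : VerticalBC) (n : ℤ) (ξ : Plane) :
    normSq (waveVector bc n ξ) = (2 * Real.pi) ^ 2 * ‖ξ‖ ^ 2 + vertFreq bc n ^ 2 := by
  rw [norm_sq_plane]; simp [normSq, waveVector]; ring

theorem abs_le_abs_vertFreq (bc : VerticalBC) (n : ℤ) : |(n : ℝ)| ≤ |vertFreq bc n| := by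
  have hpi := Real.pi_gt_three
  cases bc
  · simp only [vertFreq, abs_mul, abs_of_pos Real.pi_pos, abs_two]
    nlinarith [abs_nonneg (n : ℝ)]
  · simp only [vertFreq, abs_mul, abs_of_pos Real.pi_pos]
    nlinarith [abs_nonneg (n : ℝ)]

/-- A crude bound that serves only to make the rates bounded; it does not enter the final constant.
-/
theorem dispersion_le (η : ℝ) (k : Fin 3 → ℝ) : dispersion η k ≤ 1 + |η| := by
  have h0 : 0 ≤ normSq k := by rw [normSq]; positivity
  refine Real.sqrt_le_iff.2 ⟨by positivity, ?_⟩
  rw [dispersionSq]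
  refine div_le_of_le_mul₀ h0 (by positivity) ?_
  have e : (1 + |η|) ^ 2 = 1 + 2 * |η| + η ^ 2 := by rw [add_sq, sq_abs]; ring
  rw [e]
  simp only [normSq]
  simp
  nlinarith [sq_nonneg (k 0), sq_nonneg (k 1), sq_nonneg (k 2), sq_nonneg (η * k 0),
    sq_nonneg (η * k 1), abs_nonneg η, mul_nonneg (abs_nonneg η) (sq_nonneg (k 0)),
    mul_nonneg (abs_nonneg η) (sq_nonneg (k 1)), mul_nonneg (abs_nonneg η) (sq_nonneg (k 2))]


/-! ### The explicit solution -/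

/-- The growth rates of the three modes, restricted to the ball of radius `R`. -/
def modeRate (bc : VerticalBC) (R Γ η : ℝ) (n : ℤ) (e : Fin 3) : Plane → ℂ :=
  {ξ | normSq (waveVector bc n ξ) ≤ R ^ 2}.indicator fun ξ =>
    -(normSq (waveVector bc n ξ) : ℂ) +
      ((modeSign e * Γ * dispersion η (waveVector bc n ξ) : ℝ) : ℂ) * Complex.I

/-- The Fourier transform of the part of `v₀` in one of the three eigenspaces. -/
def modePart (bc : VerticalBC) (η : ℝ) (v₀ : L2Layer) (n : ℤ) (e : Fin 3) :
    Lp Vec4 2 (volume : Measure Plane) :=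
  toL2 volume fun ξ => (WithLp.toLp 2
    ((modeProj bc η (waveVector bc n ξ) e).mulVec (layerFourier bc v₀ n ξ).ofLp) : Vec4)

/-- The Fourier transform of the solution at time `t`. -/
def solMode (bc : VerticalBC) (R Γ η : ℝ) (v₀ : L2Layer) (n : ℤ) (t : ℝ) :
    Lp Vec4 2 (volume : Measure Plane) :=
  ∑ e, expLp (modeRate bc R Γ η n e) t (modePart bc η v₀ n e)

/-- The solution with initial value `v₀`. -/
def explicitSol (bc : VerticalBC) (R Γ η : ℝ) (v₀ : L2Layer) (t : ℝ) : L2Layer :=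
  layerSynth bc ⌈R⌉₊ fun n => 𝓕⁻ (solMode bc R Γ η v₀ n t)

theorem measurableSet_normSq_waveVector_le (bc : VerticalBC) (n : ℤ) (r : ℝ) :
    MeasurableSet {ξ | normSq (waveVector bc n ξ) ≤ r} :=
  measurableSet_le (measurable_normSq.comp (measurable_waveVector bc n)) measurable_const

theorem measurable_modeRate (bc : VerticalBC) (R Γ η : ℝ) (n : ℤ) (e : Fin 3) :
    Measurable (modeRate bc R Γ η n e) := by
  have h1 := measurable_normSq.comp (measurable_waveVector bc n)
  have h2 := (measurable_dispersion η).comp (measurable_waveVector bc n)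
  refine Measurable.indicator ?_ (measurableSet_normSq_waveVector_le bc n _)
  exact (Complex.measurable_ofReal.comp h1).neg.add
    ((Complex.measurable_ofReal.comp (h2.const_mul _)).mul_const _)

theorem abs_modeSign_le (e : Fin 3) : |modeSign e| ≤ 1 := by
  fin_cases e <;> simp [modeSign]

theorem normSq_nonneg (k : Fin 3 → ℝ) : 0 ≤ normSq k := by rw [normSq]; positivity

/-- Boundedness is the purpose of the cut-off in `modeRate`: the exponentials become bounded
multipliers, differentiable in norm. Nothing is lost, because the data vanish outside the ball. -/
theorem norm_modeRate_le (bc : VerticalBC) (R Γ η : ℝ) (n : ℤ) (e : Fin 3) (ξ : Plane) :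
    ‖modeRate bc R Γ η n e ξ‖ ≤ R ^ 2 + |Γ| * (1 + |η|) := by
  rw [modeRate]
  by_cases h : ξ ∈ {ξ | normSq (waveVector bc n ξ) ≤ R ^ 2}
  · rw [indicator_of_mem h]
    refine (norm_add_le _ _).trans (add_le_add ?_ ?_)
    · rw [norm_neg, Complex.norm_real, Real.norm_of_nonneg (normSq_nonneg _)]
      exact h
    · have hdn : 0 ≤ dispersion η (waveVector bc n ξ) := Real.sqrt_nonneg _
      rw [norm_mul, Complex.norm_I, mul_one, Complex.norm_real, Real.norm_eq_abs, abs_mul,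
        abs_mul, abs_of_nonneg hdn]
      calc |modeSign e| * |Γ| * dispersion η (waveVector bc n ξ)
          ≤ 1 * |Γ| * (1 + |η|) := by
            have := abs_modeSign_le e
            have := dispersion_le η (waveVector bc n ξ)
            gcongr
        _ = _ := by ring
  · rw [indicator_of_notMem h, norm_zero]
    positivity

section Admissible

variable {bc : VerticalBC} {R Γ η : ℝ} {v₀ : L2Layer}

/-- The pointwise consequences of the hypotheses on the initial value. -/
theorem ae_layerFourier_of_admissible (hb : IsBaroclinic bc v₀) (hd : IsDivFree bc v₀)
    (hs : HasFourierSupportIn bc R v₀) (hR : 0 < R) (n : ℤ) : ∀ᵐ ξ : Plane,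
      divSymbol bc (waveVector bc n ξ) ⬝ᵥ (layerFourier bc v₀ n ξ).ofLp = 0 ∧
      (n = 0 → layerFourier bc v₀ n ξ = 0) ∧
      (¬normSq (waveVector bc n ξ) ≤ R ^ 2 → layerFourier bc v₀ n ξ = 0) := by
  have h0 : ∀ᵐ ξ : Plane, n = 0 → layerFourier bc v₀ n ξ = 0 := by
    by_cases hn : n = 0
    · subst hn
      rw [(isBaroclinic_iff bc v₀).1 hb]
      filter_upwards [Lp.coeFn_zero Vec4 2 (volume : Measure Plane)] with ξ hξ _
      rw [hξ]; rfl
    · exact Filter.Eventually.of_forall fun ξ h => absurd h hn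
  filter_upwards [hd n, h0, hs n] with ξ a b c
  refine ⟨a, b, fun h => c ?_⟩
  rw [Real.lt_sqrt hR.le]
  exact not_le.1 h

theorem norm_modeProj_le_two_mul (hη : η ≠ 0) {n : ℤ} (hn : n ≠ 0) {ξ : Plane} {w : Fin 4 → ℂ}
    (hw : divSymbol bc (waveVector bc n ξ) ⬝ᵥ w = 0) (e : Fin 3) :
    ‖(WithLp.toLp 2 ((modeProj bc η (waveVector bc n ξ) e).mulVec w) : Vec4)‖ ≤
      2 * ‖(WithLp.toLp 2 w : Vec4)‖ := by
  have hk := waveVector_two_ne_zero bc hn ξ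
  have h1 := norm_geoProj_le bc hη hk w
  by_cases he : e = 0
  · rw [he, modeProj_zero]
    linarith [norm_nonneg (WithLp.toLp 2 w : Vec4)]
  · refine (norm_modeProj_le bc hη hk hw he).trans ?_
    rw [WithLp.toLp_sub]
    linarith [norm_sub_le (WithLp.toLp 2 w : Vec4)
      (WithLp.toLp 2 ((geoProj bc η (waveVector bc n ξ)).mulVec w))]

theorem coeFn_modePart (hη : η ≠ 0) (hb : IsBaroclinic bc v₀) (hd : IsDivFree bc v₀)
    (n : ℤ) (e : Fin 3) : modePart bc η v₀ n e =ᵐ[volume] fun ξ => (WithLp.toLp 2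
    ((modeProj bc η (waveVector bc n ξ) e).mulVec (layerFourier bc v₀ n ξ).ofLp) : Vec4) := by
  refine coeFn_toL2 ((Lp.memLp (layerFourier bc v₀ n)).of_le_mul (c := 2) ?_ ?_)
  · exact measurable_mulVec (fun i j => (measurable_modeProj bc η e i j).comp
      (measurable_waveVector bc n)) (Lp.memLp _).1
  -- At `n = 0` the bound on the projections is unavailable, since it requires `k₃ ≠ 0`, but
  -- baroclinic data vanish there.
  · by_cases hn : n = 0
    · subst hn
      rw [(isBaroclinic_iff bc v₀).1 hb]
      filter_upwards [Lp.coeFn_zero Vec4 2 (volume : Measure Plane)] with ξ hξ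
      rw [hξ]; simp
    · filter_upwards [hd n] with ξ h
      exact norm_modeProj_le_two_mul hη hn h e

theorem coeFn_solMode (hη : η ≠ 0) (hb : IsBaroclinic bc v₀) (hd : IsDivFree bc v₀)
    (n : ℤ) (t : ℝ) : ∀ᵐ ξ : Plane, solMode bc R Γ η v₀ n t ξ =
      ∑ e, Complex.exp (t * modeRate bc R Γ η n e ξ) • (WithLp.toLp 2
        ((modeProj bc η (waveVector bc n ξ) e).mulVec (layerFourier bc v₀ n ξ).ofLp) : Vec4) := by
  have h1 : ∀ᵐ ξ : Plane, ∀ e, expLp (modeRate bc R Γ η n e) t (modePart bc η v₀ n e) ξ =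
      Complex.exp (t * modeRate bc R Γ η n e ξ) • modePart bc η v₀ n e ξ :=
    ae_all_iff.2 fun e => coeFn_expLp (measurable_modeRate bc R Γ η n e)
      (norm_modeRate_le bc R Γ η n e) t _
  have h2 := ae_all_iff.2 fun e => coeFn_modePart hη hb hd n e
  filter_upwards [h1, h2, Lp.coeFn_finsetSum Finset.univ
    fun e => expLp (modeRate bc R Γ η n e) t (modePart bc η v₀ n e)] with ξ a b c
  rw [solMode, c, Finset.sum_apply]
  simp only [a, b]

/-- Since `|n| ≤ |k₃| ≤ |k|`, the ball of radius `R` meets only modes with `|n| ≤ ⌈R⌉₊`, and the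
synthesis is a finite sum. -/
theorem layerFourier_eq_zero_of_notMem (hs : HasFourierSupportIn bc R v₀)
    {n : ℤ} (hn : n ∉ Finset.Icc (-(⌈R⌉₊ : ℤ)) ⌈R⌉₊) :
    ∀ᵐ ξ : Plane, layerFourier bc v₀ n ξ = 0 := by
  have h1 : R < |vertFreq bc n| := by
    refine lt_of_lt_of_le ?_ (abs_le_abs_vertFreq bc n)
    have h2 : (⌈R⌉₊ : ℤ) < |n| := by
      by_contra! h
      exact hn (Finset.mem_Icc.2 (abs_le.1 h))
    calc R ≤ ⌈R⌉₊ := Nat.le_ceil R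
      _ < |(n : ℝ)| := by exact_mod_cast h2
  filter_upwards [hs n] with ξ h
  refine h (h1.trans_le (Real.abs_le_sqrt ?_))
  rw [normSq_waveVector]
  have : 0 ≤ (2 * Real.pi) ^ 2 * ‖ξ‖ ^ 2 := by positivity
  linarith

theorem ae_layerFourier_neg (hbc : bc = .stressFree) (n : ℤ) : ∀ᵐ ξ : Plane,
    layerFourier bc v₀ (-n) ξ = WithLp.toLp 2 (reflectVec (layerFourier bc v₀ n ξ).ofLp) := by
  subst hbc
  rw [layerFourier_neg]
  filter_upwards [reflectL.coeFn_compLp (layerFourier .stressFree v₀ n)] with ξ h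
  rw [h, reflectL_apply]

theorem modeRate_neg (n : ℤ) (e : Fin 3) (ξ : Plane) :
    modeRate bc R Γ η (-n) e ξ = modeRate bc R Γ η n e ξ := by
  simp only [modeRate, indicator, mem_ofPred_eq, waveVector_neg, normSq_reflectFreq,
    dispersion_reflectFreq]

theorem isCompatible_modePart (hη : η ≠ 0) (hb : IsBaroclinic bc v₀) (hd : IsDivFree bc v₀)
    (e : Fin 3) : IsCompatible bc fun n => modePart bc η v₀ n e := by
  intro hbc n
  refine Lp.ext ?_
  filter_upwards [coeFn_modePart hη hb hd (-n) e, coeFn_modePart hη hb hd n e,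
    reflectL.coeFn_compLp (modePart bc η v₀ n e), ae_layerFourier_neg (v₀ := v₀) hbc n]
    with ξ a b c d
  rw [a, c, b, d, waveVector_neg, reflectL_apply, hbc, modeProj_reflect]

theorem isCompatible_solMode (hη : η ≠ 0) (hb : IsBaroclinic bc v₀) (hd : IsDivFree bc v₀)
    (t : ℝ) : IsCompatible bc fun n => solMode bc R Γ η v₀ n t := by
  intro hbc n
  refine Lp.ext ?_
  filter_upwards [coeFn_solMode (R := R) (Γ := Γ) hη hb hd (-n) t,
    coeFn_solMode (R := R) (Γ := Γ) hη hb hd n t,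
    reflectL.coeFn_compLp (solMode bc R Γ η v₀ n t), ae_layerFourier_neg (v₀ := v₀) hbc n]
    with ξ a b c d
  rw [a, c, b, d, map_sum]
  refine Finset.sum_congr rfl fun e _ => ?_
  rw [modeRate_neg, map_smul, reflectL_apply, waveVector_neg, hbc, modeProj_reflect]

theorem modePart_eq_zero (hη : η ≠ 0) (hb : IsBaroclinic bc v₀) (hd : IsDivFree bc v₀)
    {n : ℤ} (h0 : ∀ᵐ ξ : Plane, layerFourier bc v₀ n ξ = 0) (e : Fin 3) :
    modePart bc η v₀ n e = 0 := by
  rw [Lp.eq_zero_iff_ae_eq_zero]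
  filter_upwards [coeFn_modePart hη hb hd n e, h0] with ξ a b
  rw [a, b]; simp

theorem solMode_eq_zero (hη : η ≠ 0) (hb : IsBaroclinic bc v₀) (hd : IsDivFree bc v₀)
    {n : ℤ} (h0 : ∀ᵐ ξ : Plane, layerFourier bc v₀ n ξ = 0) (t : ℝ) :
    solMode bc R Γ η v₀ n t = 0 := by
  rw [Lp.eq_zero_iff_ae_eq_zero]
  filter_upwards [coeFn_solMode (R := R) (Γ := Γ) hη hb hd n t, h0] with ξ a b
  rw [a, b]; simp

theorem layerFourier_explicitSol (hη : η ≠ 0) (hb : IsBaroclinic bc v₀)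
    (hd : IsDivFree bc v₀) (hs : HasFourierSupportIn bc R v₀) (t : ℝ) (n : ℤ) :
    layerFourier bc (explicitSol bc R Γ η v₀ t) n = solMode bc R Γ η v₀ n t :=
  layerFourier_layerSynth bc _ (isCompatible_solMode hη hb hd t) (fun _ hn =>
    solMode_eq_zero hη hb hd (layerFourier_eq_zero_of_notMem hs hn) t) n

theorem exists_isGeostrophicPart (hη : η ≠ 0) (hb : IsBaroclinic bc v₀)
    (hd : IsDivFree bc v₀) (hs : HasFourierSupportIn bc R v₀) :
    ∃ Sv₀, IsGeostrophicPart bc η v₀ Sv₀ := by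
  refine ⟨layerSynth bc ⌈R⌉₊ fun n => 𝓕⁻ (modePart bc η v₀ n 0), fun n => ?_⟩
  rw [layerFourier_layerSynth bc _ (isCompatible_modePart hη hb hd 0) fun _ hn =>
    modePart_eq_zero hη hb hd (layerFourier_eq_zero_of_notMem hs hn) 0]
  filter_upwards [coeFn_modePart hη hb hd n 0] with ξ a
  rw [a, modeProj_zero, geoProj_mulVec]

/-- The time derivative of the solution on the Fourier side. -/
def solMode' (bc : VerticalBC) (R Γ η : ℝ) (v₀ : L2Layer) (n : ℤ) (t : ℝ) :
    Lp Vec4 2 (volume : Measure Plane) :=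
  ∑ e, toL2 volume fun ξ => modeRate bc R Γ η n e ξ •
    expLp (modeRate bc R Γ η n e) t (modePart bc η v₀ n e) ξ

theorem hasDerivAt_solMode (n : ℤ) (t : ℝ) :
    HasDerivAt (fun t => solMode bc R Γ η v₀ n t) (solMode' bc R Γ η v₀ n t) t :=
  HasDerivAt.fun_sum fun e _ => hasDerivAt_expLp (measurable_modeRate bc R Γ η n e)
    (norm_modeRate_le bc R Γ η n e) _ t

/-- The solution is a finite sum of fixed bounded operators applied to differentiable curves. -/
theorem exists_hasDerivAt_explicitSol (t : ℝ) :
    ∃ w, HasDerivAt (explicitSol bc R Γ η v₀) w t := by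
  refine ⟨∑ n ∈ Finset.Icc (-(⌈R⌉₊ : ℤ)) ⌈R⌉₊, vertSynth bc n
    (𝓕⁻ (solMode' bc R Γ η v₀ n t)), ?_⟩
  unfold explicitSol layerSynth
  refine HasDerivAt.fun_sum fun n _ => ?_
  let T : Lp Vec4 2 (volume : Measure Plane) →L[ℂ] L2Layer := (vertSynth bc n).comp
    (Lp.fourierTransformₗᵢ Plane Vec4).symm.toLinearIsometry.toContinuousLinearMap
  exact (T.restrictScalars ℝ).hasFDerivAt.comp_hasDerivAt t (hasDerivAt_solMode n t)

theorem hasDerivAt_layerFourier {v : ℝ → L2Layer} {w : L2Layer} {t : ℝ} (h : HasDerivAt v w t)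
    (n : ℤ) : HasDerivAt (fun t => layerFourier bc (v t) n) (layerFourier bc w n) t :=
  ((layerFourierL bc n).restrictScalars ℝ).hasFDerivAt.comp_hasDerivAt t h

theorem explicitSol_isGeneratorImage {Ω : ℝ} (hη : η = Ω / Γ) (hη0 : η ≠ 0) (hR : 0 < R)
    (hb : IsBaroclinic bc v₀) (hd : IsDivFree bc v₀) (hs : HasFourierSupportIn bc R v₀)
    {t : ℝ} {w : L2Layer} (hw : HasDerivAt (explicitSol bc R Γ η v₀) w t) :
    IsGeneratorImage bc Γ Ω (explicitSol bc R Γ η v₀ t) w := by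
  intro n
  have h1 := hasDerivAt_layerFourier (bc := bc) hw n
  simp only [layerFourier_explicitSol hη0 hb hd hs] at h1
  -- Derivatives pass through the bounded map `layerFourierL`, so by uniqueness of the derivative
  -- the transform of `w` is `solMode'`.
  rw [h1.unique (hasDerivAt_solMode n t), layerFourier_explicitSol hη0 hb hd hs]
  have h2 : ∀ᵐ ξ : Plane, ∀ e, (toL2 volume fun ξ => modeRate bc R Γ η n e ξ •
      expLp (modeRate bc R Γ η n e) t (modePart bc η v₀ n e) ξ) ξ =
      modeRate bc R Γ η n e ξ • expLp (modeRate bc R Γ η n e) t (modePart bc η v₀ n e) ξ :=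
    ae_all_iff.2 fun e => coeFn_toL2 (memLp_smul_of_bound (measurable_modeRate bc R Γ η n e)
      (norm_modeRate_le bc R Γ η n e) _)
  have h3 : ∀ᵐ ξ : Plane, ∀ e, expLp (modeRate bc R Γ η n e) t (modePart bc η v₀ n e) ξ =
      Complex.exp (t * modeRate bc R Γ η n e ξ) • modePart bc η v₀ n e ξ :=
    ae_all_iff.2 fun e => coeFn_expLp (measurable_modeRate bc R Γ η n e)
      (norm_modeRate_le bc R Γ η n e) t _
  have h4 := ae_all_iff.2 fun e => coeFn_modePart hη0 hb hd n e
  filter_upwards [h2, h3, h4, coeFn_solMode (R := R) (Γ := Γ) hη0 hb hd n t,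
    ae_layerFourier_of_admissible hb hd hs hR n,
    Lp.coeFn_finsetSum Finset.univ fun e => toL2 volume fun ξ => modeRate bc R Γ η n e ξ •
      expLp (modeRate bc R Γ η n e) t (modePart bc η v₀ n e) ξ] with ξ a b c d f g
  obtain ⟨f1, f2, f3⟩ := f
  rw [solMode', g, Finset.sum_apply, d, ← hη]
  simp only [a, b, c]
  by_cases hy : layerFourier bc v₀ n ξ = 0
  · simp [hy]
  have hn : n ≠ 0 := fun h => hy (f2 h)
  have hk := waveVector_two_ne_zero bc hn ξ
  have hin : ξ ∈ {ξ | normSq (waveVector bc n ξ) ≤ R ^ 2} := not_not.1 fun h => hy (f3 h)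
  have hr : ∀ e, modeRate bc R Γ η n e ξ = -(normSq (waveVector bc n ξ) : ℂ) +
      ((modeSign e * Γ * dispersion η (waveVector bc n ξ) : ℝ) : ℂ) * Complex.I := fun e => by
    rw [modeRate, indicator_of_mem hin]
  rw [WithLp.ofLp_sum, WithLp.ofLp_sum, Matrix.mulVec_sum, Finset.smul_sum, Finset.smul_sum,
    ← Finset.sum_neg_distrib, ← Finset.sum_sub_distrib]
  refine Finset.sum_congr rfl fun e _ => ?_
  simp only [WithLp.ofLp_smul, Matrix.mulVec_smul]
  -- On each eigenspace the operator acts as the scalar `modeRate`, and the two sides agree term by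
  -- term.
  rw [pjpSymbol_modeProj bc hη0 hk f1, hr e]
  ext j
  simp only [Pi.smul_apply, Pi.sub_apply, Pi.neg_apply, smul_eq_mul]
  push_cast
  ring

theorem isSolution_explicitSol {Ω : ℝ} (hη : η = Ω / Γ) (hη0 : η ≠ 0) (hR : 0 < R)
    (hb : IsBaroclinic bc v₀) (hd : IsDivFree bc v₀) (hs : HasFourierSupportIn bc R v₀) :
    IsSolution bc Γ Ω v₀ (explicitSol bc R Γ η v₀) where
  initial := by
    refine layerFourier_ext bc fun n => ?_
    rw [layerFourier_explicitSol hη0 hb hd hs]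
    refine Lp.ext ?_
    filter_upwards [coeFn_solMode (R := R) (Γ := Γ) hη0 hb hd n 0] with ξ a
    rw [a]
    simp only [Complex.ofReal_zero, zero_mul, Complex.exp_zero, one_smul]
    rw [← WithLp.toLp_sum, sum_modeProj_mulVec]
  continuousOn := fun t _ => by
    obtain ⟨w, hw⟩ := exists_hasDerivAt_explicitSol (bc := bc) (R := R) (Γ := Γ) (η := η)
      (v₀ := v₀) t
    exact hw.continuousAt.continuousWithinAt
  equation := fun t _ => by
    obtain ⟨w, hw⟩ := exists_hasDerivAt_explicitSol (bc := bc) (R := R) (Γ := Γ) (η := η)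
      (v₀ := v₀) t
    exact ⟨w, hw, explicitSol_isGeneratorImage hη hη0 hR hb hd hs hw⟩
  divFree := fun t _ n => by
    rw [layerFourier_explicitSol hη0 hb hd hs]
    filter_upwards [coeFn_solMode (R := R) (Γ := Γ) hη0 hb hd n t,
      ae_layerFourier_of_admissible hb hd hs hR n] with ξ a f
    obtain ⟨f1, f2, -⟩ := f
    rw [a]
    by_cases hy : layerFourier bc v₀ n ξ = 0
    · simp [hy]
    have hk := waveVector_two_ne_zero bc (fun h => hy (f2 h)) ξ
    rw [WithLp.ofLp_sum, dotProduct_sum]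
    refine Finset.sum_eq_zero fun e _ => ?_
    rw [WithLp.ofLp_smul, dotProduct_smul, divSymbol_modeProj bc η hk f1, smul_zero]
  baroclinic := fun t _ => by
    rw [isBaroclinic_iff, layerFourier_explicitSol hη0 hb hd hs]
    refine solMode_eq_zero hη0 hb hd ?_ t
    filter_upwards [ae_layerFourier_of_admissible hb hd hs hR 0] with ξ f
    exact f.2.1 rfl

end Admissible

/-! ### Uniqueness -/

/-- The skew part has zero real part pointwise, which leaves minus the integral of `|k|²` times the
squared modulus of the transform. -/
theorem re_inner_generator_nonpos (bc : VerticalBC) {Γ Ω : ℝ} {f g : L2Layer}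
    (h : IsGeneratorImage bc Γ Ω f g) (n : ℤ) :
    (inner ℂ (layerFourier bc f n) (layerFourier bc g n)).re ≤ 0 := by
  rw [L2.inner_def]
  have hi := L2.integrable_inner (𝕜 := ℂ) (layerFourier bc f n) (layerFourier bc g n)
  have := integral_re hi
  simp only [RCLike.re_eq_complex_re] at this
  rw [← this]
  refine integral_nonpos_of_ae ?_
  filter_upwards [h n] with ξ hξ
  set y := layerFourier bc f n ξ
  have e : inner ℂ y (layerFourier bc g n ξ) =
      star y.ofLp ⬝ᵥ (layerFourier bc g n ξ).ofLp := by
    rw [EuclideanSpace.inner_eq_star_dotProduct, dotProduct_comm]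
  have h2 := norm_toLp_sq y.ofLp
  have h3 := re_star_dotProduct_pjpSymbol bc (Ω / Γ) (waveVector bc n ξ) y.ofLp
  rw [e, hξ, dotProduct_sub, dotProduct_neg, dotProduct_smul, dotProduct_smul, ← h2,
    smul_eq_mul, smul_eq_mul, ← Complex.ofReal_mul, Complex.sub_re, Complex.neg_re,
    Complex.ofReal_re, Complex.re_ofReal_mul, h3]
  simp only [mul_zero, sub_zero, Pi.zero_apply, neg_nonpos]
  exact mul_nonneg (normSq_nonneg _) (by positivity)

theorem IsGeneratorImage.sub {bc : VerticalBC} {Γ Ω : ℝ} {f₁ f₂ g₁ g₂ : L2Layer}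
    (h₁ : IsGeneratorImage bc Γ Ω f₁ g₁) (h₂ : IsGeneratorImage bc Γ Ω f₂ g₂) :
    IsGeneratorImage bc Γ Ω (f₁ - f₂) (g₁ - g₂) := by
  intro n
  have e : ∀ f g, layerFourier bc (f - g) n = layerFourier bc f n - layerFourier bc g n :=
    fun f g => map_sub (layerFourierL bc n) f g
  rw [e, e]
  filter_upwards [h₁ n, h₂ n, Lp.coeFn_sub (layerFourier bc f₁ n) (layerFourier bc f₂ n),
    Lp.coeFn_sub (layerFourier bc g₁ n) (layerFourier bc g₂ n)] with ξ a b c d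
  rw [d, c, Pi.sub_apply, Pi.sub_apply, WithLp.ofLp_sub, WithLp.ofLp_sub, a, b,
    Matrix.mulVec_sub, smul_sub, smul_sub]
  abel

/-- The squared norm of each mode of the difference has nonpositive derivative for positive times,
is continuous up to `0` and starts at `0`. -/
theorem IsSolution.unique {bc : VerticalBC} {Γ Ω : ℝ} {v₀ : L2Layer} {v₁ v₂ : ℝ → L2Layer}
    (h₁ : IsSolution bc Γ Ω v₀ v₁) (h₂ : IsSolution bc Γ Ω v₀ v₂) {t : ℝ} (ht : 0 ≤ t) :
    v₁ t = v₂ t := by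
  rw [← sub_eq_zero]
  refine eq_zero_of_layerFourier_eq_zero bc fun n => ?_
  set z : ℝ → Lp Vec4 2 (volume : Measure Plane) := fun t => layerFourier bc (v₁ t - v₂ t) n
    with hz
  set E : ℝ → ℝ := fun t => (inner ℂ (z t) (z t)).re with hE
  have hzc : ContinuousOn z (Ici 0) :=
    (layerFourierL bc n).continuous.comp_continuousOn (h₁.continuousOn.sub h₂.continuousOn)
  have hEc : ContinuousOn E (Ici 0) :=
    Complex.continuous_re.comp_continuousOn (hzc.inner (𝕜 := ℂ) hzc)
  have hder : ∀ s, 0 < s → ∃ r ≤ 0, HasDerivAt E r s := fun s hs => by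
    obtain ⟨w₁, hw₁, hg₁⟩ := h₁.equation s hs
    obtain ⟨w₂, hw₂, hg₂⟩ := h₂.equation s hs
    have hd : HasDerivAt z (layerFourier bc (w₁ - w₂) n) s :=
      hasDerivAt_layerFourier (hw₁.sub hw₂) n
    have hin := hd.inner ℂ hd
    have hre := (Complex.reCLM.hasFDerivAt.comp_hasDerivAt s hin)
    refine ⟨_, ?_, hre⟩
    have h3 := re_inner_generator_nonpos bc (hg₁.sub hg₂) n
    rw [Complex.reCLM_apply, Complex.add_re, ← inner_conj_symm (layerFourier bc (w₁ - w₂) n),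
      Complex.conj_re]
    linarith
  have hanti : AntitoneOn E (Ici 0) := by
    refine antitoneOn_of_deriv_nonpos (convex_Ici 0) hEc ?_ ?_
    · intro s hs
      rw [interior_Ici] at hs
      obtain ⟨r, -, hr⟩ := hder s hs
      exact hr.differentiableAt.differentiableWithinAt
    · intro s hs
      rw [interior_Ici] at hs
      obtain ⟨r, hr0, hr⟩ := hder s hs
      rw [hr.deriv]; exact hr0
  have hE0 : E 0 = 0 := by
    simp only [hE, hz]
    rw [h₁.initial, h₂.initial, sub_self]
    have : layerFourier bc 0 n = 0 := map_zero (layerFourierL bc n)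
    rw [this, inner_zero_left, Complex.zero_re]
  have hEt : E t ≤ 0 := hE0 ▸ hanti (mem_Ici.2 le_rfl) ht ht
  have : ‖z t‖ ^ 2 ≤ 0 := by
    have h := inner_self_eq_norm_sq (𝕜 := ℂ) (z t)
    rw [← h]; exact hEt
  have h0 : ‖z t‖ = 0 := by nlinarith [norm_nonneg (z t)]
  exact norm_eq_zero.1 h0


/-! ### Evaluation of synthesized modes -/

/-- The representative in `L²` of evaluation at `x` of the inverse Fourier transform of functions
supported in `A`, in the direction `b`. -/
def evalVec (A : Set Plane) (b : Vec4) (x : Plane) : Lp Vec4 2 (volume : Measure Plane) :=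
  toL2 volume (A.indicator fun ξ =>
    Complex.exp (-((2 * Real.pi * inner ℝ ξ x : ℝ) * Complex.I)) • b)

section Eval

variable {A : Set Plane} {b : Vec4}

theorem norm_evalVec_aux (b : Vec4) (x ξ : Plane) :
    ‖Complex.exp (-((2 * Real.pi * inner ℝ ξ x : ℝ) * Complex.I)) • b‖ = ‖b‖ := by
  rw [norm_smul, ← neg_mul, ← Complex.ofReal_neg, Complex.norm_exp_ofReal_mul_I, one_mul]

theorem memLp_evalVec (hA : MeasurableSet A) (hAf : volume A ≠ ∞) (b : Vec4) (x : Plane) :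
    MemLp (A.indicator fun ξ : Plane =>
      Complex.exp (-((2 * Real.pi * inner ℝ ξ x : ℝ) * Complex.I)) • b) 2 volume := by
  have h : MemLp (A.indicator fun _ : Plane => b) 2 volume :=
    memLp_indicator_const 2 hA b (Or.inr hAf)
  refine h.of_le ?_ (Filter.Eventually.of_forall fun ξ => ?_)
  · exact (Continuous.aestronglyMeasurable (by fun_prop)).indicator hA
  · by_cases hξ : ξ ∈ A
    · rw [indicator_of_mem hξ, indicator_of_mem hξ, norm_evalVec_aux]
    · rw [indicator_of_notMem hξ, indicator_of_notMem hξ]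

theorem coeFn_evalVec (hA : MeasurableSet A) (hAf : volume A ≠ ∞) (b : Vec4) (x : Plane) :
    evalVec A b x =ᵐ[volume] A.indicator fun ξ =>
      Complex.exp (-((2 * Real.pi * inner ℝ ξ x : ℝ) * Complex.I)) • b :=
  coeFn_toL2 (memLp_evalVec hA hAf b x)

theorem norm_evalVec_le (hA : MeasurableSet A) (hAf : volume A ≠ ∞) (b : Vec4) (x : Plane) :
    ‖evalVec A b x‖ ≤ ‖b‖ * √(volume.real A) := by
  have h : ‖evalVec A b x‖ ≤ ‖indicatorConstLp 2 hA hAf b‖ := by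
    refine Lp.norm_le_norm_of_ae_le ?_
    filter_upwards [coeFn_evalVec hA hAf b x,
      indicatorConstLp_coeFn (p := 2) (hs := hA) (hμs := hAf) (c := b)] with ξ h1 h2
    rw [h1, h2]
    by_cases hξ : ξ ∈ A
    · rw [indicator_of_mem hξ, indicator_of_mem hξ, norm_evalVec_aux]
    · rw [indicator_of_notMem hξ, indicator_of_notMem hξ]
  refine h.trans (le_of_eq ?_)
  rw [norm_indicatorConstLp two_ne_zero ENNReal.ofNat_ne_top, Real.sqrt_eq_rpow]
  norm_num

theorem integrable_of_ae_eq_zero {f : Lp Vec4 2 (volume : Measure Plane)}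
    (hA : MeasurableSet A) (hAf : volume A ≠ ∞) (hf : ∀ᵐ ξ : Plane, ξ ∉ A → f ξ = 0) :
    Integrable f := by
  have h : IntegrableOn f A := by
    have : IsFiniteMeasure (volume.restrict A) := ⟨by simpa using hAf.lt_top⟩
    exact ((Lp.memLp f).restrict A).integrable (by norm_num)
  refine ((integrable_indicator_iff hA).2 h).congr ?_
  filter_upwards [hf] with ξ hξ
  by_cases hm : ξ ∈ A
  · rw [indicator_of_mem hm]
  · rw [indicator_of_notMem hm, hξ hm]

variable {lam : Plane → ℂ} {L : ℝ}

/-- The evaluation vector propagated by the adjoint semigroup. -/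
def evalFlow (lam : Plane → ℂ) (A : Set Plane) (b : Vec4) (x : Plane) (t : ℝ) :
    Lp Vec4 2 (volume : Measure Plane) :=
  expLp (fun ξ => (starRingEnd ℂ) (lam ξ)) t (evalVec A b x)

theorem measurable_conj (hlam : Measurable lam) :
    Measurable fun ξ => (starRingEnd ℂ) (lam ξ) :=
  Complex.continuous_conj.measurable.comp hlam

theorem norm_conj_le (hL : ∀ ξ, ‖lam ξ‖ ≤ L) (ξ : Plane) : ‖(starRingEnd ℂ) (lam ξ)‖ ≤ L := by
  rw [Complex.norm_conj]; exact hL ξ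

theorem continuous_evalFlow (hlam : Measurable lam) (hL : ∀ ξ, ‖lam ξ‖ ≤ L) (A : Set Plane)
    (b : Vec4) (x : Plane) : Continuous (evalFlow lam A b x) :=
  continuous_iff_continuousAt.2 fun t =>
    (hasDerivAt_expLp (measurable_conj hlam) (norm_conj_le hL) _ t).continuousAt

theorem coeFn_evalFlow (hlam : Measurable lam) (hL : ∀ ξ, ‖lam ξ‖ ≤ L) (hA : MeasurableSet A)
    (hAf : volume A ≠ ∞) (b : Vec4) (x : Plane) (t : ℝ) :
    evalFlow lam A b x t =ᵐ[volume] A.indicator fun ξ =>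
      Complex.exp (t * (starRingEnd ℂ) (lam ξ) -
        (2 * Real.pi * inner ℝ ξ x : ℝ) * Complex.I) • b := by
  filter_upwards [coeFn_expLp (measurable_conj hlam) (norm_conj_le hL) t (evalVec A b x),
    coeFn_evalVec hA hAf b x] with ξ h1 h2
  rw [evalFlow, h1, h2]
  by_cases hξ : ξ ∈ A
  · rw [indicator_of_mem hξ, indicator_of_mem hξ, smul_smul, ← Complex.exp_add, sub_eq_add_neg]
  · rw [indicator_of_notMem hξ, indicator_of_notMem hξ, smul_zero]

theorem norm_evalFlow_le (hlam : Measurable lam) (hL : ∀ ξ, ‖lam ξ‖ ≤ L) (hA : MeasurableSet A)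
    (hAf : volume A ≠ ∞) (hre : ∀ ξ ∈ A, (lam ξ).re ≤ -1) (b : Vec4) (x : Plane) {t : ℝ}
    (ht : 0 < t) : ‖evalFlow lam A b x t‖ ≤ ‖b‖ * √(volume.real A) * Real.exp (-t) := by
  have h : ‖evalFlow lam A b x t‖ ≤ Real.exp (-t) * ‖evalVec A b x‖ := by
    refine Lp.norm_le_mul_norm_of_ae_le_mul ?_
    filter_upwards [coeFn_evalFlow hlam hL hA hAf b x t, coeFn_evalVec hA hAf b x] with ξ h1 h2
    rw [h1, h2]
    by_cases hξ : ξ ∈ A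
    · rw [indicator_of_mem hξ, indicator_of_mem hξ, norm_evalVec_aux, norm_smul, Complex.norm_exp]
      refine mul_le_mul_of_nonneg_right (Real.exp_le_exp.2 ?_) (norm_nonneg _)
      have := hre ξ hξ
      simp
      nlinarith
    · rw [indicator_of_notMem hξ, indicator_of_notMem hξ, norm_zero, mul_zero]
  refine h.trans ?_
  rw [mul_comm]
  exact mul_le_mul_of_nonneg_right (norm_evalVec_le hA hAf b x) (Real.exp_pos _).le

/-- Pointwise evaluation of the evolved field becomes an inner product with the unevolved data; the
evolution is moved to the other factor by conjugating the rate. This is the form that the `TT*`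
estimate requires. -/
theorem inner_evalFlow (hlam : Measurable lam) (hL : ∀ ξ, ‖lam ξ‖ ≤ L) (hA : MeasurableSet A)
    (hAf : volume A ≠ ∞) (b : Vec4) (x : Plane) (t : ℝ) {f : Lp Vec4 2 (volume : Measure Plane)}
    (hf : ∀ᵐ ξ : Plane, ξ ∉ A → f ξ = 0) :
    inner ℂ (evalFlow lam A b x t) f = inner ℂ b (𝓕⁻ (expLp lam t f : Plane → Vec4) x) := by
  have hg : ∀ᵐ ξ : Plane, ξ ∉ A → expLp lam t f ξ = 0 := by
    filter_upwards [hf, coeFn_expLp hlam hL t f] with ξ h1 h2 hξ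
    rw [h2, h1 hξ, smul_zero]
  have hgi := integrable_of_ae_eq_zero hA hAf hg
  have hgi2 : Integrable fun ξ : Plane =>
      Complex.exp ((2 * Real.pi * inner ℝ ξ x : ℝ) * Complex.I) • expLp lam t f ξ := by
    refine (hgi.norm).mono' (AEStronglyMeasurable.smul
      (f := fun ξ : Plane => Complex.exp ((2 * Real.pi * inner ℝ ξ x : ℝ) * Complex.I))
      (Continuous.aestronglyMeasurable (by fun_prop)) hgi.1)
      (Filter.Eventually.of_forall fun ξ => ?_)
    rw [norm_smul, Complex.norm_exp_ofReal_mul_I, one_mul]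
  rw [Real.fourierInv_eq', ← integral_inner hgi2, L2.inner_def]
  refine integral_congr_ae ?_
  filter_upwards [coeFn_evalFlow hlam hL hA hAf b x t, hf, coeFn_expLp hlam hL t f]
    with ξ h1 h2 h3
  rw [h1, h3]
  by_cases hξ : ξ ∈ A
  · rw [indicator_of_mem hξ, inner_smul_left, inner_smul_right, inner_smul_right, ← mul_assoc,
      ← Complex.exp_conj, ← Complex.exp_add]
    congr 2
    have h4 : (starRingEnd ℂ) 2 = 2 := map_ofNat _ 2
    simp [h4]
    ring
  · rw [indicator_of_notMem hξ, h2 hξ]; simp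

/-- This is the kernel of `TT*`. In the exponent the real parts of the rates are weighted by `s + t`
and the imaginary parts by `s - t`; the points enter only through `x - y`. -/
theorem inner_evalFlow_evalFlow (hlam : Measurable lam) (hL : ∀ ξ, ‖lam ξ‖ ≤ L)
    (hA : MeasurableSet A) (hAf : volume A ≠ ∞) (b : Vec4) (x y : Plane) (s t : ℝ) :
    inner ℂ (evalFlow lam A b x s) (evalFlow lam A b y t) = (∫ ξ in A,
      Complex.exp (s * lam ξ + t * (starRingEnd ℂ) (lam ξ) +
        (2 * Real.pi * inner ℝ (x - y) ξ : ℝ) * Complex.I)) * inner ℂ b b := by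
  rw [L2.inner_def, ← integral_mul_const, ← integral_indicator hA]
  refine integral_congr_ae ?_
  filter_upwards [coeFn_evalFlow hlam hL hA hAf b x s, coeFn_evalFlow hlam hL hA hAf b y t]
    with ξ h1 h2
  rw [h1, h2]
  by_cases hξ : ξ ∈ A
  · rw [indicator_of_mem hξ, indicator_of_mem hξ, indicator_of_mem hξ, inner_smul_left,
      inner_smul_right, ← mul_assoc, ← Complex.exp_conj, ← Complex.exp_add]
    congr 2
    have h4 : (starRingEnd ℂ) 2 = 2 := map_ofNat _ 2
    rw [inner_sub_left, real_inner_comm ξ x, real_inner_comm ξ y]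
    simp [h4]
    ring
  · rw [indicator_of_notMem hξ, indicator_of_notMem hξ, indicator_of_notMem hξ]; simp

/-! ### The supremum norm of one mode -/

/-- The supremum over the plane of the component in direction `b` of the mode at time `t`. -/
def modeSup (lam : Plane → ℂ) (A : Set Plane) (b : Vec4) (f : Lp Vec4 2 (volume : Measure Plane))
    (t : ℝ) : ℝ≥0∞ :=
  ⨆ q : ℕ, ‖inner ℂ (evalFlow lam A b (TopologicalSpace.denseSeq Plane q) t) f‖ₑ

theorem measurable_modeSup (hlam : Measurable lam) (hL : ∀ ξ, ‖lam ξ‖ ≤ L) (A : Set Plane)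
    (b : Vec4) (f : Lp Vec4 2 (volume : Measure Plane)) : Measurable (modeSup lam A b f) :=
  Measurable.iSup fun _ =>
    (((continuous_evalFlow hlam hL A b _).inner continuous_const).enorm).measurable

theorem modeSup_zero (lam : Plane → ℂ) (A : Set Plane) (b : Vec4) (t : ℝ) :
    modeSup lam A b 0 t = 0 := by
  simp [modeSup]

/-- The data have bounded support, so the inverse transform is continuous and a dense sequence of
points sees its supremum. The vertical profiles are bounded by `1`, and the norm in `ℂ⁴` is at most
the sum of the moduli of the components. -/
theorem eLpNorm_vertSynth_le (bc : VerticalBC) (n : ℤ) (hlam : Measurable lam)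
    (hL : ∀ ξ, ‖lam ξ‖ ≤ L) (hA : MeasurableSet A) (hAf : volume A ≠ ∞) (t : ℝ)
    {f : Lp Vec4 2 (volume : Measure Plane)} (hf : ∀ᵐ ξ : Plane, ξ ∉ A → f ξ = 0) :
    eLpNorm (vertSynth bc n (𝓕⁻ (expLp lam t f))) ∞ layerMeasure ≤
      ∑ j : Fin 4, modeSup lam A (EuclideanSpace.single j 1) f t := by
  have hg : ∀ᵐ ξ : Plane, ξ ∉ A → expLp lam t f ξ = 0 := by
    filter_upwards [hf, coeFn_expLp hlam hL t f] with ξ h1 h2 hξ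
    rw [h2, h1 hξ, smul_zero]
  have hgi := integrable_of_ae_eq_zero hA hAf hg
  set F : Plane → Vec4 := 𝓕⁻ (expLp lam t f : Plane → Vec4) with hF
  have hcont : Continuous F := by
    rw [hF, Real.fourierInv_eq_fourier_comp_neg]
    exact VectorFourier.fourierIntegral_continuous Real.continuous_fourierChar
      (by exact continuous_inner) hgi.comp_neg
  have hcl : IsClosed {x | ‖F x‖ₑ ≤
      ∑ j : Fin 4, modeSup lam A (EuclideanSpace.single j 1) f t} :=
    isClosed_le hcont.enorm continuous_const
  have hall : ∀ x, ‖F x‖ₑ ≤ ∑ j : Fin 4, modeSup lam A (EuclideanSpace.single j 1) f t := by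
    intro x
    refine hcl.closure_subset_iff.2 ?_ (TopologicalSpace.denseRange_denseSeq Plane x)
    rintro _ ⟨q, rfl⟩
    have hsum : ∀ w : Vec4, ‖w‖ₑ ≤ ∑ j, ‖w j‖ₑ := fun w => by
      have e : w = ∑ j, EuclideanSpace.single j (w j) := by
        ext i
        simp [WithLp.ofLp_sum, Finset.sum_apply, Pi.single_apply]
      calc ‖w‖ₑ = ‖∑ j, EuclideanSpace.single j (w j)‖ₑ := by rw [← e]
        _ ≤ ∑ j, ‖EuclideanSpace.single j (w j)‖ₑ := enorm_sum_le _ _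
        _ = _ := by simp [enorm_eq_nnnorm]
    refine (hsum _).trans (Finset.sum_le_sum fun j _ => ?_)
    refine le_trans (le_of_eq ?_) (le_iSup _ q)
    rw [inner_evalFlow hlam hL hA hAf _ _ t hf, EuclideanSpace.inner_single_left]
    simp [hF]
  refine eLpNorm_exponent_top.trans_le ?_
  refine eLpNormEssSup_le_of_ae_enorm_bound ?_
  filter_upwards [coeFn_vertSynth bc n (𝓕⁻ (expLp lam t f)),
    vertSynthFun_congr bc n (coeFn_fourierInv_of_integrable hgi)] with x h1 h2
  rw [h1, h2]
  refine le_trans ?_ (hall x.1)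
  exact enorm_le_iff_norm_le.2 (norm_vertIntegrand_le bc _ _ x)

/-- Estimate by the decay of the heat semigroup. -/
theorem lintegral_modeSup_le_of_re (hlam : Measurable lam) (hL : ∀ ξ, ‖lam ξ‖ ≤ L)
    (hA : MeasurableSet A) (hAf : volume A ≠ ∞) (hre : ∀ ξ ∈ A, (lam ξ).re ≤ -1) (b : Vec4)
    (hb : ‖b‖ = 1) (f : Lp Vec4 2 (volume : Measure Plane)) :
    ∫⁻ t in Ioi (0 : ℝ), modeSup lam A b f t ≤
      ENNReal.ofReal (√(volume.real A) * ‖f‖) := by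
  calc ∫⁻ t in Ioi (0 : ℝ), modeSup lam A b f t
      ≤ ∫⁻ t in Ioi (0 : ℝ), ENNReal.ofReal (√(volume.real A) * ‖f‖ * Real.exp (-t)) := by
        refine setLIntegral_mono' measurableSet_Ioi fun t ht => iSup_le fun q => ?_
        rw [← ofReal_norm]
        refine ENNReal.ofReal_le_ofReal ((norm_inner_le_norm _ _).trans ?_)
        have := norm_evalFlow_le hlam hL hA hAf hre b (TopologicalSpace.denseSeq Plane q) ht
        rw [hb, one_mul] at this
        refine (mul_le_mul_of_nonneg_right this (norm_nonneg _)).trans (le_of_eq (by ring))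
    _ = ENNReal.ofReal (∫ t in Ioi (0 : ℝ), √(volume.real A) * ‖f‖ * Real.exp (-t)) := by
        rw [ofReal_integral_eq_lintegral_ofReal]
        · exact integrableOn_exp_neg.1.const_mul _
        · exact Filter.Eventually.of_forall fun t => by positivity
    _ = _ := by rw [integral_const_mul, integral_exp_neg_Ioi_zero, mul_one]

end Eval


/-! ### Dispersive estimate for one mode -/

/-- Squared radius of the disc of horizontal frequencies with `|k| ≤ R` at the `n`-th mode. -/
def discRadiusSq (bc : VerticalBC) (R : ℝ) (n : ℤ) : ℝ :=
  (R ^ 2 - vertFreq bc n ^ 2) / (2 * Real.pi) ^ 2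

theorem normSq_waveVector_le_iff (bc : VerticalBC) (R : ℝ) (n : ℤ) (ξ : Plane) :
    normSq (waveVector bc n ξ) ≤ R ^ 2 ↔ ‖ξ‖ ^ 2 ≤ discRadiusSq bc R n := by
  rw [normSq_waveVector, discRadiusSq, le_div_iff₀ (by positivity)]
  constructor <;> intro h <;> linarith

theorem discRadiusSq_le (bc : VerticalBC) (R : ℝ) (n : ℤ) : discRadiusSq bc R n ≤ R ^ 2 := by
  have hpi := Real.pi_gt_three
  rw [discRadiusSq, div_le_iff₀ (by positivity)]
  nlinarith [sq_nonneg R, sq_nonneg (vertFreq bc n),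
    mul_nonneg (sq_nonneg R) (by nlinarith : (0 : ℝ) ≤ (2 * Real.pi) ^ 2 - 1)]

theorem planeSector_subset_closedBall {u : Plane} {r R : ℝ} (hR : 0 ≤ R) (hr : r ≤ R ^ 2) :
    planeSector u r ⊆ Metric.closedBall 0 R := fun ξ hξ => by
  rw [mem_closedBall_zero_iff]
  exact (sq_le_sq₀ (norm_nonneg _) hR).1 (hξ.2.trans hr)

theorem volume_planeSector_ne_top {u : Plane} {r R : ℝ} (hR : 0 ≤ R) (hr : r ≤ R ^ 2) :
    volume (planeSector u r) ≠ ∞ :=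
  ((measure_mono (planeSector_subset_closedBall hR hr)).trans_lt
    measure_closedBall_lt_top).ne

theorem one_le_vertFreq_sq (bc : VerticalBC) {n : ℤ} (hn : n ≠ 0) : 1 ≤ vertFreq bc n ^ 2 := by
  have h := pi_le_abs_vertFreq bc hn
  have hpi := Real.pi_gt_three
  rw [← sq_abs]
  nlinarith

/-- The horizontal wave vector is `2πξ`, so dividing numerator and denominator by `(2π)²` leaves `κ
= (k₃ / 2π)²`. -/
theorem dispersion_waveVector (bc : VerticalBC) (η : ℝ) (n : ℤ) (ξ : Plane) :
    dispersion η (waveVector bc n ξ) =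
      layerDisp (vertFreq bc n ^ 2 / (2 * Real.pi) ^ 2) η (‖ξ‖ ^ 2) := by
  have h1 : normSq ![waveVector bc n ξ 0, waveVector bc n ξ 1, η * waveVector bc n ξ 2] =
      (2 * Real.pi) ^ 2 * (‖ξ‖ ^ 2 + vertFreq bc n ^ 2 / (2 * Real.pi) ^ 2 * η ^ 2) := by
    have hpi := Real.pi_ne_zero
    rw [norm_sq_plane, normSq]
    simp [waveVector]
    field_simp
  have h2 : normSq (waveVector bc n ξ) =
      (2 * Real.pi) ^ 2 * (‖ξ‖ ^ 2 + vertFreq bc n ^ 2 / (2 * Real.pi) ^ 2) := by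
    have hpi := Real.pi_ne_zero
    rw [normSq_waveVector]
    field_simp
  rw [dispersion, dispersionSq, h1, h2, layerDisp,
    mul_div_mul_left _ _ (by have := Real.pi_pos; positivity)]

theorem rpow_neg_half {x : ℝ} (hx : 0 ≤ x) : x ^ (-(1 / 2) : ℝ) = 1 / √x := by
  rw [Real.rpow_neg hx, Real.sqrt_eq_rpow, one_div (_ ^ _)]

/-- Constant in the kernel estimate. -/
def kernelConst (R Γ₀ : ℝ) : ℝ := 32 * R * (1 / √(Γ₀ / (32 * R ^ 6)))

section Mode

variable {bc : VerticalBC} {R Γ₀ Γ η : ℝ} {n : ℤ} {e : Fin 3}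

theorem modeRate_of_le {ξ : Plane} (hξ : ‖ξ‖ ^ 2 ≤ discRadiusSq bc R n) :
    modeRate bc R Γ η n e ξ = -(normSq (waveVector bc n ξ) : ℂ) +
      ((modeSign e * Γ * dispersion η (waveVector bc n ξ) : ℝ) : ℂ) * Complex.I := by
  rw [modeRate, indicator_of_mem]
  exact (normSq_waveVector_le_iff bc R n ξ).2 hξ

theorem modeRate_re_le (hn : n ≠ 0) {ξ : Plane} (hξ : ‖ξ‖ ^ 2 ≤ discRadiusSq bc R n) :
    (modeRate bc R Γ η n e ξ).re ≤ -1 := by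
  have h1 := one_le_vertFreq_sq bc hn
  have h2 : 0 ≤ (2 * Real.pi) ^ 2 * ‖ξ‖ ^ 2 := by positivity
  rw [modeRate_of_le hξ, Complex.add_re, Complex.neg_re, Complex.ofReal_re,
    Complex.re_ofReal_mul, Complex.I_re, mul_zero, normSq_waveVector]
  linarith

theorem abs_modeSign (he : e ≠ 0) : |modeSign e| = 1 := by
  fin_cases e
  · exact absurd rfl he
  · simp [modeSign]
  · simp [modeSign]

/-- The dispersive estimate. The vertical part of the heat factor leaves the integral and supplies
the decay in time; the horizontal part is the monotone Gaussian amplitude. The constant is uniform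
in `n`, `x` and `y`. -/
theorem norm_inner_evalFlow_modeRate_le (hR : 0 < R) (hΓ₀ : 0 < Γ₀) (hΓ : Γ₀ ≤ |Γ|) (hn : n ≠ 0)
    (he : e ≠ 0) (hη : 2 ≤ η ^ 2) {u : Plane} (hu : ‖u‖ = 1) {b : Vec4} (hb : ‖b‖ = 1)
    (x y : Plane) {s t : ℝ} (hs : 0 < s) (ht : 0 < t) (hst : s ≠ t) :
    ‖inner ℂ (evalFlow (modeRate bc R Γ η n e) (planeSector u (discRadiusSq bc R n)) b x s)
      (evalFlow (modeRate bc R Γ η n e) (planeSector u (discRadiusSq bc R n)) b y t)‖ ≤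
      kernelConst R Γ₀ * |η| ^ (-(1 / 2) : ℝ) * Real.exp (-(s + t)) *
        |s - t| ^ (-(1 / 2) : ℝ) := by
  set r := discRadiusSq bc R n with hr
  set κ := vertFreq bc n ^ 2 / (2 * Real.pi) ^ 2 with hκd
  have hpi := Real.pi_gt_three
  have hrR : r ≤ R ^ 2 := discRadiusSq_le bc R n
  have h1 := one_le_vertFreq_sq bc hn
  -- This is `|k₃| ≥ π`: a nonzero vertical mode keeps the curvature of the dispersion relation away
  -- from zero.
  have hκ4 : 1 / 4 ≤ κ := by
    have h2 := pi_le_abs_vertFreq bc hn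
    rw [hκd, le_div_iff₀ (by positivity), ← sq_abs (vertFreq bc n)]
    nlinarith
  have hκ : 0 < κ := by linarith
  -- The sum `r + κ` equals `R² / (2π)²`, so `D = R²` serves all modes.
  have hD : r + κ ≤ R ^ 2 := by
    have : r + κ = R ^ 2 / (2 * Real.pi) ^ 2 := by rw [hr, discRadiusSq, hκd]; ring
    rw [this]
    exact div_le_self (sq_nonneg R) (by nlinarith)
  have hτ : modeSign e * Γ * (s - t) ≠ 0 := by
    refine mul_ne_zero (mul_ne_zero ?_ ?_) (sub_ne_zero.2 hst)
    · rw [← abs_pos, abs_modeSign he]; exact one_pos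
    · rw [← abs_pos]; exact hΓ₀.trans_le hΓ
  have hσ : 0 ≤ (2 * Real.pi) ^ 2 * (s + t) := by positivity
  have hbb : inner ℂ b b = 1 := by rw [inner_self_eq_norm_sq_to_K, hb]; simp
  rw [inner_evalFlow_evalFlow (measurable_modeRate bc R Γ η n e) (norm_modeRate_le bc R Γ η n e)
    (measurableSet_planeSector _ _) (volume_planeSector_ne_top hR.le hrR), hbb, mul_one]
  have hint : ∫ ξ in planeSector u r, Complex.exp (s * modeRate bc R Γ η n e ξ +
        t * (starRingEnd ℂ) (modeRate bc R Γ η n e ξ) +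
        (2 * Real.pi * inner ℝ (x - y) ξ : ℝ) * Complex.I) =
      (Real.exp (-(vertFreq bc n ^ 2 * (s + t))) : ℂ) * ∫ ξ in planeSector u r,
        (Real.exp (-((2 * Real.pi) ^ 2 * (s + t)) * ‖ξ‖ ^ 2) : ℂ) *
        Complex.exp (Complex.I * ((inner ℝ ((2 * Real.pi) • (x - y)) ξ +
          modeSign e * Γ * (s - t) * layerDisp κ η (‖ξ‖ ^ 2) : ℝ) : ℂ)) := by
    rw [← integral_const_mul]
    refine setIntegral_congr_fun (measurableSet_planeSector _ _) fun ξ hξ => ?_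
    rw [← mul_assoc, ← Complex.ofReal_mul, ← Real.exp_add, Complex.ofReal_exp, ← Complex.exp_add,
      modeRate_of_le hξ.2, dispersion_waveVector, ← hκd, normSq_waveVector, inner_smul_left]
    congr 1
    have h2 : (starRingEnd ℂ) 2 = 2 := map_ofNat _ 2
    simp [h2]
    ring
  rw [hint, norm_mul, Complex.norm_real, Real.norm_of_nonneg (Real.exp_pos _).le]
  have hosc := norm_planeSector_integral_le hκ hη hτ hσ hD hu ((2 * Real.pi) • (x - y))
  have hηp : 0 < |η| := abs_pos.2 fun h => by rw [h] at hη; norm_num at hη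
  have hstp : 0 < |s - t| := abs_pos.2 (sub_ne_zero.2 hst)
  -- With `κ² ≥ 1/16` and `D = R²`, the factor `κ² / (2 D³)` is at least `1 / (32 R⁶)`, the number
  -- appearing in `kernelConst`.
  have hden : |s - t| * (|η| * (Γ₀ / (32 * R ^ 6))) ≤
      |modeSign e * Γ * (s - t)| * (κ ^ 2 * |η| / (2 * (R ^ 2) ^ 3)) := by
    rw [abs_mul, abs_mul, abs_modeSign he, one_mul]
    have hκ2 : 1 / 16 ≤ κ ^ 2 := by nlinarith
    calc |s - t| * (|η| * (Γ₀ / (32 * R ^ 6)))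
        = Γ₀ * |s - t| * (1 / 16 * |η| / (2 * (R ^ 2) ^ 3)) := by field_simp; norm_num
      _ ≤ _ := by gcongr
  have hfin : 2 * √r * (16 / √(|modeSign e * Γ * (s - t)| *
      (κ ^ 2 * |η| / (2 * (R ^ 2) ^ 3)))) ≤
      kernelConst R Γ₀ * |η| ^ (-(1 / 2) : ℝ) * |s - t| ^ (-(1 / 2) : ℝ) := by
    have hsr : √r ≤ R := (Real.sqrt_le_sqrt hrR).trans (Real.sqrt_sq hR.le).le
    calc _ ≤ 2 * R * (16 / √(|s - t| * (|η| * (Γ₀ / (32 * R ^ 6))))) := by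
          gcongr
      _ = _ := by
          rw [Real.sqrt_mul hstp.le, Real.sqrt_mul hηp.le, rpow_neg_half hηp.le,
            rpow_neg_half hstp.le, kernelConst]
          field_simp
          norm_num
  have hexp : Real.exp (-(vertFreq bc n ^ 2 * (s + t))) ≤ Real.exp (-(s + t)) := by
    refine Real.exp_le_exp.2 ?_
    nlinarith
  calc _ ≤ Real.exp (-(s + t)) * (kernelConst R Γ₀ * |η| ^ (-(1 / 2) : ℝ) *
        |s - t| ^ (-(1 / 2) : ℝ)) :=
        mul_le_mul hexp (hosc.trans hfin) (norm_nonneg _) (Real.exp_pos _).le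
    _ = _ := by ring

/-- Constant in the estimate for one mode. -/
def modeConst (R Γ₀ : ℝ) : ℝ :=
  √(5 * kernelConst R Γ₀) + 2 * √(volume.real (Metric.closedBall (0 : Plane) R))

theorem kernelConst_pos (hR : 0 < R) (hΓ₀ : 0 < Γ₀) : 0 < kernelConst R Γ₀ := by
  unfold kernelConst; positivity

theorem modeConst_pos (hR : 0 < R) (hΓ₀ : 0 < Γ₀) : 0 < modeConst R Γ₀ := by
  have := kernelConst_pos hR hΓ₀
  unfold modeConst; positivity

/-- The gain of the oscillating modes for large `|η|`. -/
def modeWeight (η : ℝ) (e : Fin 3) : ℝ := if e = 0 then 1 else |η| ^ (-(1 / 4) : ℝ)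

theorem lintegral_modeSup_le_trivial (hR : 0 < R) (hn : n ≠ 0) (u : Plane) {b : Vec4}
    (hb : ‖b‖ = 1) (f : Lp Vec4 2 (volume : Measure Plane)) :
    ∫⁻ t in Ioi (0 : ℝ), modeSup (modeRate bc R Γ η n e)
      (planeSector u (discRadiusSq bc R n)) b f t ≤
      ENNReal.ofReal (√(volume.real (Metric.closedBall (0 : Plane) R)) * ‖f‖) := by
  have hrR := discRadiusSq_le bc R n
  refine (lintegral_modeSup_le_of_re (measurable_modeRate bc R Γ η n e)
    (norm_modeRate_le bc R Γ η n e) (measurableSet_planeSector _ _)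
    (volume_planeSector_ne_top hR.le hrR) (fun ξ hξ => modeRate_re_le hn hξ.2) b hb f).trans
    (ENNReal.ofReal_le_ofReal ?_)
  gcongr
  · exact measure_closedBall_lt_top.ne
  · exact planeSector_subset_closedBall hR.le hrR

/-- Geostrophic modes and the range `η² < 2` rest on heat decay alone; for `η² ≥ 2` the oscillating
modes use the dispersive kernel bound. -/
theorem lintegral_modeSup_le (hR : 0 < R) (hΓ₀ : 0 < Γ₀) (hΓ : Γ₀ ≤ |Γ|) (hη0 : η ≠ 0)
    (hn : n ≠ 0) {u : Plane} (hu : ‖u‖ = 1) {b : Vec4} (hb : ‖b‖ = 1)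
    (f : Lp Vec4 2 (volume : Measure Plane)) :
    ∫⁻ t in Ioi (0 : ℝ), modeSup (modeRate bc R Γ η n e)
      (planeSector u (discRadiusSq bc R n)) b f t ≤
      ENNReal.ofReal (modeConst R Γ₀ * (modeWeight η e * ‖f‖)) := by
  have hK := kernelConst_pos hR hΓ₀
  have hηp : 0 < |η| := abs_pos.2 hη0
  set V := √(volume.real (Metric.closedBall (0 : Plane) R)) with hV
  have hV0 : 0 ≤ V := Real.sqrt_nonneg _
  have hC1 : V ≤ modeConst R Γ₀ := by
    rw [modeConst]; linarith [Real.sqrt_nonneg (5 * kernelConst R Γ₀)]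
  by_cases he : e = 0
  · refine (lintegral_modeSup_le_trivial hR hn u hb f).trans (ENNReal.ofReal_le_ofReal ?_)
    rw [modeWeight, if_pos he, one_mul]
    gcongr
  rw [modeWeight, if_neg he]
  by_cases hη : 2 ≤ η ^ 2
  · have hw : (0 : ℝ) ≤ |η| ^ (-(1 / 2) : ℝ) := by positivity
    refine (lintegral_iSup_inner_le (K := kernelConst R Γ₀ * |η| ^ (-(1 / 2) : ℝ))
      (fun q => continuous_evalFlow (measurable_modeRate bc R Γ η n e)
        (norm_modeRate_le bc R Γ η n e) (planeSector u (discRadiusSq bc R n)) b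
        (TopologicalSpace.denseSeq Plane q)) (by positivity)
      (fun q t ht => norm_evalFlow_le (measurable_modeRate bc R Γ η n e)
        (norm_modeRate_le bc R Γ η n e) (measurableSet_planeSector _ _)
        (volume_planeSector_ne_top hR.le (discRadiusSq_le bc R n))
        (fun ξ hξ => modeRate_re_le hn hξ.2) b _ ht)
      (fun i j s t hs ht hst => norm_inner_evalFlow_modeRate_le hR hΓ₀ hΓ hn he hη hu hb _ _
        hs ht hst) f).trans (ENNReal.ofReal_le_ofReal ?_)
    -- The square root in the `TT*` estimate halves the exponent `-1/2` of the kernel.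
    have e1 : √(5 * (kernelConst R Γ₀ * |η| ^ (-(1 / 2) : ℝ))) =
        √(5 * kernelConst R Γ₀) * |η| ^ (-(1 / 4) : ℝ) := by
      rw [← mul_assoc, Real.sqrt_mul (by positivity), Real.sqrt_eq_rpow (_ ^ _),
        ← Real.rpow_mul hηp.le]
      norm_num
    rw [e1, mul_assoc]
    gcongr
    rw [modeConst]
    linarith
  · refine (lintegral_modeSup_le_trivial hR hn u hb f).trans (ENNReal.ofReal_le_ofReal ?_)
    -- For small `|η|` no oscillation is needed: the weight is at least `1/2`, which explains the
    -- factor `2` in `modeConst`.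
    have h2 : |η| ≤ 2 := abs_le.2 ⟨by nlinarith, by nlinarith⟩
    have h3 : (1 : ℝ) / 2 ≤ |η| ^ (-(1 / 4) : ℝ) := by
      calc (1 : ℝ) / 2 = 2 ^ (-1 : ℝ) := by rw [Real.rpow_neg_one]; norm_num
        _ ≤ 2 ^ (-(1 / 4) : ℝ) := Real.rpow_le_rpow_of_exponent_le (by norm_num) (by norm_num)
        _ ≤ _ := Real.rpow_le_rpow_of_nonpos hηp h2 (by norm_num)
    have h4 : 2 * V ≤ modeConst R Γ₀ := by
      rw [modeConst]; linarith [Real.sqrt_nonneg (5 * kernelConst R Γ₀)]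
    have h5 := modeConst_pos hR hΓ₀
    calc V * ‖f‖ = 2 * V * (1 / 2 * ‖f‖) := by ring
      _ ≤ _ := by gcongr

end Mode


/-! ### Decomposition into sectors -/

/-- A disjoint cover of a disc subordinate to the three sectors. -/
def sectorPiece (r : ℝ) : Fin 3 → Set Plane :=
  ![planeSector (sectorDir 0) r, planeSector (sectorDir 1) r \ planeSector (sectorDir 0) r,
    planeSector (sectorDir 2) r \ (planeSector (sectorDir 0) r ∪ planeSector (sectorDir 1) r)]

theorem measurableSet_sectorPiece (r : ℝ) (i : Fin 3) : MeasurableSet (sectorPiece r i) := by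
  have h := fun i => measurableSet_planeSector (sectorDir i) r
  fin_cases i
  · exact h 0
  · exact (h 1).diff (h 0)
  · exact (h 2).diff ((h 0).union (h 1))

theorem sectorPiece_subset (r : ℝ) (i : Fin 3) :
    sectorPiece r i ⊆ planeSector (sectorDir i) r := by
  fin_cases i
  · exact subset_rfl
  · exact sdiff_subset
  · exact sdiff_subset

theorem sum_indicator_sectorPiece {r : ℝ} {ξ : Plane} (hξ : ‖ξ‖ ^ 2 ≤ r) (f : Plane → Vec4) :
    ∑ i, (sectorPiece r i).indicator f ξ = f ξ := by
  classical
  obtain ⟨i, hi⟩ := exists_mem_planeSector hξ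
  rw [Fin.sum_univ_three]
  simp only [indicator_apply, sectorPiece, Matrix.cons_val_zero, Matrix.cons_val_one,
    Matrix.cons_val, mem_sdiff, mem_union]
  by_cases h0 : ξ ∈ planeSector (sectorDir 0) r
  · simp [h0]
  by_cases h1 : ξ ∈ planeSector (sectorDir 1) r
  · simp [h0, h1]
  have h2 : ξ ∈ planeSector (sectorDir 2) r := by
    fin_cases i
    · exact absurd hi h0
    · exact absurd hi h1
    · exact hi
  simp [h0, h1, h2]

/-- The part of `f` in one of the three pieces of the disc. -/
def sectorPart (r : ℝ) (f : Lp Vec4 2 (volume : Measure Plane)) (i : Fin 3) :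
    Lp Vec4 2 (volume : Measure Plane) :=
  toL2 volume ((sectorPiece r i).indicator f)

theorem coeFn_sectorPart (r : ℝ) (f : Lp Vec4 2 (volume : Measure Plane)) (i : Fin 3) :
    sectorPart r f i =ᵐ[volume] (sectorPiece r i).indicator f :=
  coeFn_toL2 ((Lp.memLp f).indicator (measurableSet_sectorPiece r i))

theorem norm_sectorPart_le (r : ℝ) (f : Lp Vec4 2 (volume : Measure Plane)) (i : Fin 3) :
    ‖sectorPart r f i‖ ≤ ‖f‖ := by
  refine Lp.norm_le_norm_of_ae_le ?_
  filter_upwards [coeFn_sectorPart r f i] with ξ h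
  rw [h]
  exact norm_indicator_le_norm_self _ _

theorem sectorPart_zero (r : ℝ) (i : Fin 3) : sectorPart r 0 i = 0 := by
  have h := norm_sectorPart_le r 0 i
  rw [norm_zero] at h
  exact norm_le_zero_iff.1 h

theorem sectorPart_ae_eq_zero (r : ℝ) (f : Lp Vec4 2 (volume : Measure Plane)) (i : Fin 3) :
    ∀ᵐ ξ : Plane, ξ ∉ planeSector (sectorDir i) r → sectorPart r f i ξ = 0 := by
  filter_upwards [coeFn_sectorPart r f i] with ξ h hξ
  rw [h, indicator_of_notMem fun hm => hξ (sectorPiece_subset r i hm)]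

/-- The second derivative test controls each sector only along its own direction, so the data are
split, and every piece is evaluated through the sector that contains its support. -/
theorem expLp_eq_sum_sectorPart {lam : Plane → ℂ} (hlam : Measurable lam) {L : ℝ}
    (hL : ∀ ξ, ‖lam ξ‖ ≤ L) (t r : ℝ) {f : Lp Vec4 2 (volume : Measure Plane)}
    (hf : ∀ᵐ ξ : Plane, ¬‖ξ‖ ^ 2 ≤ r → f ξ = 0) :
    expLp lam t f = ∑ i, expLp lam t (sectorPart r f i) := by
  refine Lp.ext ?_
  have h1 := ae_all_iff.2 fun i => coeFn_expLp hlam hL t (sectorPart r f i)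
  have h2 := ae_all_iff.2 fun i => coeFn_sectorPart r f i
  filter_upwards [h1, h2, hf, coeFn_expLp hlam hL t f,
    Lp.coeFn_finsetSum Finset.univ fun i => expLp lam t (sectorPart r f i)] with ξ a b c d g
  rw [d, g, Finset.sum_apply]
  simp only [a, b]
  rw [← Finset.smul_sum]
  by_cases hξ : ‖ξ‖ ^ 2 ≤ r
  · rw [sum_indicator_sectorPiece hξ]
  · have : ∀ i, (sectorPiece r i).indicator f ξ = 0 := fun i =>
      indicator_of_notMem (fun hm => hξ (sectorPiece_subset r i hm).2) _
    simp [this, c hξ]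

/-! ### The estimate -/

theorem eLpNorm_sum_Lp_le {ι : Type*} (s : Finset ι) (f : ι → L2Layer) :
    eLpNorm (↑(∑ i ∈ s, f i) : Plane × ℝ → Vec4) ∞ layerMeasure ≤
      ∑ i ∈ s, eLpNorm (f i) ∞ layerMeasure := by
  rw [eLpNorm_congr_ae (Lp.coeFn_finsetSum s f)]
  exact eLpNorm_sum_le (fun i _ => (Lp.memLp (f i)).1) (by norm_num)

section Estimate

variable {bc : VerticalBC} {R Γ₀ Γ η : ℝ} {v₀ Sv₀ : L2Layer}

theorem modePart_ae_eq_zero (hη : η ≠ 0) (hR : 0 < R) (hb : IsBaroclinic bc v₀)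
    (hd : IsDivFree bc v₀) (hs : HasFourierSupportIn bc R v₀) (n : ℤ) (e : Fin 3) :
    ∀ᵐ ξ : Plane, ¬‖ξ‖ ^ 2 ≤ discRadiusSq bc R n → modePart bc η v₀ n e ξ = 0 := by
  filter_upwards [coeFn_modePart hη hb hd n e, ae_layerFourier_of_admissible hb hd hs hR n]
    with ξ a f hξ
  rw [a, f.2.2 (fun h => hξ ((normSq_waveVector_le_iff bc R n ξ).1 h))]
  simp

/-- The weight `1` of the geostrophic piece is charged to `S v₀`, and the gain `|η|^(-1/4)` of the
two oscillating pieces to `(1 - S) v₀`. -/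
theorem modeWeight_mul_norm_modePart_le (hη : η ≠ 0) (hb : IsBaroclinic bc v₀)
    (hd : IsDivFree bc v₀) (hS : IsGeostrophicPart bc η v₀ Sv₀) {n : ℤ} (hn : n ≠ 0)
    (e : Fin 3) : modeWeight η e * ‖modePart bc η v₀ n e‖ ≤
      |η| ^ (-(1 / 4) : ℝ) * ‖v₀ - Sv₀‖ + ‖Sv₀‖ := by
  have hw : 0 ≤ |η| ^ (-(1 / 4) : ℝ) := by positivity
  by_cases he : e = 0
  · rw [modeWeight, if_pos he, one_mul]
    have h : ‖modePart bc η v₀ n e‖ ≤ ‖layerFourier bc Sv₀ n‖ := by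
      refine Lp.norm_le_norm_of_ae_le ?_
      filter_upwards [coeFn_modePart hη hb hd n e, hS n] with ξ a b
      rw [a, he, modeProj_zero, geoProj_mulVec, ← b]
    have h2 := norm_layerFourier_le bc n Sv₀
    have h3 : 0 ≤ |η| ^ (-(1 / 4) : ℝ) * ‖v₀ - Sv₀‖ := by positivity
    linarith
  · rw [modeWeight, if_neg he]
    have h : ‖modePart bc η v₀ n e‖ ≤ ‖layerFourier bc (v₀ - Sv₀) n‖ := by
      have e1 : layerFourier bc (v₀ - Sv₀) n = layerFourier bc v₀ n - layerFourier bc Sv₀ n :=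
        map_sub (layerFourierL bc n) v₀ Sv₀
      rw [e1]
      refine Lp.norm_le_norm_of_ae_le ?_
      filter_upwards [coeFn_modePart hη hb hd n e, hS n, hd n,
        Lp.coeFn_sub (layerFourier bc v₀ n) (layerFourier bc Sv₀ n)] with ξ a b c d
      have h4 := norm_modeProj_le bc hη (waveVector_two_ne_zero bc hn ξ) c he
      rw [geoProj_mulVec, ← b, WithLp.toLp_sub] at h4
      rw [a, d]
      exact h4
    have h2 := mul_le_mul_of_nonneg_left (h.trans (norm_layerFourier_le bc n (v₀ - Sv₀))) hw
    linarith [norm_nonneg Sv₀]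

theorem eLpNorm_explicitSol_le (hη : η ≠ 0) (hR : 0 < R) (hb : IsBaroclinic bc v₀)
    (hd : IsDivFree bc v₀) (hs : HasFourierSupportIn bc R v₀) (t : ℝ) :
    eLpNorm (explicitSol bc R Γ η v₀ t) ∞ layerMeasure ≤
      ∑ n ∈ Finset.Icc (-(⌈R⌉₊ : ℤ)) ⌈R⌉₊, ∑ e : Fin 3, ∑ i : Fin 3, ∑ j : Fin 4,
        modeSup (modeRate bc R Γ η n e) (planeSector (sectorDir i) (discRadiusSq bc R n))
          (EuclideanSpace.single j 1) (sectorPart (discRadiusSq bc R n)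
            (modePart bc η v₀ n e) i) t := by
  refine (eLpNorm_sum_Lp_le _ _).trans (Finset.sum_le_sum fun n _ => ?_)
  let T : Lp Vec4 2 (volume : Measure Plane) →L[ℂ] L2Layer := (vertSynth bc n).comp
    (Lp.fourierTransformₗᵢ Plane Vec4).symm.toLinearIsometry.toContinuousLinearMap
  have hsum : vertSynth bc n (𝓕⁻ (solMode bc R Γ η v₀ n t)) = ∑ e : Fin 3, ∑ i : Fin 3,
      vertSynth bc n (𝓕⁻ (expLp (modeRate bc R Γ η n e) t
        (sectorPart (discRadiusSq bc R n) (modePart bc η v₀ n e) i))) := by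
    change T (∑ e, expLp (modeRate bc R Γ η n e) t (modePart bc η v₀ n e)) =
      ∑ e : Fin 3, ∑ i : Fin 3, T _
    rw [map_sum]
    refine Finset.sum_congr rfl fun e _ => ?_
    rw [expLp_eq_sum_sectorPart (measurable_modeRate bc R Γ η n e)
      (norm_modeRate_le bc R Γ η n e) t _ (modePart_ae_eq_zero hη hR hb hd hs n e), map_sum]
  rw [hsum]
  refine (eLpNorm_sum_Lp_le _ _).trans (Finset.sum_le_sum fun e _ => ?_)
  refine (eLpNorm_sum_Lp_le _ _).trans (Finset.sum_le_sum fun i _ => ?_)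
  exact eLpNorm_vertSynth_le bc n (measurable_modeRate bc R Γ η n e)
    (norm_modeRate_le bc R Γ η n e) (measurableSet_planeSector _ _)
    (volume_planeSector_ne_top hR.le (discRadiusSq_le bc R n)) t (sectorPart_ae_eq_zero _ _ i)

theorem lintegral_modeSup_sectorPart_le (hR : 0 < R) (hΓ₀ : 0 < Γ₀) (hΓ : Γ₀ ≤ |Γ|)
    (hη : η ≠ 0) (hb : IsBaroclinic bc v₀) (hd : IsDivFree bc v₀)
    (hs : HasFourierSupportIn bc R v₀) (hS : IsGeostrophicPart bc η v₀ Sv₀) (n : ℤ)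
    (e i : Fin 3) (j : Fin 4) :
    ∫⁻ t in Ioi (0 : ℝ), modeSup (modeRate bc R Γ η n e)
      (planeSector (sectorDir i) (discRadiusSq bc R n)) (EuclideanSpace.single j 1)
      (sectorPart (discRadiusSq bc R n) (modePart bc η v₀ n e) i) t ≤
      ENNReal.ofReal (modeConst R Γ₀ *
        (|η| ^ (-(1 / 4) : ℝ) * ‖v₀ - Sv₀‖ + ‖Sv₀‖)) := by
  by_cases hn : n = 0
  · have h0 : modePart bc η v₀ n e = 0 := by
      refine modePart_eq_zero hη hb hd ?_ e
      filter_upwards [ae_layerFourier_of_admissible hb hd hs hR n] with ξ f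
      exact f.2.1 hn
    simp [h0, sectorPart_zero, modeSup_zero]
  refine (lintegral_modeSup_le hR hΓ₀ hΓ hη hn (norm_sectorDir i) (by simp) _).trans
    (ENNReal.ofReal_le_ofReal ?_)
  have hC := modeConst_pos hR hΓ₀
  have hw : 0 ≤ modeWeight η e := by unfold modeWeight; split_ifs <;> positivity
  refine mul_le_mul_of_nonneg_left ?_ hC.le
  exact (mul_le_mul_of_nonneg_left (norm_sectorPart_le _ _ i) hw).trans
    (modeWeight_mul_norm_modePart_le hη hb hd hS hn e)

theorem normL1Linfty_explicitSol_le (hR : 0 < R) (hΓ₀ : 0 < Γ₀) (hΓ : Γ₀ ≤ |Γ|)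
    (hη : η ≠ 0) (hb : IsBaroclinic bc v₀) (hd : IsDivFree bc v₀)
    (hs : HasFourierSupportIn bc R v₀) (hS : IsGeostrophicPart bc η v₀ Sv₀) :
    normL1Linfty (explicitSol bc R Γ η v₀) ≤ ENNReal.ofReal
      ((2 * ⌈R⌉₊ + 1 : ℕ) * 36 * modeConst R Γ₀ *
        (|η| ^ (-(1 / 4) : ℝ) * ‖v₀ - Sv₀‖ + ‖Sv₀‖)) := by
  set X := modeConst R Γ₀ * (|η| ^ (-(1 / 4) : ℝ) * ‖v₀ - Sv₀‖ + ‖Sv₀‖) with hX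
  have hm : ∀ n e (i : Fin 3) (j : Fin 4), Measurable (modeSup (modeRate bc R Γ η n e)
      (planeSector (sectorDir i) (discRadiusSq bc R n)) (EuclideanSpace.single j 1)
      (sectorPart (discRadiusSq bc R n) (modePart bc η v₀ n e) i)) := fun n e i j =>
    measurable_modeSup (measurable_modeRate bc R Γ η n e) (norm_modeRate_le bc R Γ η n e) _ _ _
  have hm1 := fun n e i => Finset.measurable_fun_sum Finset.univ fun j _ => hm n e i j
  have hm2 := fun n e => Finset.measurable_fun_sum Finset.univ fun i _ => hm1 n e i
  have hm3 := fun n => Finset.measurable_fun_sum Finset.univ fun e _ => hm2 n e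
  refine (lintegral_mono fun t => eLpNorm_explicitSol_le (Γ := Γ) hη hR hb hd hs t).trans ?_
  rw [lintegral_finsetSum _ fun n _ => hm3 n]
  simp_rw [lintegral_finsetSum _ fun e _ => hm2 _ e, lintegral_finsetSum _ fun i _ => hm1 _ _ i,
    lintegral_finsetSum _ fun j _ => hm _ _ _ j]
  calc _ ≤ ∑ n ∈ Finset.Icc (-(⌈R⌉₊ : ℤ)) ⌈R⌉₊, ∑ e : Fin 3, ∑ i : Fin 3, ∑ j : Fin 4,
        ENNReal.ofReal X := by
        gcongr with n _ e _ i _ j _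
        exact lintegral_modeSup_sectorPart_le hR hΓ₀ hΓ hη hb hd hs hS n e i j
    -- There are `2⌈R⌉₊ + 1` vertical modes and `36 = 3 · 3 · 4` combinations of eigenspace, sector
    -- and component.
    _ = ENNReal.ofReal ((2 * ⌈R⌉₊ + 1 : ℕ) * 36 * X) := by
        have hcard : (Finset.Icc (-(⌈R⌉₊ : ℤ)) ⌈R⌉₊).card = 2 * ⌈R⌉₊ + 1 := by
          rw [Int.card_Icc]; omega
        simp only [Finset.sum_const, hcard, Finset.card_univ, Fintype.card_fin, nsmul_eq_mul]
        clear_value X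
        rw [ENNReal.ofReal_mul (by positivity), ENNReal.ofReal_mul (by positivity),
          ENNReal.ofReal_natCast, ENNReal.ofReal_ofNat]
        push_cast
        ring
    _ = _ := by rw [hX, ← mul_assoc]

end Estimate

end RotatingStratified

end

/-! ### The main estimate -/

theorem mainTheorem8 (bc : RotatingStratified.VerticalBC) (R Γ₀ : ℝ) (hR : 0 < R) (hΓ₀ : 0 < Γ₀) :
    ∃ C : ℝ, 0 < C ∧
      ∀ Γ Ω : ℝ, Γ₀ ≤ |Γ| → Ω ≠ 0 →
      ∀ v₀ : RotatingStratified.L2Layer,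
        RotatingStratified.IsBaroclinic bc v₀ →
        RotatingStratified.IsDivFree bc v₀ →
        RotatingStratified.HasFourierSupportIn bc R v₀ →
        (∃ Sv₀, RotatingStratified.IsGeostrophicPart bc (Ω / Γ) v₀ Sv₀) ∧
        (∃ v, RotatingStratified.IsSolution bc Γ Ω v₀ v) ∧
        ∀ (Sv₀ : RotatingStratified.L2Layer) (v : ℝ → RotatingStratified.L2Layer),
          RotatingStratified.IsGeostrophicPart bc (Ω / Γ) v₀ Sv₀ →
          RotatingStratified.IsSolution bc Γ Ω v₀ v →
          RotatingStratified.normL1Linfty v ≤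
            ENNReal.ofReal (C * (|Ω / Γ| ^ (-(1 / 4) : ℝ) * ‖v₀ - Sv₀‖ + ‖Sv₀‖)) := by
  refine ⟨(2 * ⌈R⌉₊ + 1 : ℕ) * 36 * RotatingStratified.modeConst R Γ₀, ?_, ?_⟩
  · have := RotatingStratified.modeConst_pos hR hΓ₀
    positivity
  intro Γ Ω hΓ hΩ v₀ hb hd hs
  have hΓ0 : Γ ≠ 0 := abs_pos.1 (hΓ₀.trans_le hΓ)
  have hη : Ω / Γ ≠ 0 := div_ne_zero hΩ hΓ0
  have hsol := RotatingStratified.isSolution_explicitSol rfl hη hR hb hd hs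
  refine ⟨RotatingStratified.exists_isGeostrophicPart hη hb hd hs, ⟨_, hsol⟩,
    fun Sv₀ v hS hv => ?_⟩
  refine le_trans (le_of_eq ?_)
    (RotatingStratified.normL1Linfty_explicitSol_le hR hΓ₀ hΓ hη hb hd hs hS)
  -- Uniqueness transfers the bound from the explicit solution to an arbitrary one; only positive
  -- times enter the norm.
  refine MeasureTheory.setLIntegral_congr_fun measurableSet_Ioi fun t ht => ?_
  rw [hv.unique hsol (Set.mem_Ioi.1 ht).le]
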